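/- There are a single randomized algorithm $A$ and absolute constants $C>0$, $c\in\mathbb N$ with the following property. Let $q$ be a power of an odd prime $p$, let $\mathbb F=\mathbb F_q$ be presented as $\mathbb F_p(\theta)$ by $p$ and the minimal polynomial of a generator $\theta$ over $\mathbb F_p$, let $k=2^\ell$ with $\ell\in\mathbb N$, and let $0<\delta\le 1$. On input this presentation, $\ell$ and the integer $\lceil\log_2(1/\delta)\rceil$, the algorithm $A$ uses at most $C\,(k\log_2 q+\log_2(1/\delta))$ uniform random bits and always halts within time $C\,(k\log_2 q+\log_2(1/\delta))^c$, on a random access machine with logarithmic cost. On every string of random bits it either declares failure or outputs polynomials $p_1,\dots,p_\ell\in\mathbb F[w_1,\dots,w_\ell]$, written as lists of terms, such that - the ideal $P=(p_1,\dots,p_\ell)$ of $\mathbb F[w_1,\dots,w_\ell]$ is maximal, and $\mathbb F[w_1,\dots,w_\ell]/P$ is a field extension of $\mathbb F$ of degree $k$; - for every $1\le i\le\ell$, $p_i=w_i^2-h_i$, where $h_i\in\mathbb F[w_1,\dots,w_{i-1}]$ has total degree at most $i-1$. The probability that it outputs such polynomials is at least $1-\delta$. -/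

import Mathlib

/-! ### Probabilistic random access machines with logarithmic cost -/

namespace RAM

/-- Arithmetic instructions of the machine (subtraction is truncated at zero; division is
rounded down). -/
inductive Op where
  | add
  | sub
  | mul
  | div
  | mod

/-- The value of an arithmetic instruction. -/
def Op.apply : Op → ℕ → ℕ → ℕ
  | .add, x, y => x + y
  | .sub, x, y => x - y
  | .mul, x, y => x * y
  | .div, x, y => x / y
  | .mod, x, y => x % y

/-- Structured programs for a random access machine whose memory cells, indexed by `ℕ`, hold
natural numbers. The arguments `d`, `a`, `b` are fixed addresses of cells. -/
inductive Prog where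
  /-- do nothing -/
  | skip
  /-- `M[d] := n` -/
  | const (d n : ℕ)
  /-- `M[d] := M[a] o M[b]` -/
  | arith (o : Op) (d a b : ℕ)
  /-- `M[d] := M[M[a]]` -/
  | load (d a : ℕ)
  /-- `M[M[a]] := M[b]` -/
  | store (a b : ℕ)
  /-- read the next number of the input tape into `M[d]` -/
  | read (d : ℕ)
  /-- append `M[a]` to the output tape -/
  | write (a : ℕ)
  /-- toss a coin: store the next random bit in `M[d]` -/
  | toss (d : ℕ)
  /-- sequential composition -/
  | seq (c₁ c₂ : Prog)
  /-- if `M[a] ≠ 0` then `c₁` else `c₂` -/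
  | cond (a : ℕ) (c₁ c₂ : Prog)
  /-- while `M[a] ≠ 0` do `c` -/
  | loop (a : ℕ) (c : Prog)

/-- Configurations: the memory, the unread part of the input tape, the unused random bits, and
the numbers written so far on the output tape. -/
structure State where
  mem : ℕ → ℕ
  input : List ℕ
  coins : List Bool
  output : List ℕ

/-- The state in which `M[d]` has been set to `n`. -/
def State.put (s : State) (d n : ℕ) : State :=
  { s with mem := Function.update s.mem d n }

/-- The initial state: empty memory and output, the given input tape and random bits. -/
def State.init (input : List ℕ) (coins : List Bool) : State :=
  { mem := fun _ => 0, input := input, coins := coins, output := [] }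

/-- `Exec c s s' t`: the program `c`, started in `s`, halts in `s'`, and the run costs `t`.
Costs are logarithmic: each instruction is charged one plus the bit lengths of the numbers
(including computed addresses) that it handles. Reading from an exhausted input tape, or tossing
a coin when all random bits have been used, is not possible. -/
inductive Exec : Prog → State → State → ℕ → Prop
  | skip (s : State) : Exec .skip s s 1
  | const (d n : ℕ) (s : State) : Exec (.const d n) s (s.put d n) (1 + n.size)
  | arith (o : Op) (d a b : ℕ) (s : State) :
      Exec (.arith o d a b) s (s.put d (o.apply (s.mem a) (s.mem b)))
        (1 + (s.mem a).size + (s.mem b).size + (o.apply (s.mem a) (s.mem b)).size)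
  | load (d a : ℕ) (s : State) :
      Exec (.load d a) s (s.put d (s.mem (s.mem a)))
        (1 + (s.mem a).size + (s.mem (s.mem a)).size)
  | store (a b : ℕ) (s : State) :
      Exec (.store a b) s (s.put (s.mem a) (s.mem b)) (1 + (s.mem a).size + (s.mem b).size)
  | read (d n : ℕ) (rest : List ℕ) (s : State) (h : s.input = n :: rest) :
      Exec (.read d) s ({ s with input := rest }.put d n) (1 + n.size)
  | write (a : ℕ) (s : State) :
      Exec (.write a) s { s with output := s.output ++ [s.mem a] } (1 + (s.mem a).size)
  | toss (d : ℕ) (b : Bool) (rest : List Bool) (s : State) (h : s.coins = b :: rest) :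
      Exec (.toss d) s ({ s with coins := rest }.put d b.toNat) 2
  | seq {c₁ c₂ : Prog} {s₁ s₂ s₃ : State} {t₁ t₂ : ℕ}
      (h₁ : Exec c₁ s₁ s₂ t₁) (h₂ : Exec c₂ s₂ s₃ t₂) : Exec (.seq c₁ c₂) s₁ s₃ (t₁ + t₂)
  | condTrue {a : ℕ} {c₁ c₂ : Prog} {s s' : State} {t : ℕ}
      (h : s.mem a ≠ 0) (h₁ : Exec c₁ s s' t) :
      Exec (.cond a c₁ c₂) s s' (1 + (s.mem a).size + t)
  | condFalse {a : ℕ} {c₁ c₂ : Prog} {s s' : State} {t : ℕ}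
      (h : s.mem a = 0) (h₂ : Exec c₂ s s' t) :
      Exec (.cond a c₁ c₂) s s' (1 + (s.mem a).size + t)
  | loopStop {a : ℕ} {c : Prog} {s : State} (h : s.mem a = 0) :
      Exec (.loop a c) s s (1 + (s.mem a).size)
  | loopStep {a : ℕ} {c : Prog} {s₁ s₂ s₃ : State} {t₁ t₂ : ℕ} (h : s₁.mem a ≠ 0)
      (h₁ : Exec c s₁ s₂ t₁) (h₂ : Exec (.loop a c) s₂ s₃ t₂) :
      Exec (.loop a c) s₁ s₃ (1 + (s₁.mem a).size + t₁ + t₂)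

/-- On the given input and the given string of random bits, the program halts at cost exactly
`t`, having written exactly `out`. -/
def Prog.Outputs (c : Prog) (input : List ℕ) (coins : List Bool) (out : List ℕ) (t : ℕ) : Prop :=
  ∃ s' : State, Exec c (State.init input coins) s' t ∧ s'.output = out

end RAM

/-! ### Encodings of finite fields and of polynomials -/

namespace Tower

variable {p : ℕ} {F : Type*} [Field F] [Algebra (ZMod p) F]

/-- The input tape. The finite field `F = 𝔽_p(θ)` is presented, as usual, by `p` and the minimal
polynomial `X ^ u + c_{u-1} X ^ (u-1) + ⋯ + c_0` of `θ` over `𝔽_p`. The tape reads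
`p, u, ℓ, e, c_0, …, c_{u-1}`, with residues mod `p` written as numbers below `p`. -/
noncomputable def inputTape (θ : F) (ℓ e : ℕ) : List ℕ :=
  [p, (minpoly (ZMod p) θ).natDegree, ℓ, e] ++
    List.ofFn fun i : Fin (minpoly (ZMod p) θ).natDegree =>
      ((minpoly (ZMod p) θ).coeff i).val

/-- A term: the exponents of `w_1, …, w_ℓ` and the coordinates of the coefficient. -/
abbrev Term (p ℓ u : ℕ) := (Fin ℓ → ℕ) × (Fin u → ZMod p)

/-- The polynomial given by a list of terms; the coordinates `a_0, …, a_{u-1}` of a coefficient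
stand for the element `a_0 + a_1 θ + ⋯ + a_{u-1} θ ^ (u-1)` of `F`. -/
noncomputable def polyOf {ℓ u : ℕ} (θ : F) (T : List (Term p ℓ u)) : MvPolynomial (Fin ℓ) F :=
  (T.map fun t => MvPolynomial.monomial (Finsupp.equivFunOnFinite.symm t.1)
    (∑ j : Fin u, algebraMap (ZMod p) F (t.2 j) * θ ^ (j : ℕ))).sum

/-- A list of terms written as numbers: the number of terms, and then for each term its `ℓ`
exponents followed by the `u` coordinates of its coefficient. -/
def codeTerms {ℓ u : ℕ} (T : List (Term p ℓ u)) : List ℕ :=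
  T.length :: T.flatMap fun t => List.ofFn t.1 ++ List.ofFn fun j : Fin u => (t.2 j).val

/-- `IsCode θ P out`: the output `out` consists of the number `1`, followed by codes of the
polynomials `P_1, …, P_ℓ` over `F = 𝔽_p(θ)`. -/
def IsCode (p : ℕ) {F : Type*} [Field F] [Algebra (ZMod p) F] (θ : F) {ℓ : ℕ}
    (P : Fin ℓ → MvPolynomial (Fin ℓ) F) (out : List ℕ) : Prop :=
  ∃ T : Fin ℓ → List (Term p ℓ (minpoly (ZMod p) θ).natDegree),
    (∀ i, polyOf θ (T i) = P i) ∧ out = 1 :: (List.ofFn fun i => codeTerms (T i)).flatten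

/-- `P_1, …, P_ℓ ∈ F[w_1, …, w_ℓ]` generate a maximal ideal whose quotient is a field extension of
`F` of degree `2 ^ ℓ`, and `P_i = w_i ^ 2 - h_i` with `h_i ∈ F[w_1, …, w_{i-1}]` of total degree at
most `i - 1`. The variables are indexed from `0`, so that `i - 1` is the value of the index. -/
def IsQuadraticTower {F : Type*} [Field F] {ℓ : ℕ} (P : Fin ℓ → MvPolynomial (Fin ℓ) F) : Prop :=
  (Ideal.span (Set.range P)).IsMaximal ∧
  IsField (MvPolynomial (Fin ℓ) F ⧸ Ideal.span (Set.range P)) ∧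
  Module.finrank F (MvPolynomial (Fin ℓ) F ⧸ Ideal.span (Set.range P)) = 2 ^ ℓ ∧
  ∀ i, ∃ h : MvPolynomial (Fin ℓ) F,
    (∀ j ∈ h.vars, j < i) ∧ h.totalDegree ≤ (i : ℕ) ∧ P i = MvPolynomial.X i ^ 2 - h

/-- The output is a code of polynomials `P_1, …, P_ℓ` as required. -/
def IsSuccess (p : ℕ) {F : Type*} [Field F] [Algebra (ZMod p) F] (θ : F) (ℓ : ℕ)
    (out : List ℕ) : Prop :=
  ∃ P : Fin ℓ → MvPolynomial (Fin ℓ) F, IsCode p θ P out ∧ IsQuadraticTower P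

/-- The output by which the program declares failure. -/
def failure : List ℕ := [0]

end Tower

/-! Write `q` for the order of `F`. A tower of quadratic extensions needs one nonsquare only. If `w
^ Q = -w` with `Q % 4 = 1` and `v ^ 2 = -w`, then `v ^ (Q ^ 2) = -v` (`pow_eq_neg_self_of_sq`). So
the property `w_n ^ (q ^ 2 ^ n) = -w_n` passes from each level to the next by adjoining a root of `X
^ 2 + w_n`. For `q % 4 = 1` it starts with `w_0 ^ 2 = -(x ^ 2 + y ^ 2)`, where `x ^ 2 + y ^ 2` is a
nonsquare. For `q % 4 = 3` the passage fails at level 0 only; there `w_0 ^ 2 = -1` and `w_1 ^ 2 =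
-(x + y * w_0)` are taken, and the norm of `x + y * w_0` is the nonsquare `x ^ 2 + y ^ 2`. Thus one
kind of pair `(x, y)` serves both cases. The property gives `w_n` a Frobenius orbit of length
exactly `2 ^ (n + 1)`, which bounds the degree from below, while the squarefree monomials bound it
from above (`isField_of_rel`).

At most 7/9 of the pairs over `F` are bad. Independent pairs would cost about `log q` random bits
each, too many for a linear bound. Instead the pairs are the vertices of a walk on the square of
`ZMod M`, where `M` is the least power of two that is at least `16 * q`: the start costs `2 * log M`
bits and each step four bits. The sixteen maps of the walk have a spectral gap (`exists_gen`, an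
argument in the style of Gabber and Galil), so that a walk of `e * 2 ^ 19 + 1` vertices has only bad
pairs with probability at most `2 ^ (-e)` (`sum_stay_le`).

On the machine a field element is one number, whose digits in a large base are its coordinates.
Multiplication of numbers is then multiplication of polynomials in `θ`, and nonsquares are
recognized by Euler's criterion. Running times are numbers of instructions (cubic in the size `n` of
the problem) times the cost of one instruction on numbers of `L` bits (`L` quadratic in `n`), whence
the exponent 5. -/

set_option linter.unusedSimpArgs false

/-! ### Running programs within a bit bound and a step bound -/

namespace RAM

/-- Sequential composition of a list of programs. -/
def blk : List Prog → Prog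
  | [] => .skip
  | [c] => c
  | c :: d :: cs => .seq c (blk (d :: cs))

/-- The cells that a program without `store` may change. -/
def Prog.cells : Prog → List ℕ
  | .const d _ | .arith _ d _ _ | .load d _ | .read d | .toss d => [d]
  | .seq c₁ c₂ | .cond _ c₁ c₂ => c₁.cells ++ c₂.cells
  | .loop _ c => c.cells
  | _ => []

/-- The program does not contain `store`. -/
def Prog.direct : Prog → Bool
  | .store _ _ => false
  | .seq c₁ c₂ | .cond _ c₁ c₂ => c₁.direct && c₂.direct
  | .loop _ c => c.direct
  | _ => true

/-- The program does not touch the input tape and the random bits. -/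
def Prog.closed : Prog → Bool
  | .read _ | .toss _ => false
  | .seq c₁ c₂ | .cond _ c₁ c₂ => c₁.closed && c₂.closed
  | .loop _ c => c.closed
  | _ => true

/-- The program does not touch the output tape. -/
def Prog.silent : Prog → Bool
  | .write _ => false
  | .seq c₁ c₂ | .cond _ c₁ c₂ => c₁.silent && c₂.silent
  | .loop _ c => c.silent
  | _ => true

/-- What a run of `c` from `s` to `s'` leaves unchanged, judging by the text of `c`. -/
structure Frame (c : Prog) (s s' : State) : Prop where
  mem : c.direct = true → ∀ r ∉ c.cells, s'.mem r = s.mem r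
  coins : c.closed = true → s'.coins = s.coins
  input : c.closed = true → s'.input = s.input
  output : c.silent = true → s'.output = s.output

theorem Frame.refl (c : Prog) (s : State) : Frame c s s :=
  ⟨fun _ _ _ => rfl, fun _ => rfl, fun _ => rfl, fun _ => rfl⟩

theorem Frame.trans {c : Prog} {s₁ s₂ s₃ : State} (h : Frame c s₁ s₂) (h' : Frame c s₂ s₃) :
    Frame c s₁ s₃ :=
  ⟨fun hc r hr => (h'.mem hc r hr).trans (h.mem hc r hr),
    fun hc => (h'.coins hc).trans (h.coins hc), fun hc => (h'.input hc).trans (h.input hc),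
    fun hc => (h'.output hc).trans (h.output hc)⟩

/-- Loop invariants can thus be restricted to the cells that matter. All other cells are recovered
from here, with side conditions that are decided by evaluating the text of the program. -/
theorem Exec.frame {c : Prog} {s s' : State} {t : ℕ} (h : Exec c s s' t) : Frame c s s' := by
  induction h with
  | skip | write | loopStop => constructor <;> simp [Prog.cells, Prog.silent]
  | const | arith | load | store | read | toss =>
    constructor <;>
      simp +contextual [Prog.cells, Prog.silent, Prog.closed, Prog.direct, State.put]
  | seq _ _ h₁ h₂ =>
    constructor
    · intro hc r hr
      simp only [Prog.direct, Prog.cells, Bool.and_eq_true, List.mem_append, not_or] at hc hr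
      rw [h₂.mem hc.2 r hr.2, h₁.mem hc.1 r hr.1]
    all_goals
      intro hc
      simp only [Prog.closed, Prog.silent, Bool.and_eq_true] at hc
    · rw [h₂.coins hc.2, h₁.coins hc.1]
    · rw [h₂.input hc.2, h₁.input hc.1]
    · rw [h₂.output hc.2, h₁.output hc.1]
  | condTrue _ _ h₁ =>
    constructor
    · intro hc r hr
      simp only [Prog.direct, Prog.cells, Bool.and_eq_true, List.mem_append, not_or] at hc hr
      exact h₁.mem hc.1 r hr.1
    all_goals
      intro hc
      simp only [Prog.closed, Prog.silent, Bool.and_eq_true] at hc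
    · exact h₁.coins hc.1
    · exact h₁.input hc.1
    · exact h₁.output hc.1
  | condFalse _ _ h₁ =>
    constructor
    · intro hc r hr
      simp only [Prog.direct, Prog.cells, Bool.and_eq_true, List.mem_append, not_or] at hc hr
      exact h₁.mem hc.2 r hr.2
    all_goals
      intro hc
      simp only [Prog.closed, Prog.silent, Bool.and_eq_true] at hc
    · exact h₁.coins hc.2
    · exact h₁.input hc.2
    · exact h₁.output hc.2
  | loopStep _ _ _ h₁ h₂ =>
    constructor
    · intro hc r hr
      rw [h₂.mem hc r hr]
      exact h₁.mem (by simpa [Prog.direct] using hc) r (by simpa [Prog.cells] using hr)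
    · intro hc
      rw [h₂.coins hc]
      exact h₁.coins (by simpa [Prog.closed] using hc)
    · intro hc
      rw [h₂.input hc]
      exact h₁.input (by simpa [Prog.closed] using hc)
    · intro hc
      rw [h₂.output hc]
      exact h₁.output (by simpa [Prog.silent] using hc)

/-- `Runs L c s k Q`: started in `s`, the program `c` halts in a state with the property `Q`, at
the cost of at most `k` instructions that handle numbers of at most `L` bits. -/
def Runs (L : ℕ) (c : Prog) (s : State) (k : ℕ) (Q : State → Prop) : Prop :=
  ∃ s' t, Exec c s s' t ∧ t ≤ k * (3 * L + 1) ∧ Q s'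

theorem Runs.mono {L : ℕ} {c : Prog} {s : State} {k k' : ℕ} {Q Q' : State → Prop}
    (h : Runs L c s k Q) (hk : k ≤ k') (hQ : ∀ s', Frame c s s' → Q s' → Q' s') :
    Runs L c s k' Q' := by
  obtain ⟨s', t, he, ht, hq⟩ := h
  exact ⟨s', t, he, ht.trans (Nat.mul_le_mul_right _ hk), hQ s' he.frame hq⟩

theorem Runs.seq {L : ℕ} {c₁ c₂ : Prog} {s : State} {k₁ k₂ : ℕ} {Q₁ Q : State → Prop}
    (h₁ : Runs L c₁ s k₁ Q₁) (h₂ : ∀ s', Frame c₁ s s' → Q₁ s' → Runs L c₂ s' k₂ Q) :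
    Runs L (.seq c₁ c₂) s (k₁ + k₂) Q := by
  obtain ⟨s', t, he, ht, hq⟩ := h₁
  obtain ⟨s'', t', he', ht', hq'⟩ := h₂ s' he.frame hq
  exact ⟨s'', t + t', .seq he he', by rw [add_mul]; omega, hq'⟩

/-- The weakest precondition of a program without loops and indirect addressing. -/
def Prog.wp (L : ℕ) : Prog → (State → Prop) → State → Prop
  | .skip, Q, s => Q s
  | .const d n, Q, s => n < 2 ^ L ∧ Q (s.put d n)
  | .arith o d a b, Q, s => s.mem a < 2 ^ L ∧ s.mem b < 2 ^ L ∧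
      o.apply (s.mem a) (s.mem b) < 2 ^ L ∧ Q (s.put d (o.apply (s.mem a) (s.mem b)))
  | .read d, Q, s => ∃ n rest, s.input = n :: rest ∧ n < 2 ^ L ∧
      Q ({ s with input := rest }.put d n)
  | .write a, Q, s => s.mem a < 2 ^ L ∧ Q { s with output := s.output ++ [s.mem a] }
  | .toss d, Q, s => ∃ b rest, s.coins = b :: rest ∧ Q ({ s with coins := rest }.put d b.toNat)
  | .seq c₁ c₂, Q, s => c₁.wp L (c₂.wp L Q) s
  | .cond a c₁ c₂, Q, s => s.mem a < 2 ^ L ∧ (s.mem a ≠ 0 → c₁.wp L Q s) ∧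
      (s.mem a = 0 → c₂.wp L Q s)
  | _, _, _ => False

/-- The number of instructions of a program. -/
def Prog.len : Prog → ℕ
  -- A toss costs 2, which a single unit `3 * L + 1` would not cover for `L = 0`.
  | .toss _ => 2
  | .seq c₁ c₂ => c₁.len + c₂.len
  | .cond _ c₁ c₂ => 1 + (c₁.len + c₂.len)
  | _ => 1

/-- Code without loops is verified by unfolding `wp`, which leaves arithmetic only. Both branches of
a conditional are charged, so that the count does not depend on the state. -/
theorem Runs.of_wp {L : ℕ} {c : Prog} {s : State} {Q : State → Prop} (h : c.wp L Q s) :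
    Runs L c s c.len Q := by
  induction c generalizing s Q with
  | skip => exact ⟨s, _, .skip s, by simp [Prog.len], h⟩
  | const d n =>
    refine ⟨_, _, .const d n s, ?_, h.2⟩
    have := Nat.size_le.2 h.1
    simp only [Prog.len]; omega
  | arith o d a b =>
    obtain ⟨h₁, h₂, h₃, h⟩ := h
    refine ⟨_, _, .arith o d a b s, ?_, h⟩
    have := Nat.size_le.2 h₁
    have := Nat.size_le.2 h₂
    have := Nat.size_le.2 h₃
    simp only [Prog.len]; omega
  | read d =>
    obtain ⟨n, rest, hi, hn, h⟩ := h
    refine ⟨_, _, .read d n rest s hi, ?_, h⟩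
    have := Nat.size_le.2 hn
    simp only [Prog.len]; omega
  | write a =>
    refine ⟨_, _, .write a s, ?_, h.2⟩
    have := Nat.size_le.2 h.1
    simp only [Prog.len]; omega
  | toss d =>
    obtain ⟨b, rest, hi, h⟩ := h
    exact ⟨_, _, .toss d b rest s hi, by simp only [Prog.len]; omega, h⟩
  | seq c₁ c₂ ih₁ ih₂ => exact Runs.seq (ih₁ h) fun s' _ h' => ih₂ h'
  | cond a c₁ c₂ ih₁ ih₂ =>
    obtain ⟨h₁, h₂, h₃⟩ := h
    have hs := Nat.size_le.2 h₁
    by_cases ha : s.mem a = 0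
    · obtain ⟨s', t, he, ht, hq⟩ := ih₂ (h₃ ha)
      refine ⟨s', _, .condFalse ha he, ?_, hq⟩
      simp only [Prog.len, add_mul]; omega
    · obtain ⟨s', t, he, ht, hq⟩ := ih₁ (h₂ ha)
      refine ⟨s', _, .condTrue ha he, ?_, hq⟩
      simp only [Prog.len, add_mul]; omega
  | load | store | loop => exact h.elim

theorem Runs.cond {L a : ℕ} {c₁ c₂ : Prog} {s : State} {k : ℕ} {Q : State → Prop}
    (ha : s.mem a < 2 ^ L) (h₁ : s.mem a ≠ 0 → Runs L c₁ s k Q)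
    (h₂ : s.mem a = 0 → Runs L c₂ s k Q) : Runs L (.cond a c₁ c₂) s (1 + k) Q := by
  have hs := Nat.size_le.2 ha
  by_cases h0 : s.mem a = 0
  · obtain ⟨s', t, he, ht, hq⟩ := h₂ h0
    refine ⟨s', _, .condFalse h0 he, ?_, hq⟩
    rw [add_mul]; omega
  · obtain ⟨s', t, he, ht, hq⟩ := h₁ h0
    refine ⟨s', _, .condTrue h0 he, ?_, hq⟩
    rw [add_mul]; omega

/-- The rule for loops: `I n` holds before the last `n` rounds. -/
theorem Runs.loop {L a : ℕ} {c : Prog} (I : ℕ → State → Prop) {k : ℕ} {n : ℕ} {s : State}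
    (hI : I n s)
    (step : ∀ i s', i < n → Frame c s s' → I (i + 1) s' →
      s'.mem a ≠ 0 ∧ s'.mem a < 2 ^ L ∧ Runs L c s' k (I i))
    (halt : ∀ s', Frame c s s' → I 0 s' → s'.mem a = 0) :
    Runs L (.loop a c) s (1 + n * (1 + k)) (I 0) := by
  induction n generalizing s with
  | zero =>
    have h := halt s (Frame.refl c s) hI
    exact ⟨s, _, .loopStop h, by simp [h], hI⟩
  | succ n ih =>
    obtain ⟨h0, hb, s', t, he, ht, hq⟩ := step n s (Nat.lt_succ_self n) (Frame.refl c s) hI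
    obtain ⟨s'', t', he', ht', hq'⟩ := ih hq
      (fun i s₁ hi hf h => step i s₁ (hi.trans (Nat.lt_succ_self n)) (he.frame.trans hf) h)
      (fun s₁ hf h => halt s₁ (he.frame.trans hf) h)
    refine ⟨s'', _, .loopStep h0 he he', ?_, hq'⟩
    have hs := Nat.size_le.2 hb
    calc 1 + (s.mem a).size + t + t'
        ≤ (3 * L + 1) + k * (3 * L + 1) + (1 + n * (1 + k)) * (3 * L + 1) := by omega
      _ = (1 + (n + 1) * (1 + k)) * (3 * L + 1) := by ring

end RAM

/-! ### Packed representations of field elements -/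

namespace Tower

open Finset

/-- The number with the digits `f 0, …, f (D - 1)` in base `B`, the most significant digit
first. -/
def pack (B D : ℕ) (f : ℕ → ℕ) : ℕ := ∑ i ∈ range D, f i * B ^ (D - 1 - i)

theorem pack_zero (B : ℕ) (f : ℕ → ℕ) : pack B 0 f = 0 := by simp [pack]

/-- Appending a digit is a Horner step, because the last digit is the least significant;
`pack_succ'` splits off the most significant one. -/
theorem pack_succ (B D : ℕ) (f : ℕ → ℕ) : pack B (D + 1) f = f D + B * pack B D f := by
  simp only [pack, sum_range_succ, mul_sum]
  rw [add_comm]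
  congr 1
  · simp
  · refine sum_congr rfl fun i hi => ?_
    have : D + 1 - 1 - i = (D - 1 - i) + 1 := by have := mem_range.1 hi; omega
    rw [this, pow_succ]; ring

theorem pack_succ' (B D : ℕ) (f : ℕ → ℕ) :
    pack B (D + 1) f = f 0 * B ^ D + pack B D fun i => f (i + 1) := by
  simp only [pack, sum_range_succ']
  rw [add_comm]
  congr 1
  refine sum_congr rfl fun i hi => ?_
  congr 2
  have := mem_range.1 hi; omega

theorem pack_congr {B D : ℕ} {f g : ℕ → ℕ} (h : ∀ i < D, f i = g i) : pack B D f = pack B D g :=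
  sum_congr rfl fun i hi => by rw [h i (mem_range.1 hi)]

theorem pack_lt {B D : ℕ} {f : ℕ → ℕ} (h : ∀ i < D, f i < B) : pack B D f < B ^ D := by
  induction D with
  | zero => simp [pack]
  | succ D ih =>
    have h₁ := ih fun i hi => h i (by omega)
    have h₂ := h D (by omega)
    rw [pack_succ, pow_succ']
    calc f D + B * pack B D f < B + B * pack B D f := by omega
      _ = B * (pack B D f + 1) := by ring
      _ ≤ B * B ^ D := Nat.mul_le_mul_left _ h₁

theorem pack_add (B D : ℕ) (f g : ℕ → ℕ) :
    pack B D (fun i => f i + g i) = pack B D f + pack B D g := by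
  simp [pack, add_mul, sum_add_distrib]

theorem pack_mod {B D : ℕ} {f : ℕ → ℕ} (h : f D < B) : pack B (D + 1) f % B = f D := by
  rw [pack_succ, Nat.add_mul_mod_self_left, Nat.mod_eq_of_lt h]

theorem pack_div {B D : ℕ} {f : ℕ → ℕ} (h : f D < B) : pack B (D + 1) f / B = pack B D f := by
  rw [pack_succ, Nat.add_mul_div_left _ _ (by omega), Nat.div_eq_of_lt h, zero_add]

theorem pack_inj {B D : ℕ} {f g : ℕ → ℕ} (hf : ∀ i < D, f i < B) (hg : ∀ i < D, g i < B)
    (h : pack B D f = pack B D g) : ∀ i < D, f i = g i := by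
  induction D with
  | zero => simp
  | succ D ih =>
    have h₁ := congrArg (· % B) h
    have h₂ := congrArg (· / B) h
    simp only [pack_mod (hf D D.lt_succ_self), pack_mod (hg D D.lt_succ_self),
      pack_div (hf D D.lt_succ_self), pack_div (hg D D.lt_succ_self)] at h₁ h₂
    intro i hi
    rcases Nat.lt_succ_iff_lt_or_eq.1 hi with hi | rfl
    · exact ih (fun i hi => hf i (by omega)) (fun i hi => hg i (by omega)) h₂ i hi
    · exact h₁

variable {F : Type*} [CommRing F]

/-- The number `Z` is a packed representation, with digits below `R`, of the element `x`, as a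
combination of `1, θ, …, θ ^ (D - 1)`. -/
def Rep (θ : F) (B D R Z : ℕ) (x : F) : Prop :=
  ∃ f : ℕ → ℕ, (∀ i < D, f i < R) ∧ Z = pack B D f ∧ x = ∑ i ∈ range D, (f i : F) * θ ^ i

theorem Rep.lt {θ : F} {B D R Z : ℕ} {x : F} (h : Rep θ B D R Z x) (hR : R ≤ B) : Z < B ^ D := by
  obtain ⟨f, hf, rfl, -⟩ := h
  exact pack_lt fun i hi => (hf i hi).trans_le hR

theorem Rep.val_inj {θ : F} {B D R Z : ℕ} {x x' : F} (h : Rep θ B D R Z x)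
    (h' : Rep θ B D R Z x') (hR : R ≤ B) : x = x' := by
  obtain ⟨f, hf, rfl, rfl⟩ := h
  obtain ⟨g, hg, hfg, rfl⟩ := h'
  refine sum_congr rfl fun i hi => ?_
  rw [pack_inj (fun i hi => (hf i hi).trans_le hR) (fun i hi => (hg i hi).trans_le hR) hfg i
    (mem_range.1 hi)]

theorem Rep.add {θ : F} {B D R R' Z Z' : ℕ} {x x' : F} (h : Rep θ B D R Z x)
    (h' : Rep θ B D R' Z' x') : Rep θ B D (R + R') (Z + Z') (x + x') := by
  obtain ⟨f, hf, rfl, rfl⟩ := h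
  obtain ⟨g, hg, rfl, rfl⟩ := h'
  refine ⟨fun i => f i + g i, fun i hi => ?_, (pack_add _ _ _ _).symm, ?_⟩
  · have := hf i hi
    have := hg i hi
    show f i + g i < R + R'
    omega
  · simp [add_mul, sum_add_distrib]

/-- The Cauchy product, stated so that `Rep.mul` can use it twice with the same digits: over `ℕ`
with powers of the base, and over `F` with powers of `θ`. -/
theorem sum_mul_sum_eq_conv {S : Type*} [CommSemiring S] (u : ℕ) (f g : ℕ → ℕ) (a b c : ℕ → S)
    (h : ∀ i < u, ∀ j < u, a i * b j = c (i + j)) :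
    (∑ i ∈ range u, (f i : S) * a i) * (∑ j ∈ range u, (g j : S) * b j) =
      ∑ k ∈ range (2 * u - 1),
        ((∑ i ∈ range u, if i ≤ k ∧ k - i < u then f i * g (k - i) else 0 : ℕ) : S) * c k := by
  rw [sum_mul_sum]
  simp only [Nat.cast_sum, sum_mul]
  rw [sum_comm (s := range (2 * u - 1))]
  refine sum_congr rfl fun i hi => ?_
  rw [mem_range] at hi
  have h₁ : ∀ k ∈ range (2 * u - 1), k ∉ (range u).image (i + ·) →
      (((if i ≤ k ∧ k - i < u then f i * g (k - i) else 0 : ℕ) : S) * c k) = 0 := by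
    intro k _ hk
    rw [if_neg]
    · simp
    · rintro ⟨h1, h2⟩
      exact hk (mem_image.2 ⟨k - i, mem_range.2 h2, Nat.add_sub_cancel' h1⟩)
  rw [← sum_subset _ h₁, sum_image (by intro a _ b _ h; simpa using h)]
  · refine sum_congr rfl fun j hj => ?_
    rw [mem_range] at hj
    rw [if_pos ⟨by omega, by omega⟩, ← h i hi j hj]
    simp only [add_tsub_cancel_left, Nat.cast_mul]
    ring
  · intro k hk
    obtain ⟨j, hj, rfl⟩ := mem_image.1 hk
    rw [mem_range] at hj ⊢
    omega

/-- Kronecker substitution. A digit of the product is a sum of `u` numbers below `p ^ 2`, which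
gives its bound. -/
theorem Rep.mul {θ : F} {B u p Z Z' : ℕ} {x x' : F} (hu : 0 < u) (h : Rep θ B u p Z x)
    (h' : Rep θ B u p Z' x') : Rep θ B (2 * u - 1) (u * p ^ 2) (Z * Z') (x * x') := by
  obtain ⟨f, hf, rfl, rfl⟩ := h
  obtain ⟨g, hg, rfl, rfl⟩ := h'
  refine ⟨fun k => ∑ i ∈ range u, if i ≤ k ∧ k - i < u then f i * g (k - i) else 0,
    fun k _ => ?_, ?_, ?_⟩
  · have : ∀ i ∈ range u, (if i ≤ k ∧ k - i < u then f i * g (k - i) else 0) < p ^ 2 := by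
      intro i hi
      have h₁ := hf i (mem_range.1 hi)
      split_ifs with hk
      · rw [sq]
        exact Nat.mul_lt_mul'' h₁ (hg _ hk.2)
      · exact pow_pos (by omega) 2
    simpa using sum_lt_sum_of_nonempty ⟨0, mem_range.2 hu⟩ this
  · have := sum_mul_sum_eq_conv (S := ℕ) u f g (fun i => B ^ (u - 1 - i))
      (fun i => B ^ (u - 1 - i)) (fun k => B ^ (2 * u - 1 - 1 - k)) (by
        intro i hi j hj
        rw [← pow_add]
        congr 1
        omega)
    simpa [pack] using this
  · exact sum_mul_sum_eq_conv u f g _ _ _ fun i _ j _ => (pow_add θ i j).symm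

theorem Rep.one {θ : F} {B u p : ℕ} (hu : 0 < u) (hp : 1 < p) :
    Rep θ B u p (B ^ (u - 1)) 1 := by
  obtain ⟨v, rfl⟩ := Nat.exists_eq_succ_of_ne_zero hu.ne'
  refine ⟨fun i => if i = 0 then 1 else 0, fun i _ => ?_, ?_, ?_⟩
  · show (if i = 0 then 1 else 0) < p
    split_ifs <;> omega
  · rw [Nat.succ_eq_add_one, pack_succ', add_tsub_cancel_right]
    simp [pack]
  · rw [Nat.succ_eq_add_one, sum_range_succ']
    simp

/-- The number `p` vanishes in `F`, and `θ` is a zero of the monic polynomial of degree `u` with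
the lower coefficients `c 0, …, c (u - 1)`, which are numbers below `p`. -/
structure Presents (p u : ℕ) (c : ℕ → ℕ) (θ : F) : Prop where
  two_lt : 2 < p
  pos : 0 < u
  lt : ∀ j < u, c j < p
  cast_eq : (p : F) = 0
  rel : θ ^ u + ∑ j ∈ range u, (c j : F) * θ ^ j = 0
  inj : ∀ f g : ℕ → ℕ, (∀ i < u, f i < p) → (∀ i < u, g i < p) →
    ∑ i ∈ range u, (f i : F) * θ ^ i = ∑ i ∈ range u, (g i : F) * θ ^ i → ∀ i < u, f i = g i

theorem Presents.cast_mod {p u : ℕ} {c : ℕ → ℕ} {θ : F} (h : Presents p u c θ) (n : ℕ) :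
    ((n % p : ℕ) : F) = n := by
  conv_rhs => rw [← Nat.mod_add_div n p]
  simp [h.cast_eq]

/-- Together with `Rep.val_inj` this makes equality of field elements the same as equality of
reduced codes. -/
theorem Presents.code_inj {p u : ℕ} {c : ℕ → ℕ} {θ : F} (h : Presents p u c θ) {B Z Z' : ℕ}
    {x : F} (hZ : Rep θ B u p Z x) (hZ' : Rep θ B u p Z' x) : Z = Z' := by
  obtain ⟨f, hf, rfl, rfl⟩ := hZ
  obtain ⟨g, hg, rfl, hfg⟩ := hZ'
  exact pack_congr (h.inj f g hf hg hfg)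

theorem Presents.rep_neg_one {p u : ℕ} {c : ℕ → ℕ} {θ : F} (h : Presents p u c θ) (B : ℕ) :
    Rep θ B u p ((p - 1) * B ^ (u - 1)) (-1) := by
  have hp := h.two_lt
  have hcast := h.cast_eq
  obtain ⟨v, rfl⟩ := Nat.exists_eq_succ_of_ne_zero h.pos.ne'
  refine ⟨fun i => if i = 0 then p - 1 else 0, fun i _ => ?_, ?_, ?_⟩
  · show (if i = 0 then p - 1 else 0) < p
    split_ifs <;> omega
  · rw [Nat.succ_eq_add_one, pack_succ', add_tsub_cancel_right]
    simp [pack]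
  · rw [Nat.succ_eq_add_one, sum_range_succ']
    simp [Nat.cast_sub (show 1 ≤ p by omega), hcast]

/-- The lowest digit belongs to the highest power `θ ^ D`. Division by `B` removes it, and the
relation for `θ ^ u` then falls on the lowest `u` digits without any shift; the order of the digits
is chosen for this. The numbers `p - c j` stand for `-c j`, and the digit bound grows by `p ^ 2`. -/
theorem Rep.reduce {p u : ℕ} {c : ℕ → ℕ} {θ : F} (h : Presents p u c θ) {B D R Z : ℕ} {x : F}
    (hZ : Rep θ B (D + 1) R Z x) (hD : u ≤ D) (hR : R ≤ B) :
    Rep θ B D (R + p ^ 2) (Z / B + Z % B % p * pack B u fun j => p - c j) x := by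
  obtain ⟨f, hf, rfl, rfl⟩ := hZ
  obtain ⟨k, rfl⟩ := Nat.exists_eq_add_of_le' hD
  have hd : f (k + u) < B := (hf _ (by omega)).trans_le hR
  rw [pack_mod hd, pack_div hd]
  set d := f (k + u) % p with hdd
  have hdp : d < p := Nat.mod_lt _ (by have := h.two_lt; omega)
  refine ⟨fun i => f i + if k ≤ i then d * (p - c (i - k)) else 0, fun i hi => ?_, ?_, ?_⟩
  · have h₁ := hf i (by omega)
    have h₂ : (if k ≤ i then d * (p - c (i - k)) else 0) ≤ p ^ 2 := by
      split_ifs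
      · rw [sq]
        exact Nat.mul_le_mul hdp.le (Nat.sub_le _ _)
      · exact Nat.zero_le _
    show f i + _ < _
    omega
  · rw [pack_add]
    congr 1
    rw [eq_comm, pack, sum_range_add, sum_eq_zero, zero_add, pack, mul_sum]
    · refine sum_congr rfl fun j hj => ?_
      rw [if_pos (by omega), add_tsub_cancel_left, mul_assoc]
      congr 3
      have := mem_range.1 hj; omega
    · intro i hi
      rw [if_neg (by have := mem_range.1 hi; omega), zero_mul]
  · rw [sum_range_succ]
    simp only [Nat.cast_add, add_mul, sum_add_distrib]
    congr 1
    rw [sum_range_add, sum_eq_zero, zero_add]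
    · have h₁ : ∀ j ∈ range u, (((if k ≤ k + j then d * (p - c (k + j - k)) else 0 : ℕ)) : F) *
          θ ^ (k + j) = - (f (k + u) : F) * θ ^ k * ((c j : F) * θ ^ j) := by
        intro j hj
        rw [if_pos (by omega), add_tsub_cancel_left, Nat.cast_mul,
          Nat.cast_sub (h.lt j (mem_range.1 hj)).le, h.cast_eq, hdd, h.cast_mod, pow_add]
        ring
      rw [sum_congr rfl h₁, ← mul_sum, pow_add]
      linear_combination (f (k + u) : F) * θ ^ k * h.rel
    · intro i hi
      rw [if_neg (by have := mem_range.1 hi; omega)]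
      simp

end Tower

/-! ### The programs for field arithmetic -/

namespace Tower

open RAM Finset

variable {F : Type*} [CommRing F]

/-- The base of packed representations. -/
abbrev base (p u : ℕ) : ℕ := 4 * u * p ^ 2

/-- The bit bound `L` is large enough for the computation. -/
structure Setup (p u ℓ e L : ℕ) (c : ℕ → ℕ) (θ : F) : Prop extends Presents p u c θ where
  base_pow_le : base p u ^ (2 * u + 2) ≤ 2 ^ L
  trials_le : (e + 1) * 2 ^ 20 ≤ 2 ^ L
  length_le : ℓ + 4 ≤ 2 ^ L

/-- The contents of the cells that are computed once for all. -/
structure Ctx (p u ℓ e : ℕ) (c : ℕ → ℕ) (s : State) : Prop where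
  h0 : s.mem 0 = p
  h1 : s.mem 1 = u
  h2 : s.mem 2 = ℓ
  h3 : s.mem 3 = e
  h4 : s.mem 4 = base p u
  h5 : s.mem 5 = pack (base p u) u fun j => p - c j
  h6 : s.mem 6 = base p u ^ (u - 1)
  h7 : s.mem 7 = p ^ u
  h8 : s.mem 8 = 1
  h10 : s.mem 10 = 2
  h11 : s.mem 11 = 0

theorem Ctx.of_eq {p u ℓ e : ℕ} {c : ℕ → ℕ} {s s' : State} (h : Ctx p u ℓ e c s)
    (h' : ∀ r < 12, s'.mem r = s.mem r) : Ctx p u ℓ e c s' := by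
  constructor <;> rw [h' _ (by norm_num)]
  exacts [h.h0, h.h1, h.h2, h.h3, h.h4, h.h5, h.h6, h.h7, h.h8, h.h10, h.h11]

theorem Ctx.frame {p u ℓ e : ℕ} {c : ℕ → ℕ} {P : Prog} {s s' : State} (h : Ctx p u ℓ e c s)
    (hf : Frame P s s') (hP : P.direct = true) (hr : ∀ r ∈ P.cells, 12 ≤ r) :
    Ctx p u ℓ e c s' :=
  h.of_eq fun r hr' => hf.mem hP r fun hm => by have := hr r hm; omega

section

variable {p u ℓ e L : ℕ} {c : ℕ → ℕ} {θ : F}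

theorem Setup.base_ge (h : Setup p u ℓ e L c θ) : 36 ≤ base p u := by
  have h₁ := h.two_lt
  have h₂ := h.pos
  have : 3 ^ 2 ≤ p ^ 2 := Nat.pow_le_pow_left h₁ 2
  unfold base
  nlinarith

theorem Setup.p_lt_base (h : Setup p u ℓ e L c θ) : p < base p u := by
  have h₁ := h.two_lt
  have h₂ := h.pos
  unfold base
  have : p * 3 ≤ p ^ 2 := by rw [sq]; exact Nat.mul_le_mul_left _ h₁
  nlinarith

theorem Setup.u_lt_base (h : Setup p u ℓ e L c θ) : u < base p u := by
  have h₁ := h.two_lt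
  have h₂ := h.pos
  unfold base
  have : 3 ^ 2 ≤ p ^ 2 := Nat.pow_le_pow_left h₁ 2
  nlinarith

theorem Setup.lt_of_lt_pow (h : Setup p u ℓ e L c θ) {n k : ℕ} (hn : n < base p u ^ k)
    (hk : k ≤ 2 * u + 2) : n < 2 ^ L :=
  hn.trans_le ((Nat.pow_le_pow_right (by have := h.base_ge; omega) hk).trans h.base_pow_le)

theorem Setup.pow_lt (h : Setup p u ℓ e L c θ) {k : ℕ} (hk : k ≤ 2 * u + 1) :
    base p u ^ k < 2 ^ L :=
  h.lt_of_lt_pow (Nat.pow_lt_pow_right (by have := h.base_ge; omega) (Nat.lt_succ_self k))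
    (by omega)

theorem Setup.base_lt (h : Setup p u ℓ e L c θ) : base p u < 2 ^ L := by
  simpa using h.pow_lt (k := 1) (by omega)

theorem Setup.p_lt (h : Setup p u ℓ e L c θ) : p < 2 ^ L := h.p_lt_base.trans h.base_lt

theorem Setup.u_lt (h : Setup p u ℓ e L c θ) : u < 2 ^ L := h.u_lt_base.trans h.base_lt

theorem Setup.m_lt (h : Setup p u ℓ e L c θ) :
    pack (base p u) u (p - c ·) < base p u ^ u :=
  pack_lt fun _ _ => (Nat.sub_le _ _).trans_lt h.p_lt_base

theorem Setup.q_le (h : Setup p u ℓ e L c θ) : p ^ u ≤ base p u ^ u :=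
  Nat.pow_le_pow_left h.p_lt_base.le u

end

/-- Replace the number in cell `21`, which represents an element of `F` by powers of `θ` that
need not be reduced, by the reduced representation of the element, in cell `23`. -/
def reduceP : Prog := blk
  [.arith .sub 20 1 8,
   .loop 20 (blk [.arith .mod 22 21 4, .arith .mod 22 22 0, .arith .div 21 21 4,
     .arith .mul 22 22 5, .arith .add 21 21 22, .arith .sub 20 20 8]),
   .arith .add 20 1 11, .const 23 0, .const 24 1,
   .loop 20 (blk [.arith .mod 22 21 4, .arith .mod 22 22 0, .arith .div 21 21 4,
     .arith .mul 22 22 24, .arith .add 23 23 22, .arith .mul 24 24 4, .arith .sub 20 20 8])]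

/-- The first loop removes the powers from `θ ^ u` on, leaving `u` digits that may exceed `p`; the
second reduces each of them modulo `p`. -/
theorem reduceP_runs {p u ℓ e L : ℕ} {c : ℕ → ℕ} {θ : F} (h : Setup p u ℓ e L c θ) {s : State}
    (hc : Ctx p u ℓ e c s) {R : ℕ} (hR : R ≤ 3 * u * p ^ 2) {x : F}
    (hx : Rep θ (base p u) (2 * u - 1) R (s.mem 21) x) :
    Runs L reduceP s (20 * u + 10) fun s' => Rep θ (base p u) u p (s'.mem 23) x := by
  have hp := h.two_lt
  have hu := h.pos
  have hpB := h.p_lt_base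
  have hB := h.base_ge
  have hBL := h.base_lt
  have hpL := h.p_lt
  have huL := h.u_lt
  have hmL := h.m_lt
  refine Runs.mono (k := 1 + ((1 + (u - 1) * (1 + 6)) + (1 + (1 + (1 + (1 + u * (1 + 7)))))))
    (Q := fun s' => Rep θ (base p u) u p (s'.mem 23) x) ?_ (by omega) (fun _ _ h => h)
  refine Runs.seq (Q₁ := fun s' => s'.mem 20 = u - 1 ∧ s'.mem 21 = s.mem 21)
    (Runs.of_wp ?_) fun s₁ hf₁ h₁ => ?_
  · simp only [Prog.wp, State.put, Op.apply, Function.update_apply, reduceIte, Nat.reduceEqDiff,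
      and_true, hc.h1, hc.h8]
    omega
  have hc₁ := hc.frame hf₁ rfl (by decide)
  refine Runs.seq (Runs.loop (fun n s' => s'.mem 20 = n ∧ ∃ R, R + n * p ^ 2 ≤ base p u ∧
    Rep θ (base p u) (u + n) R (s'.mem 21) x) ⟨h₁.1, R, ?_, ?_⟩ ?_ ?_) fun s₂ hf₂ h₂ => ?_
  -- The factor 4 of the base is used here: the digits are at most `3 * u * p ^ 2`, and the `u - 1`
  -- reductions add at most `u * p ^ 2`.
  · unfold base
    have : (u - 1) * p ^ 2 ≤ u * p ^ 2 := Nat.mul_le_mul_right _ (by omega)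
    nlinarith
  · rw [h₁.2, show u + (u - 1) = 2 * u - 1 by omega]
    exact hx
  · rintro n s' hn hf ⟨hn', R, hR, hrep⟩
    have hc' := hc₁.frame hf rfl (by decide)
    rw [← add_assoc] at hrep
    have hR' : R ≤ base p u := le_trans (Nat.le_add_right _ _) hR
    have hlt := hrep.lt hR'
    have hnew := hrep.reduce h.toPresents (by omega) hR'
    have hlt' := hnew.lt (by rw [add_mul, one_mul] at hR; omega)
    have hZ := h.lt_of_lt_pow hlt (by omega)
    have hZ' := h.lt_of_lt_pow hlt' (by omega)
    have h3 : s'.mem 21 % base p u < base p u := Nat.mod_lt _ (by omega)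
    have h4 : s'.mem 21 % base p u % p < p := Nat.mod_lt _ (by omega)
    have h5 : s'.mem 21 / base p u ≤ s'.mem 21 := Nat.div_le_self _ _
    refine ⟨by omega, by omega, Runs.of_wp ?_⟩
    simp only [blk, Prog.wp, State.put, Op.apply, Function.update_apply, hc'.h0, hc'.h4, hc'.h5,
      hc'.h8, hn', reduceIte, Nat.reduceEqDiff]
    have hm := h.lt_of_lt_pow hmL (by omega)
    have hdm := (Nat.le_add_left _ _).trans_lt hZ'
    refine ⟨hZ, hBL, by omega, by omega, hpL, by omega, hZ, hBL, by omega, by omega, hm, by omega,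
      by omega, by omega, hZ', by omega, by omega, by omega, by omega, _, ?_, hnew⟩
    rw [add_mul, one_mul] at hR
    omega
  · exact fun _ _ h => h.1
  have hc₂ := hc₁.frame hf₂ rfl (by decide)
  obtain ⟨-, R, hR, f, hf, hZ, rfl⟩ := h₂
  rw [add_zero] at hf hZ
  rw [zero_mul, add_zero] at hR
  refine Runs.seq (Q₁ := fun s' => s'.mem 20 = u ∧ s'.mem 21 = s₂.mem 21)
    (Runs.of_wp ?_) fun s₃ hf₃ h₃ => ?_
  · simp only [Prog.wp, State.put, Op.apply, Function.update_apply, reduceIte, Nat.reduceEqDiff,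
      and_true, hc₂.h1, hc₂.h11]
    omega
  refine Runs.seq (Q₁ := fun s' => s'.mem 20 = u ∧ s'.mem 21 = s₂.mem 21 ∧ s'.mem 23 = 0)
    (Runs.of_wp ?_) fun s₄ hf₄ h₄ => ?_
  · simp [Prog.wp, State.put, h₃]
  refine Runs.seq (Q₁ := fun s' => s'.mem 20 = u ∧ s'.mem 21 = s₂.mem 21 ∧ s'.mem 23 = 0 ∧
    s'.mem 24 = 1) (Runs.of_wp ?_) fun s₅ hf₅ h₅ => ?_
  · simp only [Prog.wp, State.put, Function.update_apply, reduceIte, Nat.reduceEqDiff, and_true, h₄]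
    omega
  have hc₅ := ((hc₂.frame hf₃ rfl (by decide)).frame hf₄ rfl (by decide)).frame hf₅ rfl (by decide)
  -- Digits leave cell `21` at the low end, and each is put in front of those already in cell `23`,
  -- with the weight in cell `24`.
  refine Runs.mono (Runs.loop (fun n s' => s'.mem 20 = n ∧ n ≤ u ∧
    s'.mem 21 = pack (base p u) n f ∧
    s'.mem 23 = pack (base p u) (u - n) (fun i => f (n + i) % p) ∧
    s'.mem 24 = base p u ^ (u - n)) (n := u) (k := 7) ?_ ?_ ?_) le_rfl ?_
  · simp [h₅, hZ, pack_zero]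
  · rintro n s' hn hf' ⟨hn', -, h21, h23, h24⟩
    have hc' := hc₅.frame hf' rfl (by decide)
    have hfn : f n < base p u := (hf n hn).trans_le hR
    have hZL := h.lt_of_lt_pow (pack_lt fun i (hi : i < n + 1) =>
      (hf i (by omega)).trans_le hR) (by omega)
    have hZL' := h.lt_of_lt_pow (pack_lt fun i (hi : i < n) =>
      (hf i (by omega)).trans_le hR) (by omega)
    have hd : f n % p < p := Nat.mod_lt _ (by omega)
    have hnew : pack (base p u) (u - (n + 1)) (fun i => f (n + 1 + i) % p) +
        f n % p * base p u ^ (u - (n + 1)) = pack (base p u) (u - n) fun i => f (n + i) % p := by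
      rw [show u - n = u - (n + 1) + 1 by omega, pack_succ', add_comm, add_zero]
      simp only [add_assoc, add_comm 1]
    have hnewL : pack (base p u) (u - n) (fun i => f (n + i) % p) < 2 ^ L :=
      h.lt_of_lt_pow (pack_lt fun i _ => (Nat.mod_lt _ (by omega)).trans hpB) (by omega)
    have hpw := h.pow_lt (k := u - (n + 1)) (by omega)
    have hpw' : base p u ^ (u - (n + 1)) * base p u = base p u ^ (u - n) := by
      rw [← pow_succ]; congr 1; omega
    have hpwL := h.pow_lt (k := u - n) (by omega)
    refine ⟨by omega, by omega, Runs.of_wp ?_⟩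
    simp only [blk, Prog.wp, State.put, Op.apply, Function.update_apply, hc'.h0, hc'.h4,
      hc'.h8, hn', reduceIte, Nat.reduceEqDiff, h21, h23, h24,
      pack_mod hfn, pack_div hfn, hpw', hnew]
    refine ⟨hZL, hBL, by omega, by omega, hpL, by omega, hZL, hBL, hZL', by omega, hpw, by omega,
      by omega, by omega, hnewL, hpw, hBL, hpwL, by omega, by omega, by omega, by omega, by omega,
      trivial, trivial, trivial⟩
  · exact fun _ _ h => h.1
  · rintro s' - ⟨-, -, -, h23, -⟩
    refine ⟨fun i => f i % p, fun i _ => Nat.mod_lt _ (by omega), by simpa using h23, ?_⟩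
    simp only [h.cast_mod, add_zero]

end Tower

/-! ### Conversion from base `p`, and powers of field elements. -/

namespace Tower

open RAM Finset

variable {F : Type*} [CommRing F]

theorem Setup.one_lt {p u ℓ e L : ℕ} {c : ℕ → ℕ} {θ : F} (h : Setup p u ℓ e L c θ) :
    36 < 2 ^ L := h.base_ge.trans_lt h.base_lt

/-- The element of `F` that is given by the lowest `u` digits of `x` in base `p`. -/
def elt (θ : F) (p u x : ℕ) : F := ∑ i ∈ range u, ((x / p ^ i % p : ℕ) : F) * θ ^ i

/-- Convert the number in cell `25` to the element of `F` given by its digits, in cell `26`. -/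
def packP : Prog := blk
  [.arith .add 20 1 11, .const 26 0,
   .loop 20 (blk [.arith .mod 22 25 0, .arith .div 25 25 0, .arith .mul 26 26 4,
     .arith .add 26 26 22, .arith .sub 20 20 8])]

theorem packP_runs {p u ℓ e L : ℕ} {c : ℕ → ℕ} {θ : F} (h : Setup p u ℓ e L c θ) {s : State}
    (hc : Ctx p u ℓ e c s) (hx : s.mem 25 < 2 ^ L) :
    Runs L packP s (6 * u + 3) fun s' =>
      Rep θ (base p u) u p (s'.mem 26) (elt θ p u (s.mem 25)) := by
  have hp := h.two_lt
  have hu := h.pos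
  have hpB := h.p_lt_base
  have hBL := h.base_lt
  have hpL := h.p_lt
  have huL := h.u_lt
  refine Runs.mono (k := 1 + (1 + (1 + u * (1 + 5))))
    (Q := fun s' => Rep θ (base p u) u p (s'.mem 26) (elt θ p u (s.mem 25))) ?_ (by omega)
    (fun _ _ h => h)
  refine Runs.seq (Q₁ := fun s' => s'.mem 20 = u ∧ s'.mem 25 = s.mem 25)
    (Runs.of_wp ?_) fun s₁ hf₁ h₁ => ?_
  · simp only [Prog.wp, State.put, Op.apply, Function.update_apply, reduceIte, Nat.reduceEqDiff, and_true,
      true_and, hc.h1, hc.h11]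
    omega
  refine Runs.seq (Q₁ := fun s' => s'.mem 20 = u ∧ s'.mem 25 = s.mem 25 ∧ s'.mem 26 = 0)
    (Runs.of_wp ?_) fun s₂ hf₂ h₂ => ?_
  · simp only [Prog.wp, State.put, Op.apply, Function.update_apply, reduceIte, Nat.reduceEqDiff, and_true,
      true_and, h₁]
    omega
  have hc₂ := (hc.frame hf₁ rfl (by decide)).frame hf₂ rfl (by decide)
  refine Runs.mono (Runs.loop (fun n s' => s'.mem 20 = n ∧ n ≤ u ∧
    s'.mem 25 = s.mem 25 / p ^ (u - n) ∧
    s'.mem 26 = pack (base p u) (u - n) (fun i => s.mem 25 / p ^ i % p)) (n := u) (k := 5)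
    ?_ ?_ ?_) le_rfl ?_
  · simp [h₂, pack_zero]
  · rintro n s' hn hf' ⟨hn', -, h25, h26⟩
    have hc' := hc₂.frame hf' rfl (by decide)
    have hx' : s.mem 25 / p ^ (u - (n + 1)) ≤ s.mem 25 := Nat.div_le_self _ _
    have hdiv : s.mem 25 / p ^ (u - (n + 1)) / p = s.mem 25 / p ^ (u - n) := by
      rw [Nat.div_div_eq_div_mul, ← pow_succ]
      congr 2
      omega
    have hx'' : s.mem 25 / p ^ (u - n) ≤ s.mem 25 := Nat.div_le_self _ _
    have hd : s.mem 25 / p ^ (u - (n + 1)) % p < p := Nat.mod_lt _ (by omega)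
    have hnew := pack_succ (base p u) (u - (n + 1)) fun i => s.mem 25 / p ^ i % p
    rw [show u - (n + 1) + 1 = u - n by omega, mul_comm, add_comm] at hnew
    have hlt : ∀ k ≤ u, pack (base p u) k (fun i => s.mem 25 / p ^ i % p) < 2 ^ L := fun k hk =>
      h.lt_of_lt_pow (pack_lt fun i _ => (Nat.mod_lt _ (by omega)).trans hpB) (by omega)
    have hl₁ := hlt (u - (n + 1)) (by omega)
    have hl₂ := hlt (u - n) (by omega)
    refine ⟨by omega, by omega, Runs.of_wp ?_⟩
    simp only [blk, Prog.wp, State.put, Op.apply, Function.update_apply, reduceIte, Nat.reduceEqDiff, and_true,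
      true_and, hc'.h0, hc'.h4, hc'.h8, hn', h25, h26, hdiv, ← hnew]
    rw [hnew]
    omega
  · exact fun _ _ h => h.1
  · rintro s' - ⟨-, -, -, h26⟩
    exact ⟨_, fun i _ => Nat.mod_lt _ (by omega), by simpa using h26, rfl⟩

/-- Raise the element in cell `30` to the power `q / 2`, in cell `31`. -/
def powP : Prog := blk
  [blk [.arith .div 32 7 10, .arith .add 31 6 11],
   .loop 32 (blk [
     blk [.arith .mod 33 32 10, .arith .mul 34 33 30, .arith .sub 33 8 33, .arith .mul 33 33 6,
       .arith .add 34 34 33, .arith .mul 21 31 34],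
     reduceP,
     blk [.arith .add 31 23 11, .arith .mul 21 30 30],
     reduceP,
     blk [.arith .add 30 23 11, .arith .div 32 32 10]])]

theorem size_half {m n : ℕ} (h : m.size = n + 1) : (m / 2).size = n := by
  have h0 : Nat.bit m.bodd (m / 2) = m := by
    rw [← Nat.div2_val]; exact Nat.bit_bodd_div2 m
  have hm : Nat.bit m.bodd (m / 2) ≠ 0 := by
    rw [h0]; rintro rfl; simp at h
  have := Nat.size_bit hm
  rw [h0, h] at this
  omega

/-- Repeated squaring: with `m` the remaining exponent, `r * b ^ m` keeps its value, and each round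
shortens `m` by one binary digit. -/
theorem powP_runs {p u ℓ e L : ℕ} {c : ℕ → ℕ} {θ : F} (h : Setup p u ℓ e L c θ) {s : State}
    (hc : Ctx p u ℓ e c s) {x : F} (hx : Rep θ (base p u) u p (s.mem 30) x) :
    Runs L powP s (3 + (p ^ u / 2).size * (40 * u + 31)) fun s' =>
      Rep θ (base p u) u p (s'.mem 31) (x ^ (p ^ u / 2)) := by
  have hp := h.two_lt
  have hu := h.pos
  have hpB := h.p_lt_base
  have hBL := h.base_lt
  have h1L := h.one_lt
  have hqL := h.q_le.trans_lt (h.pow_lt (k := u) (by omega))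
  have hTL := h.pow_lt (k := u - 1) (by omega)
  have h3 : u * p ^ 2 ≤ 3 * u * p ^ 2 := by nlinarith
  refine Runs.mono (k := 2 + (1 + (p ^ u / 2).size *
      (1 + (6 + ((20 * u + 10) + (2 + ((20 * u + 10) + 2)))))))
    (Q := fun s' => Rep θ (base p u) u p (s'.mem 31) (x ^ (p ^ u / 2))) ?_
    (by ring_nf; omega) (fun _ _ h => h)
  refine Runs.seq (Q₁ := fun s' => s'.mem 32 = p ^ u / 2 ∧ s'.mem 31 = base p u ^ (u - 1) ∧
    s'.mem 30 = s.mem 30) (Runs.of_wp ?_) fun s₁ hf₁ h₁ => ?_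
  · have := Nat.div_le_self (p ^ u) 2
    simp only [blk, Prog.wp, State.put, Op.apply, Function.update_apply, reduceIte, Nat.reduceEqDiff, and_true,
      true_and, hc.h7, hc.h10, hc.h6, hc.h11]
    omega
  have hc₁ := hc.frame hf₁ rfl (by decide)
  refine Runs.mono (Runs.loop (fun n s' => (s'.mem 32).size = n ∧ s'.mem 32 < 2 ^ L ∧
    ∃ r b, Rep θ (base p u) u p (s'.mem 31) r ∧ Rep θ (base p u) u p (s'.mem 30) b ∧
      r * b ^ s'.mem 32 = x ^ (p ^ u / 2)) (n := (p ^ u / 2).size)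
      (k := 6 + ((20 * u + 10) + (2 + ((20 * u + 10) + 2)))) ?_ ?_ ?_) le_rfl ?_
  · rw [h₁.1, h₁.2.1, h₁.2.2]
    exact ⟨rfl, (Nat.div_le_self _ _).trans_lt hqL, 1, x, Rep.one hu (by omega), hx, one_mul _⟩
  · rintro n s' - hf' ⟨hn', h32, r, b, hr, hb, heq⟩
    have hc' := hc₁.frame hf' rfl (by decide)
    have h0 : s'.mem 32 ≠ 0 := by intro h0; rw [h0] at hn'; simp at hn'
    refine ⟨h0, h32, ?_⟩
    have hrL := h.lt_of_lt_pow (hr.lt hpB.le) (by omega)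
    have hbL := h.lt_of_lt_pow (hb.lt hpB.le) (by omega)
    set m := s'.mem 32 with hm
    -- The factor `b'` is selected without a branch: it is `b` for odd `m`, and for even `m` it is
    -- `1`, whose code is `base p u ^ (u - 1)`.
    obtain ⟨b', hb', hsel, hval⟩ : ∃ b' : F,
        Rep θ (base p u) u p (m % 2 * s'.mem 30 + (1 - m % 2) * base p u ^ (u - 1)) b' ∧
        m % 2 * s'.mem 30 + (1 - m % 2) * base p u ^ (u - 1) < 2 ^ L ∧
        r * b' * (b * b) ^ (m / 2) = x ^ (p ^ u / 2) := by
      have hm2 := Nat.mod_add_div m 2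
      rcases Nat.mod_two_eq_zero_or_one m with h2 | h2
      · rw [h2] at hm2
        refine ⟨1, by simpa [h2] using Rep.one hu (by omega), by simpa [h2] using hTL, ?_⟩
        rw [← heq, mul_one, ← sq, ← pow_mul]
        congr 2
        omega
      · rw [h2] at hm2
        refine ⟨b, by simpa [h2] using hb, by simpa [h2] using hbL, ?_⟩
        rw [← heq, mul_assoc, ← sq, ← pow_mul, ← pow_succ']
        congr 2
        omega
    have hprod := hr.mul hu hb'
    have hprodL := h.lt_of_lt_pow (hprod.lt (by unfold base; nlinarith)) (by omega)
    refine Runs.seq (Q₁ := fun t => t.mem 21 =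
      s'.mem 31 * (m % 2 * s'.mem 30 + (1 - m % 2) * base p u ^ (u - 1)) ∧
      t.mem 30 = s'.mem 30 ∧ t.mem 32 = m) (Runs.of_wp ?_) fun s₂ hf₂ h₂ => ?_
    · have h5 : m % 2 * s'.mem 30 < 2 ^ L := (Nat.le_add_right _ _).trans_lt hsel
      have h6 : (1 - m % 2) * base p u ^ (u - 1) < 2 ^ L := (Nat.le_add_left _ _).trans_lt hsel
      simp only [blk, Prog.wp, State.put, Op.apply, Function.update_apply, reduceIte, Nat.reduceEqDiff, and_true,
      true_and, hc'.h8, hc'.h10, hc'.h6, ← hm]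
      omega
    have hc₂ := hc'.frame hf₂ rfl (by decide)
    refine Runs.seq (reduceP_runs h hc₂ h3 (by rw [h₂.1]; exact hprod)) fun s₃ hf₃ h₃ => ?_
    have hc₃ := hc₂.frame hf₃ rfl (by decide)
    have h30 : s₃.mem 30 = s'.mem 30 := (hf₃.mem rfl 30 (by decide)).trans h₂.2.1
    have h32' : s₃.mem 32 = m := (hf₃.mem rfl 32 (by decide)).trans h₂.2.2
    have hbb := hb.mul hu hb
    have hbbL := h.lt_of_lt_pow (hbb.lt (by unfold base; nlinarith)) (by omega)
    have h23L := h.lt_of_lt_pow (h₃.lt hpB.le) (by omega)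
    refine Runs.seq (Q₁ := fun t => t.mem 21 = s'.mem 30 * s'.mem 30 ∧ t.mem 31 = s₃.mem 23 ∧
      t.mem 32 = m) (Runs.of_wp ?_) fun s₄ hf₄ h₄ => ?_
    · simp only [blk, Prog.wp, State.put, Op.apply, Function.update_apply, reduceIte, Nat.reduceEqDiff, and_true,
      true_and, hc₃.h11, h30, h32']
      omega
    have hc₄ := hc₃.frame hf₄ rfl (by decide)
    refine Runs.seq (reduceP_runs h hc₄ h3 (by rw [h₄.1]; exact hbb)) fun s₅ hf₅ h₅ => ?_
    have hc₅ := hc₄.frame hf₅ rfl (by decide)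
    have h31 : s₅.mem 31 = s₃.mem 23 := (hf₅.mem rfl 31 (by decide)).trans h₄.2.1
    have h32'' : s₅.mem 32 = m := (hf₅.mem rfl 32 (by decide)).trans h₄.2.2
    have h23L' := h.lt_of_lt_pow (h₅.lt hpB.le) (by omega)
    have := Nat.div_le_self m 2
    refine Runs.of_wp ?_
    simp only [blk, Prog.wp, State.put, Op.apply, Function.update_apply, reduceIte, Nat.reduceEqDiff, and_true,
      true_and, hc₅.h11, hc₅.h10, h31, h32'', add_zero]
    exact ⟨h23L', by omega, h23L', h32, by omega, by omega, size_half hn', by omega, r * b', b * b,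
      h₃, h₅, hval⟩
  · rintro s' - ⟨h0, -⟩
    exact Nat.size_eq_zero.1 h0
  · rintro s' - ⟨h0, -, r, b, hr, -, heq⟩
    rw [show s'.mem 32 = 0 from Nat.size_eq_zero.1 h0, pow_zero, mul_one] at heq
    rwa [← heq]

end Tower

/-! ### Testing pairs, the starting pair and the walk. -/

namespace Tower

open RAM Finset

variable {F : Type*} [CommRing F]

/-- The sum of the squares of the elements given by the digits of `x` and of `y`. -/
def sumSq (θ : F) (p u x y : ℕ) : F :=
  elt θ p u x * elt θ p u x + elt θ p u y * elt θ p u y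

/-- A pair of numbers is good if the sum of the squares of its elements is not a square. -/
def Good (θ : F) (p u x y : ℕ) : Prop := sumSq θ p u x y ^ (p ^ u / 2) = -1

/-- A good pair is stored in the cells `50`, `51`, `52`. -/
def Found (θ : F) (p u : ℕ) (s : State) : Prop :=
  s.mem 53 = 1 ∧ ∃ x y, Good θ p u x y ∧ Rep θ (base p u) u p (s.mem 50) (elt θ p u x) ∧
    Rep θ (base p u) u p (s.mem 51) (elt θ p u y) ∧
    Rep θ (base p u) u p (s.mem 52) (sumSq θ p u x y)

theorem Found.of_eq {θ : F} {p u : ℕ} {s s' : State} (h : Found θ p u s)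
    (h50 : s'.mem 50 = s.mem 50) (h51 : s'.mem 51 = s.mem 51) (h52 : s'.mem 52 = s.mem 52)
    (h53 : s'.mem 53 = s.mem 53) : Found θ p u s' := by
  unfold Found at *
  rwa [h50, h51, h52, h53]

/-- Test the pair of numbers in the cells `40` and `41`, and store it if it is good. -/
def trialP : Prog := blk
  [.arith .add 25 40 11, packP, blk [.arith .add 42 26 11, .arith .add 25 41 11], packP,
   blk [.arith .add 43 26 11, .arith .mul 21 42 42, .arith .mul 22 43 43, .arith .add 21 21 22],
   reduceP, blk [.arith .add 44 23 11, .arith .add 30 23 11], powP,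
   blk [.arith .sub 35 0 8, .arith .mul 35 35 6, .arith .sub 36 31 35, .arith .sub 35 35 31,
     .arith .add 36 36 35, .cond 36 .skip (blk [.arith .add 50 42 11, .arith .add 51 43 11,
       .arith .add 52 44 11, .arith .add 53 8 11])]]

/-- Codes `a` and `b` agree exactly if the truncated differences `a - b` and `b - a` add up to zero.
Here `b` is the code of `-1`. One direction of the test is `Presents.code_inj`, the other is
`Rep.val_inj`. -/
theorem trialP_runs {p u ℓ e L : ℕ} {c : ℕ → ℕ} {θ : F} (h : Setup p u ℓ e L c θ) {s : State}
    (hc : Ctx p u ℓ e c s) (hx : s.mem 40 < 2 ^ L) (hy : s.mem 41 < 2 ^ L) :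
    Runs L trialP s (50 + 32 * u + (p ^ u / 2).size * (40 * u + 31)) fun s' =>
      (Good θ p u (s.mem 40) (s.mem 41) → Found θ p u s') ∧
      (¬ Good θ p u (s.mem 40) (s.mem 41) → s'.mem 50 = s.mem 50 ∧ s'.mem 51 = s.mem 51 ∧
        s'.mem 52 = s.mem 52 ∧ s'.mem 53 = s.mem 53) := by
  have hp := h.two_lt
  have hu := h.pos
  have hpB := h.p_lt_base
  have hpL := h.p_lt
  have h1L := h.one_lt
  have hTL := h.pow_lt (k := u - 1) (by omega)
  have hle : ∀ {Z x}, Rep θ (base p u) u p Z x → Z < 2 ^ L := fun hZ =>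
    h.lt_of_lt_pow (hZ.lt hpB.le) (by omega)
  refine Runs.mono (k := 1 + ((6 * u + 3) + (2 + ((6 * u + 3) + (4 + ((20 * u + 10) + (2 +
    ((3 + (p ^ u / 2).size * (40 * u + 31)) + 11)))))))) ?_ (by omega) (fun _ _ h => h)
  refine Runs.seq (Q₁ := fun t => t.mem 25 = s.mem 40 ∧ t.mem 41 = s.mem 41)
    (Runs.of_wp ?_) fun s₁ hf₁ h₁ => ?_
  · simp only [blk, Prog.wp, State.put, Op.apply, Function.update_apply, reduceIte, Nat.reduceEqDiff, and_true,
      true_and, hc.h11]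
    omega
  have hc₁ := hc.frame hf₁ rfl (by decide)
  refine Runs.seq (packP_runs h hc₁ (by omega)) fun s₂ hf₂ h₂ => ?_
  have hc₂ := hc₁.frame hf₂ rfl (by decide)
  rw [h₁.1] at h₂
  have h41 : s₂.mem 41 = s.mem 41 := (hf₂.mem rfl 41 (by decide)).trans h₁.2
  have := hle h₂
  refine Runs.seq (Q₁ := fun t => t.mem 42 = s₂.mem 26 ∧ t.mem 25 = s.mem 41)
    (Runs.of_wp ?_) fun s₃ hf₃ h₃ => ?_
  · simp only [blk, Prog.wp, State.put, Op.apply, Function.update_apply, reduceIte, Nat.reduceEqDiff, and_true,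
      true_and, hc₂.h11, h41]
    omega
  have hc₃ := hc₂.frame hf₃ rfl (by decide)
  refine Runs.seq (packP_runs h hc₃ (by omega)) fun s₄ hf₄ h₄ => ?_
  have hc₄ := hc₃.frame hf₄ rfl (by decide)
  rw [h₃.2] at h₄
  have h42 : s₄.mem 42 = s₂.mem 26 := (hf₄.mem rfl 42 (by decide)).trans h₃.1
  have := hle h₄
  -- Both squares are added before the reduction; the digits stay below `2 * u * p ^ 2`, as
  -- `reduceP_runs` permits.
  have hsum := (h₂.mul hu h₂).add (h₄.mul hu h₄)
  have hsumL := h.lt_of_lt_pow (hsum.lt (by unfold base; nlinarith)) (by omega)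
  refine Runs.seq (Q₁ := fun t => t.mem 42 = s₂.mem 26 ∧ t.mem 43 = s₄.mem 26 ∧
    t.mem 21 = s₂.mem 26 * s₂.mem 26 + s₄.mem 26 * s₄.mem 26) (Runs.of_wp ?_) fun s₅ hf₅ h₅ => ?_
  · simp only [blk, Prog.wp, State.put, Op.apply, Function.update_apply, reduceIte, Nat.reduceEqDiff, and_true,
      true_and, hc₄.h11, h42, add_zero]
    omega
  have hc₅ := hc₄.frame hf₅ rfl (by decide)
  refine Runs.seq (reduceP_runs h hc₅ (R := u * p ^ 2 + u * p ^ 2) (by nlinarith)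
    (by rw [h₅.2.2]; exact hsum)) fun s₆ hf₆ h₆ => ?_
  have hc₆ := hc₅.frame hf₆ rfl (by decide)
  have h42' : s₆.mem 42 = s₂.mem 26 := (hf₆.mem rfl 42 (by decide)).trans h₅.1
  have h43 : s₆.mem 43 = s₄.mem 26 := (hf₆.mem rfl 43 (by decide)).trans h₅.2.1
  have := hle h₆
  refine Runs.seq (Q₁ := fun t => t.mem 42 = s₂.mem 26 ∧ t.mem 43 = s₄.mem 26 ∧
    t.mem 44 = s₆.mem 23 ∧ t.mem 30 = s₆.mem 23) (Runs.of_wp ?_) fun s₇ hf₇ h₇ => ?_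
  · simp only [blk, Prog.wp, State.put, Op.apply, Function.update_apply, reduceIte, Nat.reduceEqDiff, and_true,
      true_and, hc₆.h11, h42', h43]
    omega
  have hc₇ := hc₆.frame hf₇ rfl (by decide)
  refine Runs.seq (powP_runs h hc₇ (by rw [h₇.2.2.2]; exact h₆)) fun s₈ hf₈ h₈ => ?_
  have hc₈ := hc₇.frame hf₈ rfl (by decide)
  have e42 : s₈.mem 42 = s₂.mem 26 := (hf₈.mem rfl 42 (by decide)).trans h₇.1
  have e43 : s₈.mem 43 = s₄.mem 26 := (hf₈.mem rfl 43 (by decide)).trans h₇.2.1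
  have e44 : s₈.mem 44 = s₆.mem 23 := (hf₈.mem rfl 44 (by decide)).trans h₇.2.2.1
  have e5 : ∀ r ∈ [50, 51, 52, 53], s₈.mem r = s.mem r := by
    intro r hr
    rw [hf₈.mem rfl r (by revert r; decide), hf₇.mem rfl r (by revert r; decide),
      hf₆.mem rfl r (by revert r; decide), hf₅.mem rfl r (by revert r; decide),
      hf₄.mem rfl r (by revert r; decide), hf₃.mem rfl r (by revert r; decide),
      hf₂.mem rfl r (by revert r; decide), hf₁.mem rfl r (by revert r; decide)]
  have := hle h₈
  have hneg := h.rep_neg_one (base p u)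
  have := hle hneg
  refine Runs.of_wp ?_
  simp only [blk, Prog.wp, State.put, Op.apply, Function.update_apply, reduceIte, Nat.reduceEqDiff, and_true,
      true_and, hc₈.h0, hc₈.h8, hc₈.h6, hc₈.h11, e42, e43, e44,
    e5 50 (by decide), e5 51 (by decide), e5 52 (by decide), e5 53 (by decide), add_zero]
  refine ⟨by omega, by omega, by omega, by omega, by omega, by omega, by omega, by omega, by omega,
    by omega, by omega, by omega, by omega, by omega, by omega, by omega, fun h0 => ?_,
    fun h0 => ⟨by omega, by omega, by omega, by omega, by omega, by omega, by omega, by omega,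
      by omega, by omega, by omega, by omega, fun hg => ?_, fun hg => ?_⟩⟩
  · refine ⟨fun hg => (h0 ?_).elim, fun _ => trivial⟩
    have := h.code_inj h₈ (hg ▸ hneg)
    omega
  · refine ⟨?_, s.mem 40, s.mem 41, hg, ?_, ?_, ?_⟩
    all_goals simp only [Function.update_apply, reduceIte, Nat.reduceEqDiff]
    exacts [h₂, h₄, h₆]
  · refine (hg ?_).elim
    have hrep := h₈
    rw [show s₈.mem 31 = (p - 1) * base p u ^ (u - 1) by omega] at hrep
    exact hrep.val_inj hneg hpB.le

/-- One step of the walk: every pair moves by a random one of sixteen affine maps. -/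
def stepP : Prog := blk
  [.toss 60, .arith .mul 60 60 41, .arith .add 40 40 60, .toss 60, .arith .add 40 40 60,
   .arith .mod 40 40 12, .toss 60, .arith .mul 60 60 40, .arith .add 41 41 60, .toss 60,
   .arith .add 41 41 60, .arith .mod 41 41 12]

/-- The new first coordinate after a step of the walk. -/
def stepFst (M x y : ℕ) (b₁ b₂ : Bool) : ℕ := (x + b₁.toNat * y + b₂.toNat) % M

/-- Some of the first `n` pairs of the walk from `(x, y)` with the given random bits is good. -/
def Walk (good : ℕ → ℕ → Prop) (M : ℕ) : ℕ → ℕ → ℕ → List Bool → Prop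
  | n + 1, x, y, b₁ :: b₂ :: b₃ :: b₄ :: w => good x y ∨
      Walk good M n (stepFst M x y b₁ b₂) (stepFst M y (stepFst M x y b₁ b₂) b₃ b₄) w
  | _, _, _, _ => False

/-- Test `e * 2 ^ 19 + 1` pairs of the walk. -/
def mainP : Prog := blk
  [blk [.const 22 (2 ^ 19), .arith .mul 45 3 22, .arith .add 45 45 8],
   .loop 45 (blk [trialP, stepP, .arith .sub 45 45 8])]

theorem exists_bits {w : List Bool} {n : ℕ} (h : w.length = 4 * (n + 1)) :
    ∃ b₁ b₂ b₃ b₄ w', w = b₁ :: b₂ :: b₃ :: b₄ :: w' ∧ w'.length = 4 * n := by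
  match w, h with
  | b₁ :: b₂ :: b₃ :: b₄ :: w', h =>
    exact ⟨b₁, b₂, b₃, b₄, w', rfl, by simp only [List.length_cons] at h; omega⟩
  | [_, _, _], h | [_, _], h | [_], h | [], h =>
    simp only [List.length_cons, List.length_nil] at h; omega

/-- The invariant says that if the whole walk contains a good pair, then one is stored already or
the rest of the walk contains one. The loop goes on after a find, so that the number of bits is
fixed: a later good pair replaces the stored one, a bad pair leaves it alone. The last round also
makes a step, to a pair that is not tested. -/
theorem mainP_runs {p u ℓ e L M : ℕ} {c : ℕ → ℕ} {θ : F} (h : Setup p u ℓ e L c θ) {s : State}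
    (hc : Ctx p u ℓ e c s) (hM : 4 * M ≤ 2 ^ L) (h12 : s.mem 12 = M) (hx : s.mem 40 < M)
    (hy : s.mem 41 < M) (h53 : s.mem 53 = 0)
    (hw : s.coins.length = 4 * (e * 2 ^ 19 + 1)) :
    Runs L mainP s (4 + (e * 2 ^ 19 + 1) *
      (70 + 32 * u + (p ^ u / 2).size * (40 * u + 31))) fun s' =>
      (Walk (Good θ p u) M (e * 2 ^ 19 + 1) (s.mem 40) (s.mem 41) s.coins → Found θ p u s') ∧
      (s'.mem 53 = 0 ∨ Found θ p u s') := by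
  have hpL := h.p_lt
  have h1L := h.one_lt
  have heL := h.trials_le
  refine Runs.mono (k := 3 + (1 + (e * 2 ^ 19 + 1) * (1 + ((50 + 32 * u +
    (p ^ u / 2).size * (40 * u + 31)) + (16 + 1))))) ?_
    (by rw [← add_assoc]; gcongr ?_ + _ * ?_ <;> omega) (fun _ _ h => h)
  refine Runs.seq (Q₁ := fun t => t.mem 45 = e * 2 ^ 19 + 1 ∧ t.mem 12 = s.mem 12 ∧
    t.mem 40 = s.mem 40 ∧ t.mem 41 = s.mem 41 ∧ t.mem 53 = s.mem 53 ∧ t.coins = s.coins)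
    (Runs.of_wp ?_) fun s₁ hf₁ h₁ => ?_
  · simp only [blk, Prog.wp, State.put, Op.apply, Function.update_apply, reduceIte, Nat.reduceEqDiff, and_true,
      true_and, hc.h3, hc.h8]
    omega
  have hc₁ := hc.frame hf₁ rfl (by decide)
  refine Runs.mono (Runs.loop (fun n t => t.mem 45 = n ∧ t.mem 40 < M ∧ t.mem 41 < M ∧
    t.coins.length = 4 * n ∧ (t.mem 53 = 0 ∨ Found θ p u t) ∧
    (Walk (Good θ p u) M (e * 2 ^ 19 + 1) (s.mem 40) (s.mem 41) s.coins →
      Found θ p u t ∨ Walk (Good θ p u) M n (t.mem 40) (t.mem 41) t.coins))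
    (n := e * 2 ^ 19 + 1) (k := (50 + 32 * u +
    (p ^ u / 2).size * (40 * u + 31)) + (16 + 1)) ?_ ?_ ?_) le_rfl ?_
  · obtain ⟨h₁, h₂, h₃, h₄, h₅, h₆⟩ := h₁
    rw [h₃, h₄, h₅, h₆]
    exact ⟨h₁, hx, hy, hw, Or.inl h53, Or.inr⟩
  · rintro n t hn hf ⟨h45, hx, hy, hw, h53, hW⟩
    have hc' := hc₁.frame hf rfl (by decide)
    have ht12 : t.mem 12 = M := by rw [hf.mem rfl 12 (by decide), h₁.2.1, h12]
    refine ⟨by omega, by omega, ?_⟩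
    refine Runs.seq (trialP_runs h hc' (by omega) (by omega)) fun s₂ hf₂ h₂ => ?_
    have hc₂ := hc'.frame hf₂ rfl (by decide)
    obtain ⟨b₁, b₂, b₃, b₄, w, hbw, hwl⟩ := exists_bits hw
    rw [hbw] at hW
    have e12 : s₂.mem 12 = M := by rw [hf₂.mem rfl 12 (by decide), ht12]
    have e40 := hf₂.mem rfl 40 (by decide)
    have e41 := hf₂.mem rfl 41 (by decide)
    have e45 := hf₂.mem rfl 45 (by decide)
    have ew := hf₂.coins rfl
    rw [hbw] at ew
    have hb₁ := b₁.toNat_le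
    have hb₂ := b₂.toNat_le
    have hb₃ := b₃.toNat_le
    have hb₄ := b₄.toNat_le
    have hM0 : 0 < M := by omega
    refine Runs.seq (Q₁ := fun t' => t'.coins = w ∧
      t'.mem 40 = stepFst M (t.mem 40) (t.mem 41) b₁ b₂ ∧
      t'.mem 41 = stepFst M (t.mem 41) (stepFst M (t.mem 40) (t.mem 41) b₁ b₂) b₃ b₄)
      (Runs.of_wp ?_) fun s₃ hf₃ h₃ => ?_
    · have m₁ : b₁.toNat * t.mem 41 ≤ 1 * M := Nat.mul_le_mul hb₁ hy.le
      have m₂ : (t.mem 40 + b₁.toNat * t.mem 41 + b₂.toNat) % M < M := Nat.mod_lt _ hM0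
      have m₃ : b₃.toNat * ((t.mem 40 + b₁.toNat * t.mem 41 + b₂.toNat) % M) ≤ 1 * M :=
        Nat.mul_le_mul hb₃ m₂.le
      have m₄ : (t.mem 41 + b₃.toNat * ((t.mem 40 + b₁.toNat * t.mem 41 + b₂.toNat) % M) +
        b₄.toNat) % M < M := Nat.mod_lt _ hM0
      simp only [stepP, blk, Prog.wp, State.put, Op.apply, Function.update_apply, reduceIte, Nat.reduceEqDiff, and_true,
      true_and, e12, e40, e41, ew, stepFst, List.cons.injEq, exists_and_left,
        exists_eq_left', exists_eq_left, and_assoc]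
      omega
    have hc₃ := hc₂.frame hf₃ rfl (by decide)
    have g45 := hf₃.mem rfl 45 (by decide)
    have g5 : ∀ r ∈ [50, 51, 52, 53], s₃.mem r = s₂.mem r := by
      intro r hr
      rw [hf₃.mem rfl r (by revert r; decide)]
    have hF : ∀ {t'}, (∀ r ∈ [50, 51, 52, 53], t'.mem r = s₂.mem r) →
        (Found θ p u t' ↔ Found θ p u s₂) := by
      intro t' ht'
      unfold Found
      rw [ht' 50 (by decide), ht' 51 (by decide), ht' 52 (by decide), ht' 53 (by decide)]
    have hmono : Found θ p u t → Found θ p u s₂ := by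
      intro hf
      by_cases hg : Good θ p u (t.mem 40) (t.mem 41)
      · exact h₂.1 hg
      · obtain ⟨a₁, a₂, a₃, a₄⟩ := h₂.2 hg
        exact hf.of_eq a₁ a₂ a₃ a₄
    refine Runs.of_wp ?_
    simp only [blk, Prog.wp, State.put, Op.apply, Function.update_apply, reduceIte, Nat.reduceEqDiff, and_true,
      true_and, hc₃.h8, g45, e45, h45]
    refine ⟨by omega, by omega, by omega, by omega, ?_, ?_, ?_, ?_, ?_⟩
    · rw [h₃.2.1]; exact Nat.mod_lt _ hM0
    · rw [h₃.2.2]; exact Nat.mod_lt _ hM0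
    · rw [h₃.1, hwl]
    · rw [hF (by simpa [Function.update_apply] using g5), g5 53 (by decide)]
      by_cases hg : Good θ p u (t.mem 40) (t.mem 41)
      · exact Or.inr (h₂.1 hg)
      · rw [(h₂.2 hg).2.2.2]
        exact h53.imp_right hmono
    · intro hW'
      rw [hF (by simpa [Function.update_apply] using g5)]
      rcases hW hW' with hf | hg | hw'
      · exact Or.inl (hmono hf)
      · exact Or.inl (h₂.1 hg)
      · right
        rwa [h₃.1, h₃.2.1, h₃.2.2]
  · exact fun _ _ h => h.1
  · rintro s' - ⟨-, -, -, -, h53, hW⟩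
    refine ⟨fun hw => (hW hw).resolve_right ?_, h53⟩
    simp [Walk]

/-- The pair of numbers with the given initial parts and `n` further binary digits each that are
read from a string of random bits, and the rest of the string. -/
def draw : ℕ → ℕ → ℕ → List Bool → ℕ × ℕ × List Bool
  | n + 1, x, y, b₁ :: b₂ :: w => draw n (x * 2 + b₁.toNat) (y * 2 + b₂.toNat) w
  | _, x, y, w => (x, y, w)

/-- Choose a random pair of numbers below a power of two that is at least `16 * q`. -/
def drawP : Prog := blk
  [blk [.const 22 16, .arith .mul 46 22 7, .const 12 1, .const 40 0, .const 41 0,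
     .arith .sub 47 46 12],
   .loop 47 (blk [.arith .mul 12 12 10, .toss 60, .arith .mul 40 40 10, .arith .add 40 40 60,
     .toss 60, .arith .mul 41 41 10, .arith .add 41 41 60, .arith .sub 47 46 12])]

/-- Cell `12` is doubled as long as it is below `16 * q`: the truncated difference in cell `47`
vanishes as soon as it is not. Hence the number of rounds is the least `b` with `16 * q ≤ 2 ^ b`,
and each round draws one digit of either number. -/
theorem drawP_runs {p u ℓ e L b R : ℕ} {c : ℕ → ℕ} {θ : F} (h : Setup p u ℓ e L c θ) {s : State}
    (hc : Ctx p u ℓ e c s) (hb : 16 * p ^ u ≤ 2 ^ b) (hb' : ∀ j < b, 2 ^ j < 16 * p ^ u)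
    (hbL : 2 ^ b < 2 ^ L) (hw : s.coins.length = 2 * b + R) :
    Runs L drawP s (7 + b * 11) fun s' => s'.mem 12 = 2 ^ b ∧ s'.mem 40 < 2 ^ b ∧
      s'.mem 41 < 2 ^ b ∧ s'.coins.length = R ∧
      draw b 0 0 s.coins = (s'.mem 40, s'.mem 41, s'.coins) := by
  have h1L := h.one_lt
  refine Runs.mono (k := 6 + (1 + b * (1 + 10))) ?_ (by omega) (fun _ _ h => h)
  refine Runs.seq (Q₁ := fun t => t.mem 46 = 16 * p ^ u ∧ t.mem 12 = 1 ∧ t.mem 40 = 0 ∧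
    t.mem 41 = 0 ∧ t.mem 47 = 16 * p ^ u - 1 ∧ t.coins = s.coins)
    (Runs.of_wp ?_) fun s₁ hf₁ h₁ => ?_
  · simp only [blk, Prog.wp, State.put, Op.apply, Function.update_apply, reduceIte, Nat.reduceEqDiff, and_true,
      true_and, hc.h7]
    omega
  have hc₁ := hc.frame hf₁ rfl (by decide)
  refine Runs.mono (Runs.loop (fun n t => n ≤ b ∧ t.mem 47 = 16 * p ^ u - 2 ^ (b - n) ∧
    t.mem 12 = 2 ^ (b - n) ∧ t.mem 40 < 2 ^ (b - n) ∧ t.mem 41 < 2 ^ (b - n) ∧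
    t.coins.length = 2 * n + R ∧
    draw b 0 0 s.coins = draw n (t.mem 40) (t.mem 41) t.coins)
    (n := b) (k := 10) ?_ ?_ ?_) le_rfl ?_
  · obtain ⟨h₁, h₂, h₃, h₄, h₅, h₆⟩ := h₁
    rw [h₂, h₃, h₄, h₅, h₆]
    simp [hw]
  · rintro n t hn hf ⟨-, h47, h12, hx, hy, hw, hd⟩
    have hc' := hc₁.frame hf rfl (by decide)
    have h46 : t.mem 46 = 16 * p ^ u := by rw [hf.mem rfl 46 (by decide), h₁.1]
    have hlt := hb' (b - (n + 1)) (by omega)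
    have hle : 2 ^ (b - n) ≤ 2 ^ b := Nat.pow_le_pow_right (by norm_num) (Nat.sub_le _ _)
    have h2 : 2 ^ (b - (n + 1)) * 2 = 2 ^ (b - n) := by
      rw [← pow_succ]; congr 1; omega
    obtain ⟨b₁, b₂, w, hbw, hwl⟩ : ∃ b₁ b₂ w, t.coins = b₁ :: b₂ :: w ∧ w.length = 2 * n + R := by
      match hm : t.coins with
      | b₁ :: b₂ :: w =>
        rw [hm] at hw
        exact ⟨b₁, b₂, w, rfl, by simp only [List.length_cons] at hw; omega⟩
      | [_] | [] =>
        rw [hm] at hw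
        simp only [List.length_cons, List.length_nil] at hw; omega
    have hb₁ := b₁.toNat_le
    have hb₂ := b₂.toNat_le
    refine ⟨by omega, by omega, Runs.of_wp ?_⟩
    rw [hbw] at hd
    simp only [draw] at hd
    simp only [blk, Prog.wp, State.put, Op.apply, Function.update_apply, reduceIte, Nat.reduceEqDiff, and_true,
      true_and, h47, h12, h46, hbw, hc'.h10, List.cons.injEq, exists_and_left,
        exists_eq_left', exists_eq_left, and_assoc, h2, hd]
    omega
  · rintro t - ⟨-, h47, -⟩
    rw [h47, Nat.sub_zero, Nat.sub_eq_zero_of_le hb]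
  · rintro t - ⟨-, -, h12, hx, hy, hw, hd⟩
    refine ⟨h12, hx, hy, by omega, ?_⟩
    rw [hd]
    simp [draw]

end Tower

/-! ### Writing the polynomials. -/

namespace Tower

open RAM Finset

variable {F : Type*} [CommRing F]

/-- The code of a term in which only the variable with the index `i` occurs, with exponent `v`,
and whose coefficient has the coordinates `f 0, …, f (u - 1)`. -/
def termCode (ℓ u v i : ℕ) (f : ℕ → ℕ) : List ℕ :=
  (List.range ℓ).map (fun j => if j = i then v else 0) ++ (List.range u).map f

/-- Write the term with the variable in cell `77`, the exponent in cell `76`, and the coefficient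
in cell `78`. -/
def termP : Prog := blk
  [blk [.arith .add 20 2 11, .const 21 0],
   .loop 20 (blk [.arith .sub 22 21 77, .arith .sub 23 77 21, .arith .add 22 22 23,
     .arith .sub 22 8 22, .arith .mul 22 22 76, .write 22, .arith .add 21 21 8,
     .arith .sub 20 20 8]),
   blk [.arith .add 20 1 11, .arith .add 21 6 11],
   .loop 20 (blk [.arith .div 22 78 21, .write 22, .arith .mod 78 78 21, .arith .div 21 21 4,
     .arith .sub 20 20 8])]

theorem termP_runs {p u ℓ e L v i : ℕ} {c : ℕ → ℕ} {θ : F} (h : Setup p u ℓ e L c θ) {s : State}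
    (hc : Ctx p u ℓ e c s) {f : ℕ → ℕ} (hf : ∀ j < u, f j < p) (h76 : s.mem 76 = v)
    (h77 : s.mem 77 = i) (h78 : s.mem 78 = pack (base p u) u f) (hv : v < 3) (hi : i ≤ ℓ) :
    Runs L termP s (6 + ℓ * 9 + u * 6) fun s' => s'.output = s.output ++ termCode ℓ u v i f := by
  have h1L := h.one_lt
  have huL := h.u_lt
  have hℓL := h.length_le
  have hpB := h.p_lt_base
  have hBL := h.base_lt
  have hTL := h.pow_lt (k := u - 1) (by omega)
  have hB := h.base_ge
  have hu := h.pos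
  refine Runs.mono (k := 2 + ((1 + ℓ * (1 + 8)) + (2 + (1 + u * (1 + 5))))) ?_ (by omega)
    (fun _ _ h => h)
  refine Runs.seq (Q₁ := fun t => t.mem 20 = ℓ ∧ t.mem 21 = 0 ∧ t.mem 76 = v ∧ t.mem 77 = i ∧
    t.mem 78 = s.mem 78 ∧ t.output = s.output) (Runs.of_wp ?_) fun s₁ hf₁ h₁ => ?_
  · simp only [blk, Prog.wp, State.put, Op.apply, Function.update_apply, reduceIte, Nat.reduceEqDiff, and_true,
      true_and, hc.h2, hc.h11, h76, h77]
    omega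
  have hc₁ := hc.frame hf₁ rfl (by decide)
  refine Runs.seq (Runs.loop (fun n t => t.mem 20 = n ∧ n ≤ ℓ ∧ t.mem 21 = ℓ - n ∧
    t.output = s.output ++ (List.range (ℓ - n)).map (fun j => if j = i then v else 0))
    (n := ℓ) (k := 8) ?_ ?_ ?_) fun s₂ hf₂ h₂ => ?_
  · simp [h₁]
  · rintro n t hn hf' ⟨h20, -, h21, ho⟩
    have hc' := hc₁.frame hf' rfl (by decide)
    have e76 : t.mem 76 = v := by rw [hf'.mem rfl 76 (by decide), h₁.2.2.1]
    have e77 : t.mem 77 = i := by rw [hf'.mem rfl 77 (by decide), h₁.2.2.2.1]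
    -- The truncated value of `1 - |j - i|` is the indicator of `j = i`.
    have hval : (1 - (ℓ - (n + 1) - i + (i - (ℓ - (n + 1))))) * v =
        if ℓ - (n + 1) = i then v else 0 := by
      split_ifs with hh
      · rw [hh]; simp
      · rw [show 1 - (ℓ - (n + 1) - i + (i - (ℓ - (n + 1)))) = 0 by omega, zero_mul]
    have hval' : (if ℓ - (n + 1) = i then v else 0) < 3 := by split_ifs <;> omega
    refine ⟨by omega, by omega, Runs.of_wp ?_⟩
    simp only [blk, Prog.wp, State.put, Op.apply, Function.update_apply, reduceIte, Nat.reduceEqDiff, and_true,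
      true_and, hc'.h8, h20, h21, e76, e77, ho, hval]
    refine ⟨by omega, by omega, by omega, by omega, by omega, by omega, by omega, by omega,
      by omega, by omega, by omega, by omega, by omega, by omega, by omega, by omega, by omega,
      by omega, by omega, by omega, by omega, by omega, by omega, ?_⟩
    rw [show ℓ - n = ℓ - (n + 1) + 1 by omega, List.range_succ]
    simp
    omega
  · exact fun _ _ h => h.1
  have hc₂ := hc₁.frame hf₂ rfl (by decide)
  have e78 : s₂.mem 78 = pack (base p u) u f := by
    rw [hf₂.mem rfl 78 (by decide), h₁.2.2.2.2.1, h78]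
  refine Runs.seq (Q₁ := fun t => t.mem 20 = u ∧ t.mem 21 = base p u ^ (u - 1) ∧
    t.mem 78 = pack (base p u) u f ∧ t.output = s₂.output) (Runs.of_wp ?_) fun s₃ hf₃ h₃ => ?_
  · simp only [blk, Prog.wp, State.put, Op.apply, Function.update_apply, reduceIte, Nat.reduceEqDiff, and_true,
      true_and, hc₂.h1, hc₂.h6, hc₂.h11, e78]
    omega
  have hc₃ := hc₂.frame hf₃ rfl (by decide)
  -- The weight is `base p u ^ (n - 1)` for `n > 0`, but after the last round the cell contains `0`;
  -- the quotient expresses both.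
  refine Runs.mono (Runs.loop (fun n t => t.mem 20 = n ∧ n ≤ u ∧
    t.mem 21 = base p u ^ n / base p u ∧ t.mem 78 = pack (base p u) n (fun j => f (u - n + j)) ∧
    t.output = s₂.output ++ (List.range (u - n)).map f) (n := u) (k := 5) ?_ ?_ ?_) le_rfl ?_
  · obtain ⟨v, hv⟩ := Nat.exists_eq_succ_of_ne_zero hu.ne'
    rw [h₃.1, h₃.2.1, h₃.2.2.1, h₃.2.2.2]
    refine ⟨rfl, le_rfl, ?_, by simp, by simp⟩
    conv_rhs => rw [hv, Nat.succ_eq_add_one, pow_succ,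
      Nat.mul_div_cancel _ (by rw [← Nat.succ_eq_add_one, ← hv]; omega)]
    rw [hv]; rfl
  · rintro n t hn hf' ⟨h20, -, h21, h78, ho⟩
    have hc' := hc₃.frame hf' rfl (by decide)
    rw [pow_succ, Nat.mul_div_cancel _ (by omega)] at h21
    rw [pack_succ', add_zero] at h78
    have hlt : pack (base p u) n (fun j => f (u - (n + 1) + (j + 1))) < base p u ^ n :=
      pack_lt fun j hj => (hf _ (by omega)).trans hpB
    have hfd := hf (u - (n + 1)) (by omega)
    have h78' := h.lt_of_lt_pow (pack_lt (D := n + 1)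
      (f := fun j => f (u - (n + 1) + j)) fun j hj => (hf _ (by omega)).trans hpB) (by omega)
    rw [pack_succ', add_zero] at h78'
    have hdiv : (f (u - (n + 1)) * base p u ^ n +
        pack (base p u) n fun j => f (u - (n + 1) + (j + 1))) / base p u ^ n =
        f (u - (n + 1)) := by
      rw [add_comm, Nat.add_mul_div_right _ _ (by omega), Nat.div_eq_of_lt hlt, zero_add]
    have hmod : (f (u - (n + 1)) * base p u ^ n +
        pack (base p u) n fun j => f (u - (n + 1) + (j + 1))) % base p u ^ n =
        pack (base p u) n fun j => f (u - (n + 1) + (j + 1)) := by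
      rw [add_comm, Nat.add_mul_mod_self_right, Nat.mod_eq_of_lt hlt]
    have hpw := h.pow_lt (k := n) (by omega)
    have hpd : base p u ^ n / base p u ≤ base p u ^ n := Nat.div_le_self _ _
    refine ⟨by omega, by omega, Runs.of_wp ?_⟩
    simp only [blk, Prog.wp, State.put, Op.apply, Function.update_apply, reduceIte, Nat.reduceEqDiff, and_true,
      true_and, hc'.h8, hc'.h4, h20, h21, h78, ho, hdiv, hmod]
    refine ⟨by omega, by omega, by omega, by omega, by omega, by omega, by omega, by omega,
      by omega, by omega, by omega, by omega, by omega, by omega, by omega, ?_, ?_⟩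
    · congr 1
      funext j
      congr 1
      omega
    · rw [show u - n = u - (n + 1) + 1 by omega, List.range_succ]
      simp
  · exact fun _ _ h => h.1
  · rintro t - ⟨-, -, -, -, ho⟩
    rw [ho, h₂.2.2.2, termCode]
    simp

/-- The digits of `1`. -/
def oneDigits (i : ℕ) : ℕ := if i = 0 then 1 else 0

/-- The code of the `i`-th polynomial. -/
def polyCode (ℓ u : ℕ) (f g : ℕ → ℕ → ℕ) (i : ℕ) : List ℕ :=
  3 :: (termCode ℓ u 2 i oneDigits ++ (termCode ℓ u 0 i (f i) ++ termCode ℓ u 1 (i - 1) (g i)))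

/-- Write the polynomials. The cells `70` and `71` hold the coefficients of the next polynomial,
the cells `72` and `73` those of the one after it. -/
def polysP : Prog :=
  .loop 75 (blk [blk [.const 22 3, .write 22, .arith .add 76 10 11, .arith .add 77 74 11,
      .arith .add 78 6 11], termP,
    blk [.const 76 0, .arith .add 78 70 11], termP,
    blk [.arith .add 76 8 11, .arith .sub 77 74 8, .arith .add 78 71 11], termP,
    blk [.arith .add 70 72 11, .arith .add 71 73 11, .arith .add 72 11 11, .arith .add 73 6 11,
      .arith .add 74 74 8, .arith .sub 75 75 8]])

theorem pack_oneDigits (B : ℕ) {u : ℕ} (hu : 0 < u) : pack B u oneDigits = B ^ (u - 1) := by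
  obtain ⟨v, rfl⟩ := Nat.exists_eq_succ_of_ne_zero hu.ne'
  rw [Nat.succ_eq_add_one, pack_succ', add_tsub_cancel_right]
  simp [pack, oneDigits]

/-- The coefficients move through a queue of length two that is refilled with `0` and `1`. Therefore
`f` and `g` are free at the indices `0` and `1` only. -/
theorem polysP_runs {p u ℓ e L : ℕ} {c : ℕ → ℕ} {θ : F} (h : Setup p u ℓ e L c θ) {s : State}
    (hc : Ctx p u ℓ e c s) {f g : ℕ → ℕ → ℕ} (hf : ∀ i, ∀ j < u, f i j < p)
    (hg : ∀ i, ∀ j < u, g i j < p) (hf2 : ∀ i, 2 ≤ i → f i = fun _ => 0)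
    (hg2 : ∀ i, 2 ≤ i → g i = oneDigits) (h70 : s.mem 70 = pack (base p u) u (f 0))
    (h71 : s.mem 71 = pack (base p u) u (g 0)) (h72 : s.mem 72 = pack (base p u) u (f 1))
    (h73 : s.mem 73 = pack (base p u) u (g 1)) (h74 : s.mem 74 = 0) (h75 : s.mem 75 = ℓ) :
    Runs L polysP s (1 + ℓ * (35 + ℓ * 27 + u * 18)) fun s' =>
      s'.output = s.output ++ (List.range ℓ).flatMap (polyCode ℓ u f g) := by
  have h1L := h.one_lt
  have hℓL := h.length_le
  have hpB := h.p_lt_base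
  have hp := h.two_lt
  have hTL := h.pow_lt (k := u - 1) (by omega)
  have hu := h.pos
  have hle : ∀ {f : ℕ → ℕ}, (∀ j < u, f j < p) → pack (base p u) u f < 2 ^ L := fun hf =>
    h.lt_of_lt_pow (pack_lt fun j hj => (hf j hj).trans hpB) (by omega)
  refine Runs.mono (Runs.loop (fun n t => n ≤ ℓ ∧ t.mem 75 = n ∧ t.mem 74 = ℓ - n ∧
    t.mem 70 = pack (base p u) u (f (ℓ - n)) ∧ t.mem 71 = pack (base p u) u (g (ℓ - n)) ∧
    t.mem 72 = pack (base p u) u (f (ℓ - n + 1)) ∧ t.mem 73 = pack (base p u) u (g (ℓ - n + 1)) ∧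
    t.output = s.output ++ (List.range (ℓ - n)).flatMap (polyCode ℓ u f g)) (n := ℓ)
    (k := 5 + ((6 + ℓ * 9 + u * 6) + (2 + ((6 + ℓ * 9 + u * 6) + (3 + ((6 + ℓ * 9 + u * 6) + 6))))))
    ?_ ?_ ?_) ?_ ?_
  · simp [h70, h71, h72, h73, h74, h75]
  · rintro n t hn hf' ⟨-, h75, h74, h70, h71, h72, h73, ho⟩
    have hc' := hc.frame hf' rfl (by decide)
    refine ⟨by omega, by omega, ?_⟩
    have hone : ∀ j < u, oneDigits j < p := fun j _ => by unfold oneDigits; split_ifs <;> omega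
    have l₁ := hle (hf (ℓ - (n + 1)))
    have l₂ := hle (hg (ℓ - (n + 1)))
    have l₃ := hle (hf (ℓ - (n + 1) + 1))
    have l₄ := hle (hg (ℓ - (n + 1) + 1))
    refine Runs.seq (Q₁ := fun t' => t'.mem 76 = 2 ∧ t'.mem 77 = ℓ - (n + 1) ∧
      t'.mem 78 = base p u ^ (u - 1) ∧ t'.output = t.output ++ [3])
      (Runs.of_wp ?_) fun s₁ hf₁ h₁ => ?_
    · simp only [blk, Prog.wp, State.put, Op.apply, Function.update_apply, reduceIte, Nat.reduceEqDiff, and_true,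
      true_and, hc'.h6, hc'.h10, hc'.h11, h74]
      omega
    have hc₁ := hc'.frame hf₁ rfl (by decide)
    refine Runs.seq (termP_runs h hc₁ hone h₁.1 h₁.2.1
      (by rw [pack_oneDigits _ hu, h₁.2.2.1]) (by norm_num) (by omega)) fun s₂ hf₂ h₂ => ?_
    have hc₂ := hc₁.frame hf₂ rfl (by decide)
    have a70 : s₂.mem 70 = pack (base p u) u (f (ℓ - (n + 1))) := by
      rw [hf₂.mem rfl 70 (by decide), hf₁.mem rfl 70 (by decide), h70]
    have a77 : s₂.mem 77 = ℓ - (n + 1) := by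
      rw [hf₂.mem rfl 77 (by decide), h₁.2.1]
    refine Runs.seq (Q₁ := fun t' => t'.mem 76 = 0 ∧ t'.mem 77 = ℓ - (n + 1) ∧
      t'.mem 78 = s₂.mem 70 ∧ t'.output = s₂.output)
      (Runs.of_wp ?_) fun s₃ hf₃ h₃ => ?_
    · simp only [blk, Prog.wp, State.put, Op.apply, Function.update_apply, reduceIte, Nat.reduceEqDiff, and_true,
      true_and, hc₂.h11, a77]
      omega
    have hc₃ := hc₂.frame hf₃ rfl (by decide)
    refine Runs.seq (termP_runs h hc₃ (hf (ℓ - (n + 1))) h₃.1 h₃.2.1 (by rw [h₃.2.2.1, a70])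
      (by norm_num) (by omega)) fun s₄ hf₄ h₄ => ?_
    have hc₄ := hc₃.frame hf₄ rfl (by decide)
    have b71 : s₄.mem 71 = pack (base p u) u (g (ℓ - (n + 1))) := by
      rw [hf₄.mem rfl 71 (by decide), hf₃.mem rfl 71 (by decide), hf₂.mem rfl 71 (by decide),
        hf₁.mem rfl 71 (by decide), h71]
    have b74 : s₄.mem 74 = ℓ - (n + 1) := by
      rw [hf₄.mem rfl 74 (by decide), hf₃.mem rfl 74 (by decide), hf₂.mem rfl 74 (by decide),
        hf₁.mem rfl 74 (by decide), h74]
    refine Runs.seq (Q₁ := fun t' => t'.mem 76 = 1 ∧ t'.mem 77 = ℓ - (n + 1) - 1 ∧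
      t'.mem 78 = s₄.mem 71 ∧ t'.output = s₄.output)
      (Runs.of_wp ?_) fun s₅ hf₅ h₅ => ?_
    · simp only [blk, Prog.wp, State.put, Op.apply, Function.update_apply, reduceIte, Nat.reduceEqDiff, and_true,
      true_and, hc₄.h11, hc₄.h8, b74]
      omega
    have hc₅ := hc₄.frame hf₅ rfl (by decide)
    refine Runs.seq (termP_runs h hc₅ (hg (ℓ - (n + 1))) h₅.1 h₅.2.1 (by rw [h₅.2.2.1, b71])
      (by norm_num) (by omega)) fun s₆ hf₆ h₆ => ?_
    have hc₆ := hc₅.frame hf₆ rfl (by decide)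
    have hk : ∀ r ∈ [72, 73, 74, 75], s₆.mem r = t.mem r := by
      intro r hr
      rw [hf₆.mem rfl r (by revert r; decide), hf₅.mem rfl r (by revert r; decide),
        hf₄.mem rfl r (by revert r; decide), hf₃.mem rfl r (by revert r; decide),
        hf₂.mem rfl r (by revert r; decide), hf₁.mem rfl r (by revert r; decide)]
    have hout : s₆.output = s.output ++
        (List.range (ℓ - n)).flatMap (polyCode ℓ u f g) := by
      rw [h₆, h₅.2.2.2, h₄, h₃.2.2.2, h₂, h₁.2.2.2, ho, show ℓ - n = ℓ - (n + 1) + 1 by omega,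
        List.range_succ, List.flatMap_append]
      simp [polyCode]
    refine Runs.of_wp ?_
    simp only [blk, Prog.wp, State.put, Op.apply, Function.update_apply, reduceIte, Nat.reduceEqDiff, and_true,
      true_and, hc₆.h11, hc₆.h6, hc₆.h8, hk 72 (by decide), hk 73 (by decide),
      hk 74 (by decide), hk 75 (by decide), h72, h73, h74, h75, hout, add_zero]
    refine ⟨by omega, by omega, by omega, by omega, by omega, by omega, by omega, by omega,
      by omega, by omega, by omega, by omega, by omega, by omega, by omega, by omega, by omega,
      by omega, by omega, by omega, by omega, ?_, ?_, ?_, ?_⟩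
    · rw [show ℓ - (n + 1) + 1 = ℓ - n by omega]
    · rw [show ℓ - (n + 1) + 1 = ℓ - n by omega]
    · rw [hf2 _ (by omega)]; simp [pack]
    · rw [hg2 _ (by omega), pack_oneDigits _ hu]
  · exact fun _ _ h => h.2.1
  · exact Nat.add_le_add_left (Nat.mul_le_mul_left _ (by omega)) _
  · rintro t - ⟨-, -, -, -, -, -, -, ho⟩
    simpa using ho

end Tower

/-! ### Input, choice of the tower, and the whole program. -/

namespace Tower

open RAM Finset

variable {F : Type*} [CommRing F]

/-- Read the input, and fill the cells with the contents that are computed once for all. -/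
def initP : Prog := blk
  [blk [.read 0, .read 1, .read 2, .read 3, .const 8 1, .const 10 2, .const 4 4,
     .arith .mul 4 4 1, .arith .mul 4 4 0, .arith .mul 4 4 0, .const 5 0, .const 6 1, .const 7 1,
     .arith .add 20 1 11],
   .loop 20 (blk [.read 22, .arith .sub 22 0 22, .arith .mul 5 5 4, .arith .add 5 5 22,
     .arith .mul 6 6 4, .arith .mul 7 7 0, .arith .sub 20 20 8]),
   .arith .div 6 6 4]

theorem initP_runs {p u ℓ e L : ℕ} {c : ℕ → ℕ} {θ : F} (h : Setup p u ℓ e L c θ)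
    (w : List Bool) :
    Runs L initP (State.init ([p, u, ℓ, e] ++ (List.range u).map c) w) (16 + u * 8) fun s' =>
      Ctx p u ℓ e c s' ∧ s'.coins = w := by
  have h1L := h.one_lt
  have hpL := h.p_lt
  have huL := h.u_lt
  have hℓL := h.length_le
  have heL := h.trials_le
  have hB := h.base_ge
  have hBL := h.base_lt
  have hp := h.two_lt
  have hpB := h.p_lt_base
  have hu := h.pos
  have hbase : base p u = 4 * u * p * p := by unfold base; ring
  refine Runs.mono (k := 14 + ((1 + u * (1 + 7)) + 1)) ?_ (by omega) (fun _ _ h => h)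
  refine Runs.seq (Q₁ := fun t => t.mem 0 = p ∧ t.mem 1 = u ∧ t.mem 2 = ℓ ∧ t.mem 3 = e ∧
    t.mem 4 = base p u ∧ t.mem 5 = 0 ∧ t.mem 6 = 1 ∧ t.mem 7 = 1 ∧ t.mem 8 = 1 ∧ t.mem 10 = 2 ∧
    t.mem 11 = 0 ∧ t.mem 20 = u ∧ t.input = (List.range' 0 u).map c ∧ t.coins = w)
    (Runs.of_wp ?_) fun s₁ hf₁ h₁ => ?_
  · have l₁ : 4 * u ≤ base p u := by
      rw [hbase, mul_assoc]; exact Nat.le_mul_of_pos_right _ (by positivity)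
    have l₂ : 4 * u * p ≤ base p u := by
      rw [hbase]; exact Nat.le_mul_of_pos_right _ (by omega)
    simp only [blk, Prog.wp, State.put, Op.apply, Function.update_apply, reduceIte, Nat.reduceEqDiff, and_true,
      true_and, State.init, List.cons_append, List.nil_append, List.cons.injEq,
      exists_and_left, exists_eq_left', exists_eq_left, and_assoc, add_zero, ← hbase,
      List.range_eq_range']
    omega
  obtain ⟨a0, a1, a2, a3, a4, a5, a6, a7, a8, a10, a11, a20, ai, aw⟩ := h₁
  refine Runs.seq (Runs.loop (fun n t => t.mem 20 = n ∧ n ≤ u ∧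
    t.mem 5 = pack (base p u) (u - n) (fun j => p - c j) ∧ t.mem 6 = base p u ^ (u - n) ∧
    t.mem 7 = p ^ (u - n) ∧ t.input = (List.range' (u - n) n).map c ∧ t.coins = w)
    (n := u) (k := 7) ?_ ?_ ?_) fun s₂ hf₂ h₂ => ?_
  · simp [a5, a6, a7, a20, ai, aw, pack_zero]
  · rintro n t hn hf ⟨h20, -, h5, h6, h7, hi, hw⟩
    have e0 : t.mem 0 = p := by rw [hf.mem rfl 0 (by decide), a0]
    have e4 : t.mem 4 = base p u := by rw [hf.mem rfl 4 (by decide), a4]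
    have e8 : t.mem 8 = 1 := by rw [hf.mem rfl 8 (by decide), a8]
    have hk : u - (n + 1) + 1 = u - n := by omega
    have hnew := pack_succ (base p u) (u - (n + 1)) fun j => p - c j
    rw [hk, mul_comm, add_comm] at hnew
    rw [List.range'_succ, List.map_cons] at hi
    have hlt : ∀ k ≤ u, pack (base p u) k (fun j => p - c j) < 2 ^ L := fun k hk =>
      h.lt_of_lt_pow (pack_lt fun j _ => (Nat.sub_le _ _).trans_lt hpB) (by omega)
    have l₁ := hlt (u - (n + 1)) (by omega)
    have l₂ := hlt (u - n) (by omega)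
    have l₃ := h.pow_lt (k := u - (n + 1)) (by omega)
    have l₄ := h.pow_lt (k := u - n) (by omega)
    have l₅ : p ^ (u - (n + 1)) ≤ base p u ^ (u - (n + 1)) := Nat.pow_le_pow_left hpB.le _
    have l₆ : p ^ (u - n) ≤ base p u ^ (u - n) := Nat.pow_le_pow_left hpB.le _
    have l₇ := h.lt (u - (n + 1)) (by omega)
    have e6 : base p u ^ (u - (n + 1)) * base p u = base p u ^ (u - n) := by rw [← pow_succ, hk]
    have e7 : p ^ (u - (n + 1)) * p = p ^ (u - n) := by rw [← pow_succ, hk]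
    refine ⟨by omega, by omega, Runs.of_wp ?_⟩
    simp only [blk, Prog.wp, State.put, Op.apply, Function.update_apply, reduceIte, Nat.reduceEqDiff, and_true,
      true_and, e0, e4, e8, h20, h5, h6, h7, hi, hw, List.cons.injEq,
      exists_and_left, exists_eq_left', exists_eq_left, and_assoc, ← hnew, e6, e7, hk]
    rw [hnew]
    omega
  · exact fun _ _ h => h.1
  obtain ⟨-, -, b5, b6, b7, -, bw⟩ := h₂
  rw [Nat.sub_zero] at b5 b6 b7
  have hk : ∀ r ∈ [0, 1, 2, 3, 4, 8, 10, 11], s₂.mem r = s₁.mem r := by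
    intro r hr
    rw [hf₂.mem rfl r (by revert r; decide)]
  -- The loop has accumulated `base p u ^ u`; the code of `1` is one power lower.
  have e6 : base p u ^ u / base p u = base p u ^ (u - 1) := by
    conv_lhs => rw [show u = u - 1 + 1 by omega, pow_succ]
    rw [show u - 1 + 1 = u by omega, Nat.mul_div_cancel _ (by omega)]
  have l₁ := h.pow_lt (k := u) (by omega)
  have l₂ := h.pow_lt (k := u - 1) (by omega)
  have e4 := (hk 4 (by decide)).trans a4
  refine Runs.of_wp ?_
  simp only [blk, Prog.wp, State.put, Op.apply, Function.update_apply, reduceIte, Nat.reduceEqDiff, and_true,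
      true_and, e4, b6, e6]
  refine ⟨l₁, hBL, l₂, ⟨?_, ?_, ?_, ?_, ?_, ?_, ?_, ?_, ?_, ?_, ?_⟩, bw⟩
  all_goals simp only [Function.update_apply, reduceIte, Nat.reduceEqDiff]
  exacts [(hk 0 (by decide)).trans a0, (hk 1 (by decide)).trans a1, (hk 2 (by decide)).trans a2,
    (hk 3 (by decide)).trans a3, e4, b5, b7, (hk 8 (by decide)).trans a8,
    (hk 10 (by decide)).trans a10, (hk 11 (by decide)).trans a11]

/-- Write the polynomials that belong to the good pair. -/
def successP : Prog := blk
  [blk [.const 22 4, .arith .mod 22 7 22, .arith .sub 22 22 8,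
     .cond 22 (blk [.arith .add 70 6 11, .arith .add 72 50 11, .arith .add 73 51 11])
       (blk [.arith .add 70 52 11, .arith .add 72 11 11, .arith .add 73 6 11]),
     .const 71 0, .write 8, .const 74 0, .arith .add 75 2 11],
   polysP]

/-- The output `out` is the code of the polynomials `w_i ^ 2 + A_i + B_i * w_{i-1}`, where the
elements `A_i` and `B_i` have the digits `f i` and `g i`. -/
structure IsTowerCode (θ : F) (p u ℓ : ℕ) (f g : ℕ → ℕ → ℕ) (out : List ℕ) : Prop where
  left_lt : ∀ i, ∀ j < u, f i j < p
  right_lt : ∀ i, ∀ j < u, g i j < p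
  out_eq : out = 1 :: (List.range ℓ).flatMap (polyCode ℓ u f g)
  left_eq : ∀ i, 2 ≤ i → f i = fun _ => 0
  right_eq : ∀ i, 2 ≤ i → g i = oneDigits
  right_zero : g 0 = fun _ => 0
  cases : ∃ x y, Good θ p u x y ∧
    ((p ^ u % 4 = 1 ∧ ∑ j ∈ range u, (f 0 j : F) * θ ^ j = sumSq θ p u x y ∧
        (f 1 = fun _ => 0) ∧ g 1 = oneDigits) ∨
      (p ^ u % 4 = 3 ∧ f 0 = oneDigits ∧ ∑ j ∈ range u, (f 1 j : F) * θ ^ j = elt θ p u x ∧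
        ∑ j ∈ range u, (g 1 j : F) * θ ^ j = elt θ p u y))

/-- As `q` is odd, the truncated number `q % 4 - 1` is zero exactly for `q % 4 = 1`, and it selects
the shape of the tower. The plus signs in `w_i ^ 2 + A_i + B_i * w_{i-1}` save all negations. -/
theorem successP_runs {p u ℓ e L : ℕ} {c : ℕ → ℕ} {θ : F} (h : Setup p u ℓ e L c θ) {s : State}
    (hc : Ctx p u ℓ e c s) (hodd : p ^ u % 2 = 1) (hs : Found θ p u s) (ho : s.output = []) :
    Runs L successP s (15 + ℓ * (35 + ℓ * 27 + u * 18)) fun s' =>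
      ∃ f g, IsTowerCode θ p u ℓ f g s'.output := by
  have h1L := h.one_lt
  have hℓL := h.length_le
  have hpB := h.p_lt_base
  have hp := h.two_lt
  have hu := h.pos
  have hTL := h.pow_lt (k := u - 1) (by omega)
  have hqL := h.q_le.trans_lt (h.pow_lt (k := u) (by omega))
  have hle : ∀ {Z x}, Rep θ (base p u) u p Z x → Z < 2 ^ L := fun hZ =>
    h.lt_of_lt_pow (hZ.lt hpB.le) (by omega)
  have hone : ∀ j < u, oneDigits j < p := fun j _ => by unfold oneDigits; split_ifs <;> omega
  have hpo := pack_oneDigits (base p u) hu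
  have hp0 : 0 < p := by omega
  obtain ⟨-, x, y, hg, r50, r51, r52⟩ := hs
  have l50 := hle r50
  have l51 := hle r51
  have l52 := hle r52
  refine Runs.mono (k := (3 + (1 + (3 + 3) + 4)) + (1 + ℓ * (35 + ℓ * 27 + u * 18))) ?_
    (by omega) (fun _ _ h => h)
  have hmod : p ^ u % 4 < 4 := Nat.mod_lt _ (by norm_num)
  refine Runs.seq (Q₁ := fun t => t.mem 71 = 0 ∧ t.mem 74 = 0 ∧ t.mem 75 = ℓ ∧ t.output = [1] ∧
    ((p ^ u % 4 = 1 ∧ t.mem 70 = s.mem 52 ∧ t.mem 72 = 0 ∧ t.mem 73 = base p u ^ (u - 1)) ∨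
      (p ^ u % 4 = 3 ∧ t.mem 70 = base p u ^ (u - 1) ∧ t.mem 72 = s.mem 50 ∧
        t.mem 73 = s.mem 51))) (Runs.of_wp ?_) fun s₁ hf₁ h₁ => ?_
  · simp only [blk, Prog.wp, State.put, Op.apply, Function.update_apply, reduceIte, Nat.reduceEqDiff, and_true,
      true_and, hc.h2, hc.h6, hc.h7, hc.h8, hc.h11, ho, List.nil_append, add_zero]
    omega
  have hc₁ := hc.frame hf₁ rfl (by decide)
  obtain ⟨h71, h74, h75, ho₁, hcase⟩ := h₁
  have key : ∀ f₀ f₁ g₁ : ℕ → ℕ, (∀ j < u, f₀ j < p) → (∀ j < u, f₁ j < p) → (∀ j < u, g₁ j < p) →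
      s₁.mem 70 = pack (base p u) u f₀ → s₁.mem 72 = pack (base p u) u f₁ →
      s₁.mem 73 = pack (base p u) u g₁ →
      ((p ^ u % 4 = 1 ∧ ∑ j ∈ range u, (f₀ j : F) * θ ^ j = sumSq θ p u x y ∧
        (f₁ = fun _ => 0) ∧ g₁ = oneDigits) ∨
      (p ^ u % 4 = 3 ∧ f₀ = oneDigits ∧ ∑ j ∈ range u, (f₁ j : F) * θ ^ j = elt θ p u x ∧
        ∑ j ∈ range u, (g₁ j : F) * θ ^ j = elt θ p u y)) →
      Runs L polysP s₁ (1 + ℓ * (35 + ℓ * 27 + u * 18)) fun s' =>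
        ∃ f g, IsTowerCode θ p u ℓ f g s'.output := by
    intro f₀ f₁ g₁ hf₀ hf₁ hg₁ e70 e72 e73 hfin
    let f : ℕ → ℕ → ℕ := fun i => if i = 0 then f₀ else if i = 1 then f₁ else fun _ => 0
    let g : ℕ → ℕ → ℕ := fun i => if i = 0 then fun _ => 0 else if i = 1 then g₁ else oneDigits
    have hf : ∀ i, ∀ j < u, f i j < p := by
      intro i j hj
      dsimp only [f]
      split_ifs
      exacts [hf₀ j hj, hf₁ j hj, hp0]
    have hg' : ∀ i, ∀ j < u, g i j < p := by
      intro i j hj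
      dsimp only [g]
      split_ifs
      exacts [hp0, hg₁ j hj, hone j hj]
    have hf2 : ∀ i, 2 ≤ i → f i = fun _ => 0 := fun i hi => by
      simp only [f, show i ≠ 0 by omega, show i ≠ 1 by omega, if_false]
    have hg2 : ∀ i, 2 ≤ i → g i = oneDigits := fun i hi => by
      simp only [g, show i ≠ 0 by omega, show i ≠ 1 by omega, if_false]
    refine Runs.mono (polysP_runs h hc₁ (f := f) (g := g) hf hg' hf2 hg2 e70
      (by rw [h71]; simp [g, pack]) e72 e73 h74 h75) le_rfl fun s' _ hs' => ?_
    exact ⟨f, g, hf, hg', by rw [hs', ho₁]; rfl, hf2, hg2, rfl, x, y, hg, hfin⟩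
  rcases hcase with ⟨hq, e70, e72, e73⟩ | ⟨hq, e70, e72, e73⟩
  · obtain ⟨f₀, hf₀, h52, hv⟩ := r52
    exact key f₀ (fun _ => 0) oneDigits hf₀ (fun _ _ => hp0) hone (by rw [e70, h52])
      (by rw [e72]; simp [pack]) (by rw [e73, hpo]) (Or.inl ⟨hq, hv.symm, rfl, rfl⟩)
  · obtain ⟨f₁, hf₁, h50, hv⟩ := r50
    obtain ⟨g₁, hg₁, h51, hv'⟩ := r51
    exact key oneDigits f₁ g₁ hone hf₁ hg₁ (by rw [e70, hpo]) (by rw [e72, h50]) (by rw [e73, h51])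
      (Or.inr ⟨hq, rfl, hv.symm, hv'.symm⟩)

/-- The whole program. -/
def towerP : Prog := blk
  [initP, drawP, mainP, .cond 53 successP (blk [.const 22 0, .write 22])]

/-- A bound for the number of instructions. -/
def stepBound (u ℓ e b k : ℕ) : ℕ :=
  50 + u * 8 + b * 11 + (e * 2 ^ 19 + 1) * (70 + 32 * u + k * (40 * u + 31)) +
    ℓ * (35 + ℓ * 27 + u * 18)

theorem towerP_outputs {p u ℓ e L b : ℕ} {c : ℕ → ℕ} {θ : F} (h : Setup p u ℓ e L c θ)
    (hodd : p ^ u % 2 = 1) (hb : 16 * p ^ u ≤ 2 ^ b) (hb' : ∀ j < b, 2 ^ j < 16 * p ^ u)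
    {w : List Bool} (hw : w.length = 2 * b + 4 * (e * 2 ^ 19 + 1)) :
    ∃ out t, towerP.Outputs ([p, u, ℓ, e] ++ (List.range u).map c) w out t ∧
      t ≤ stepBound u ℓ e b (p ^ u / 2).size * (3 * L + 1) ∧
      ((∃ f g, IsTowerCode θ p u ℓ f g out) ∨ out = failure) ∧
      (Walk (Good θ p u) (2 ^ b) (e * 2 ^ 19 + 1) (draw b 0 0 w).1 (draw b 0 0 w).2.1
        (draw b 0 0 w).2.2 → ∃ f g, IsTowerCode θ p u ℓ f g out) := by
  have h1L := h.one_lt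
  have hB := h.base_ge
  have hu := h.pos
  -- Minimality of `b` gives `2 ^ b ≤ 32 * q`. Two spare factors `base p u ≥ 36` then leave room for
  -- the sums formed in a step of the walk.
  have hbL : 4 * 2 ^ b ≤ 2 ^ L := by
    have h1 : 2 ^ b ≤ 32 * p ^ u := by
      rcases Nat.eq_zero_or_pos b with rfl | hb0
      · have : 0 < p ^ u := pow_pos (by have := h.two_lt; omega) _
        rw [pow_zero]; omega
      · have := hb' (b - 1) (by omega)
        obtain ⟨d, rfl⟩ := Nat.exists_eq_succ_of_ne_zero hb0.ne'
        rw [Nat.succ_sub_one] at this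
        rw [pow_succ]
        omega
    have h2 : base p u ^ u * (36 * 36) ≤ 2 ^ L :=
      calc base p u ^ u * (36 * 36) ≤ base p u ^ u * (base p u * base p u) := by gcongr
        _ = base p u ^ (u + 2) := by ring
        _ ≤ base p u ^ (2 * u + 2) := Nat.pow_le_pow_right (by omega) (by omega)
        _ ≤ 2 ^ L := h.base_pow_le
    have h3 := h.q_le
    omega
  have hruns : Runs L towerP (State.init ([p, u, ℓ, e] ++ (List.range u).map c) w)
      (stepBound u ℓ e b (p ^ u / 2).size) fun s' =>
      ((∃ f g, IsTowerCode θ p u ℓ f g s'.output) ∨ s'.output = failure) ∧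
      (Walk (Good θ p u) (2 ^ b) (e * 2 ^ 19 + 1) (draw b 0 0 w).1 (draw b 0 0 w).2.1
        (draw b 0 0 w).2.2 → ∃ f g, IsTowerCode θ p u ℓ f g s'.output) := by
    refine Runs.mono (k := (16 + u * 8) + ((7 + b * 11) + ((4 + (e * 2 ^ 19 + 1) *
      (70 + 32 * u + (p ^ u / 2).size * (40 * u + 31))) +
      (1 + (15 + ℓ * (35 + ℓ * 27 + u * 18)))))) ?_ (by unfold stepBound; omega) (fun _ _ h => h)
    refine Runs.seq (initP_runs h w) fun s₁ hf₁ h₁ => ?_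
    obtain ⟨hc₁, hw₁⟩ := h₁
    have o₁ : s₁.output = [] := hf₁.output rfl
    have m₁ : s₁.mem 53 = 0 := hf₁.mem rfl 53 (by decide)
    refine Runs.seq (drawP_runs h hc₁ (R := 4 * (e * 2 ^ 19 + 1)) hb hb' (by omega)
      (by rw [hw₁, hw])) fun s₂ hf₂ h₂ => ?_
    obtain ⟨h12, h40, h41, hw₂, hd⟩ := h₂
    have hc₂ := hc₁.frame hf₂ rfl (by decide)
    have o₂ : s₂.output = [] := (hf₂.output rfl).trans o₁
    have m₂ : s₂.mem 53 = 0 := (hf₂.mem rfl 53 (by decide)).trans m₁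
    refine Runs.seq (mainP_runs h hc₂ hbL h12 h40 h41 m₂ hw₂) fun s₃ hf₃ h₃ => ?_
    have hc₃ := hc₂.frame hf₃ rfl (by decide)
    have o₃ : s₃.output = [] := (hf₃.output rfl).trans o₂
    rw [hw₁] at hd
    rw [hd]
    have h53 : s₃.mem 53 < 2 ^ L := by
      rcases h₃.2 with h0 | h0
      · omega
      · rw [h0.1]; omega
    refine Runs.cond h53 (fun hne => ?_) fun h0 => ?_
    · refine Runs.mono (successP_runs h hc₃ hodd (h₃.2.resolve_left hne) o₃) le_rfl
        fun s' _ hs' => ⟨Or.inl hs', fun _ => hs'⟩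
    · refine Runs.mono (k := 2) (Runs.of_wp (Q := fun s' => s'.output = failure) ?_) (by omega)
        fun s' _ hs' => ⟨Or.inr hs', fun hW => ?_⟩
      · simp only [blk, Prog.wp, State.put, Op.apply, Function.update_apply, reduceIte, Nat.reduceEqDiff, and_true,
      true_and, o₃]
        exact ⟨by omega, by omega, rfl⟩
      · have := (h₃.1 hW).1
        omega
  obtain ⟨s', t, he, ht, hQ⟩ := hruns
  exact ⟨s'.output, t, ⟨s', he, rfl⟩, ht, hQ⟩

end Tower

/-! ### Towers of quadratic extensions -/

namespace Tower

open MvPolynomial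

section powers

variable {K : Type*} [Field K]

/-- With `Q = 4 * k + 1` one has `w ^ (4 * k) = -1` and `Q ^ 2 - 1 = 2 * (4 * k * (2 * k + 1))`, so
that `v ^ (Q ^ 2 - 1) = (-1) ^ (2 * k + 1)`. The congruence for `Q` is what makes the last exponent
odd. -/
theorem pow_eq_neg_self_of_sq {Q : ℕ} {v w : K} (hQ : Q % 4 = 1) (hw : w ^ Q = -w) (hw0 : w ≠ 0)
    (hv : v ^ 2 = -w) : v ^ (Q ^ 2) = -v := by
  obtain ⟨k, rfl⟩ : ∃ k, Q = 4 * k + 1 := ⟨Q / 4, by omega⟩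
  have h1 : w ^ (4 * k) = -1 := by
    rw [pow_succ] at hw
    have : (w ^ (4 * k) + 1) * w = 0 := by linear_combination hw
    exact eq_neg_of_add_eq_zero_left ((mul_eq_zero.1 this).resolve_right hw0)
  have h2 : (4 * k + 1) ^ 2 = 2 * (4 * k * (2 * k + 1)) + 1 := by ring
  rw [h2, pow_succ, pow_mul, hv, pow_mul, neg_pow, h1]
  have h3 : Even (4 * k) := ⟨2 * k, by ring⟩
  rw [h3.neg_one_pow, one_mul, pow_succ, pow_mul]
  simp

end powers

variable {F : Type*} [Field F]

/-- Odd squares are `1` modulo `4`, so level 0 with `q % 4 = 3` is the only obstacle to taking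
`w_{n+1} ^ 2 = -w_n`. -/
theorem card_pow_mod_four {q : ℕ} (hq : q % 2 = 1) (n : ℕ) (h : q % 4 = 1 ∨ n ≠ 0) :
    q ^ 2 ^ n % 4 = 1 := by
  have hsq : q ^ 2 % 4 = 1 := by
    rcases (by omega : q % 4 = 1 ∨ q % 4 = 3) with h | h <;> simp [Nat.pow_mod, h]
  rcases n with _ | n
  · simpa using h
  · rw [pow_succ', pow_mul, Nat.pow_mod, hsq]
    simp

/-- The recursion for generators of the successive quadratic extensions. -/
structure QuadraticCoeffs (q : ℕ) (α β : ℕ → F) : Prop where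
  left : ∀ i, 2 ≤ i → α i = 0
  right : ∀ i, 2 ≤ i → β i = 1
  zero : β 0 = 0
  cases : (q % 4 = 1 ∧ α 0 ^ (q / 2) = -1 ∧ α 1 = 0 ∧ β 1 = 1) ∨
    (q % 4 = 3 ∧ α 0 = 1 ∧ (α 1 * α 1 + β 1 * β 1) ^ (q / 2) = -1)

theorem two_ne_zero_of_card_odd [Fintype F] (h : Fintype.card F % 2 = 1) : (2 : F) ≠ 0 := by
  apply Ring.two_ne_zero
  rw [Ne, FiniteField.even_card_iff_char_two]
  omega

section roots

variable {K : Type*} [Field K] [Algebra F K]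

/-- At `i = 0` the truncated index `i - 1` is `0` again; the equation is not circular because `β 0 =
0`. -/
theorem exists_roots [IsAlgClosed K] (α β : ℕ → F) (h0 : β 0 = 0) :
    ∃ w : ℕ → K, ∀ i, w i ^ 2 = -(algebraMap F K (α i) + algebraMap F K (β i) * w (i - 1)) := by
  have hs : ∀ x : K, ∃ y, y ^ 2 = x := fun x => IsAlgClosed.exists_pow_nat_eq x two_pos
  choose r hr using hs
  refine ⟨fun n => Nat.rec (r (-algebraMap F K (α 0)))
    (fun n y => r (-(algebraMap F K (α (n + 1)) + algebraMap F K (β (n + 1)) * y))) n,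
    fun i => ?_⟩
  rcases i with _ | i
  · simp [h0, hr]
  · simp [hr]

/-- After the first one or two levels, `pow_eq_neg_self_of_sq` carries the induction. For `q % 4 =
1`, level 0 is Euler's criterion, as `(-1) ^ (q / 2) = 1`. For `q % 4 = 3`, Frobenius conjugates `w
0`, so `(w 1 ^ 2) ^ (q + 1)` is the norm `α 1 ^ 2 + β 1 ^ 2`; raising it to the power `q / 2` gives
`w 1 ^ (q ^ 2 - 1) = -1`. -/
theorem roots_pow [Fintype F] {q : ℕ} (hcard : Fintype.card F = q) (hq : q % 2 = 1)
    {α β : ℕ → F} (h : QuadraticCoeffs q α β) {w : ℕ → K}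
    (hw : ∀ i, w i ^ 2 = -(algebraMap F K (α i) + algebraMap F K (β i) * w (i - 1))) (n : ℕ) :
    w n ^ (q ^ 2 ^ n) = -w n ∧ w n ≠ 0 := by
  have hq0 : q ≠ 0 := by omega
  have hq2 : q / 2 ≠ 0 := by
    have := Fintype.one_lt_card (α := F)
    omega
  have step : ∀ n, (q % 4 = 1 ∨ n ≠ 0) → α (n + 1) = 0 → β (n + 1) = 1 →
      (w n ^ (q ^ 2 ^ n) = -w n ∧ w n ≠ 0) →
      w (n + 1) ^ (q ^ 2 ^ (n + 1)) = -w (n + 1) ∧ w (n + 1) ≠ 0 := by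
    intro n hn ha hb ih
    have h1 := hw (n + 1)
    rw [ha, hb] at h1
    simp only [map_zero, map_one, zero_add, one_mul, add_tsub_cancel_right] at h1
    refine ⟨?_, ?_⟩
    · rw [pow_succ 2 n, pow_mul]
      exact pow_eq_neg_self_of_sq (card_pow_mod_four hq n hn) ih.1 ih.2 h1
    · intro h0
      rw [h0] at h1
      exact ih.2 (by simpa using h1.symm)
  have h0 := hw 0
  rw [h.zero] at h0
  simp only [map_zero, zero_mul, add_zero] at h0
  rcases h.cases with ⟨h4, hα, hα1, hβ1⟩ | ⟨h4, hα, hN⟩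
  · have base : w 0 ^ (q ^ 2 ^ 0) = -w 0 ∧ w 0 ≠ 0 := by
      refine ⟨?_, ?_⟩
      · have hq' : q = 2 * (q / 2) + 1 := by omega
        have he : Even (q / 2) := ⟨q / 4, by omega⟩
        rw [pow_zero, pow_one]
        conv_lhs => rw [hq']
        rw [pow_succ, pow_mul, h0, neg_pow, he.neg_one_pow, ← map_pow, hα]
        simp
      · intro hz
        rw [hz] at h0
        have : α 0 = 0 := by simpa using h0.symm
        rw [this, zero_pow hq2] at hα
        exact neg_ne_zero.2 one_ne_zero hα.symm
    induction n with
    | zero => exact base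
    | succ n ih =>
      rcases n with _ | n
      · exact step 0 (Or.inl h4) hα1 hβ1 base
      · exact step (n + 1) (Or.inl h4) (h.left _ (by omega)) (h.right _ (by omega)) ih
  · rw [hα, map_one] at h0
    have hqq : q = 2 * (q / 2) + 1 := by omega
    have ho : Odd (q / 2) := ⟨q / 4, by omega⟩
    have e0 : w 0 ^ q = -w 0 := by
      conv_lhs => rw [hqq]
      rw [pow_succ, pow_mul, h0, ho.neg_one_pow]
      ring
    have hfrob : ∀ a b : F, (algebraMap F K a + algebraMap F K b * w 0) ^ q =
        algebraMap F K a - algebraMap F K b * w 0 := by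
      intro a b
      obtain ⟨r, hr⟩ := CharP.exists F
      have := Fact.mk (CharP.char_is_prime F r)
      have : CharP K r := charP_of_injective_algebraMap (algebraMap F K).injective r
      obtain ⟨m, -, hm⟩ := FiniteField.card F r
      rw [← hcard, hm, add_pow_char_pow, ← hm, mul_pow, ← map_pow, ← map_pow,
        FiniteField.pow_card, FiniteField.pow_card, hcard, e0]
      ring
    have h1 := hw 1
    simp only [Nat.sub_self] at h1
    have hnorm : (w 1 ^ 2) ^ (q + 1) =
        algebraMap F K (α 1 * α 1 + β 1 * β 1) := by
      have hev : Even (q + 1) := ⟨(q + 1) / 2, by omega⟩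
      rw [h1, neg_pow, hev.neg_one_pow, one_mul, pow_succ, hfrob]
      simp only [map_add, map_mul]
      linear_combination - algebraMap F K (β 1) ^ 2 * h0
    have base : w 1 ^ (q ^ 2 ^ 1) = -w 1 ∧ w 1 ≠ 0 := by
      refine ⟨?_, ?_⟩
      · have hq' : q ^ 2 ^ 1 = 2 * (q + 1) * (q / 2) + 1 := by
          generalize q / 2 = k at hqq
          subst hqq
          ring
        rw [hq', pow_succ, pow_mul, pow_mul, hnorm, ← map_pow, hN]
        simp
      · intro hz
        rw [hz] at hnorm
        rw [zero_pow two_ne_zero, zero_pow (by omega)] at hnorm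
        have : α 1 * α 1 + β 1 * β 1 = 0 := (map_eq_zero _).1 hnorm.symm
        rw [this, zero_pow hq2] at hN
        exact neg_ne_zero.2 one_ne_zero hN.symm
    rcases n with _ | n
    · refine ⟨by simpa using e0, ?_⟩
      intro hz
      rw [hz] at h0
      simp at h0
    induction n with
    | zero => exact base
    | succ n ih =>
      exact step (n + 1) (Or.inr (by omega)) (h.left _ (by omega)) (h.right _ (by omega)) ih

/-- Under `y ↦ y ^ q` the point `x` returns after `2 ^ (n + 1)` steps but not after `2 ^ n`, so its
minimal period is `2 ^ (n + 1)`, which divides every period `d`. -/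
theorem two_pow_dvd_of_pow_eq {q n d : ℕ} {x : K} (hne : (2 : K) ≠ 0) (hx0 : x ≠ 0)
    (hq : q % 2 = 1) (hx : x ^ (q ^ 2 ^ n) = -x) (hd : x ^ (q ^ d) = x) : 2 ^ (n + 1) ∣ d := by
  have hit : ∀ m, (fun y : K => y ^ q)^[m] x = x ^ (q ^ m) := by
    intro m
    induction m with
    | zero => simp
    | succ m ih => rw [Function.iterate_succ_apply', ih, ← pow_mul, pow_succ]
  have h1 : ¬ Function.IsPeriodicPt (fun y : K => y ^ q) (2 ^ n) x := by
    rw [Function.IsPeriodicPt, Function.IsFixedPt, hit, hx]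
    intro h
    have : 2 * x = 0 := by linear_combination -h
    exact (mul_ne_zero hne hx0) this
  have h2 : Function.IsPeriodicPt (fun y : K => y ^ q) (2 ^ (n + 1)) x := by
    rw [Function.IsPeriodicPt, Function.IsFixedPt, hit, pow_succ 2 n, pow_mul, sq, pow_mul, hx,
      Odd.neg_pow, hx, neg_neg]
    exact Odd.pow (Nat.odd_iff.2 hq)
  rw [← Function.minimalPeriod_eq_prime_pow (hp := ⟨Nat.prime_two⟩) h1 h2]
  refine Function.IsPeriodicPt.minimalPeriod_dvd ?_
  rw [Function.IsPeriodicPt, Function.IsFixedPt, hit, hd]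

end roots

/-- The polynomials `w_i ^ 2 + α_i + β_i * w_{i-1}`. -/
noncomputable def quadratic (ℓ : ℕ) (α β : ℕ → F) (i : Fin ℓ) : MvPolynomial (Fin ℓ) F :=
  X i ^ 2 + (C (α i) + C (β i) * X ⟨i - 1, (Nat.sub_le _ _).trans_lt i.2⟩)

section span

variable {A : Type*} [CommRing A] [Algebra F A] {ℓ : ℕ} {α β : ℕ → F} {x : Fin ℓ → A}

/-- If `x i` already occurs in a squarefree monomial, multiplying by it creates `x i * x i`, which
the relation turns into a constant and a multiple of `x (i - 1)`; induction on `i` handles the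
latter. The span is therefore closed under multiplication by the generators, and it contains `1`. -/
theorem span_squarefree (h0 : β 0 = 0)
    (hrel : ∀ i : Fin ℓ, x i * x i = -(algebraMap F A (α i) +
      algebraMap F A (β i) * x ⟨i - 1, (Nat.sub_le _ _).trans_lt i.2⟩))
    (htop : Algebra.adjoin F (Set.range x) = ⊤) :
    Submodule.span F (Set.range fun s : Finset (Fin ℓ) => ∏ i ∈ s, x i) = ⊤ := by
  obtain ⟨V, hV⟩ : ∃ V, V = Submodule.span F (Set.range fun s : Finset (Fin ℓ) => ∏ i ∈ s, x i) :=
    ⟨_, rfl⟩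
  have hmem : ∀ s : Finset (Fin ℓ), ∏ i ∈ s, x i ∈ V := fun s => by
    rw [hV]; exact Submodule.subset_span ⟨s, rfl⟩
  have hX' : ∀ n, ∀ i : Fin ℓ, (i : ℕ) = n → ∀ s : Finset (Fin ℓ), x i * ∏ j ∈ s, x j ∈ V := by
    intro n
    induction n with
    | zero =>
      intro i hi s
      by_cases his : i ∈ s
      · rw [← Finset.mul_prod_erase s _ his, ← mul_assoc, hrel i, show β i = 0 by rw [hi, h0],
          map_zero, zero_mul, add_zero, neg_mul, ← Algebra.smul_def]
        exact V.neg_mem (V.smul_mem _ (hmem _))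
      · rw [← Finset.prod_insert his]
        exact hmem _
    | succ n ih =>
      intro i hi s
      by_cases his : i ∈ s
      · rw [← Finset.mul_prod_erase s _ his, ← mul_assoc, hrel i, neg_mul, add_mul,
          mul_assoc, ← Algebra.smul_def, ← Algebra.smul_def]
        refine V.neg_mem (V.add_mem (V.smul_mem _ (hmem _)) (V.smul_mem _ (ih _ ?_ _)))
        simp [hi]
      · rw [← Finset.prod_insert his]
        exact hmem _
  have hX : ∀ (i : Fin ℓ) (y : A), y ∈ V → x i * y ∈ V := by
    intro i y hy
    rw [hV] at hy
    refine Submodule.span_induction (p := fun y _ => x i * y ∈ V) ?_ ?_ ?_ ?_ hy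
    · rintro _ ⟨s, rfl⟩
      exact hX' _ i rfl s
    · rw [mul_zero]; exact V.zero_mem
    · intro x y _ _ hx hy
      rw [mul_add]; exact V.add_mem hx hy
    · intro a x _ hx
      rw [mul_smul_comm]; exact V.smul_mem _ hx
  rw [← hV, eq_top_iff]
  rintro z -
  have hz : z ∈ Algebra.adjoin F (Set.range x) := by rw [htop]; trivial
  have key : ∀ y ∈ V, z * y ∈ V := by
    refine Algebra.adjoin_induction (p := fun z _ => ∀ y ∈ V, z * y ∈ V) ?_ ?_ ?_ ?_ hz
    · rintro _ ⟨i, rfl⟩ y hy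
      exact hX i y hy
    · intro a y hy
      rw [← Algebra.smul_def]
      exact V.smul_mem _ hy
    · intro z z' _ _ h h' y hy
      rw [add_mul]
      exact V.add_mem (h y hy) (h' y hy)
    · intro z z' _ _ h h' y hy
      rw [mul_assoc]
      exact h _ (h' y hy)
  have h1 := hmem ∅
  rw [Finset.prod_empty] at h1
  simpa using key 1 h1

/-- Irreducibility is not checked level by level. The dimension of `A` is at most `2 ^ ℓ`, and its
image in `K` is a finite field, whose degree is divisible by `2 ^ ℓ` because the last root lies in
it. Hence `A` maps isomorphically onto its image. -/
theorem isField_of_rel {K : Type*} [Field K] [Algebra F K] [Fintype F] {q : ℕ}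
    (hcard : Fintype.card F = q) (hq : q % 2 = 1) (h : QuadraticCoeffs q α β) {w : ℕ → K}
    (hw : ∀ i, w i ^ 2 = -(algebraMap F K (α i) + algebraMap F K (β i) * w (i - 1)))
    (hrel : ∀ i : Fin ℓ, x i * x i = -(algebraMap F A (α i) +
      algebraMap F A (β i) * x ⟨i - 1, (Nat.sub_le _ _).trans_lt i.2⟩))
    (htop : Algebra.adjoin F (Set.range x) = ⊤) (φ : A →ₐ[F] K) (hφ : ∀ i : Fin ℓ, φ (x i) = w i) :
    IsField A ∧ Module.finrank F A = 2 ^ ℓ := by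
  have hspan := span_squarefree h.zero hrel htop
  have hfin : Module.Finite F A := ⟨by rw [← hspan]; exact Submodule.fg_span (Set.finite_range _)⟩
  have hle : Module.finrank F A ≤ 2 ^ ℓ := by
    have := finrank_range_le_card (R := F) (fun s : Finset (Fin ℓ) => ∏ i ∈ s, x i)
    rw [Set.finrank, hspan, finrank_top] at this
    simpa using this
  have hne : (2 : K) ≠ 0 := by
    have := (map_ne_zero (algebraMap F K)).2 (two_ne_zero_of_card_odd (hcard ▸ hq))
    rwa [map_ofNat] at this
  have hA : Finite A := Module.finite_of_finite F
  have hr : Finite φ.range := Finite.of_surjective _ φ.rangeRestrict_surjective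
  have hrf : Module.Finite F φ.range := Module.Finite.of_finite
  have hge : 2 ^ ℓ ≤ Module.finrank F φ.range := by
    have hpos : 0 < Module.finrank F φ.range := Module.finrank_pos
    rcases ℓ with _ | n
    · exact hpos
    refine Nat.le_of_dvd hpos ?_
    obtain ⟨h1, h2⟩ := roots_pow hcard hq h hw n
    refine two_pow_dvd_of_pow_eq hne h2 hq h1 ?_
    have hx : w n ∈ φ.range := ⟨x (Fin.last n), by
      have := hφ (Fin.last n)
      simpa using this⟩
    let _ := Fintype.ofFinite φ.range
    let _ : Field φ.range := (Finite.isField_of_domain φ.range).toField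
    have hc : Fintype.card φ.range = q ^ Module.finrank F φ.range := by
      rw [Module.card_eq_pow_finrank (K := F), hcard]
    have := FiniteField.pow_card (⟨w n, hx⟩ : φ.range)
    rw [hc] at this
    exact congrArg (φ.range.val) this
  have hle' : Module.finrank F φ.range ≤ Module.finrank F A :=
    LinearMap.finrank_le_finrank_of_surjective (f := φ.rangeRestrict.toLinearMap)
      φ.rangeRestrict_surjective
  have hinj : Function.Injective φ.rangeRestrict :=
    (LinearMap.injective_iff_surjective_of_finrank_eq_finrank
      (f := φ.rangeRestrict.toLinearMap) (by omega)).2 φ.rangeRestrict_surjective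
  have hdom : IsDomain A := hinj.isDomain φ.rangeRestrict.toRingHom
  exact ⟨Finite.isField_of_domain _, by omega⟩

end span

theorem isQuadraticTower_quadratic [Fintype F] {q : ℕ} (hcard : Fintype.card F = q)
    (hq : q % 2 = 1) {α β : ℕ → F} (h : QuadraticCoeffs q α β) (ℓ : ℕ) :
    IsQuadraticTower (quadratic ℓ α β) := by
  obtain ⟨w, hw⟩ := exists_roots (K := AlgebraicClosure F) α β h.zero
  have hker : ∀ a ∈ Ideal.span (Set.range (quadratic ℓ α β)),
      (aeval fun i : Fin ℓ => w i : _ →ₐ[F] AlgebraicClosure F) a = 0 := by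
    intro a ha
    have hle : Ideal.span (Set.range (quadratic ℓ α β)) ≤
        RingHom.ker (aeval fun i : Fin ℓ => w i : _ →ₐ[F] AlgebraicClosure F) := by
      rw [Ideal.span_le]
      rintro _ ⟨i, rfl⟩
      simp only [quadratic, SetLike.mem_coe, RingHom.mem_ker, map_add, map_mul, map_pow, aeval_X,
        aeval_C]
      rw [hw i]
      ring
    exact hle ha
  obtain ⟨hfield, hrank⟩ := isField_of_rel (α := α) (β := β) (ℓ := ℓ)
    (x := fun i => Ideal.Quotient.mkₐ F (Ideal.span (Set.range (quadratic ℓ α β))) (X i))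
    hcard hq h hw
    (by
      intro i
      have h0 : Ideal.Quotient.mkₐ F (Ideal.span (Set.range (quadratic ℓ α β)))
          (quadratic ℓ α β i) = 0 := by
        rw [Ideal.Quotient.mkₐ_eq_mk]
        exact Ideal.Quotient.eq_zero_iff_mem.2 (Ideal.subset_span ⟨i, rfl⟩)
      simp only [quadratic, map_add, map_mul, map_pow] at h0
      simp only [← algebraMap_eq, AlgHom.commutes] at h0
      linear_combination h0)
    (by
      rw [Set.range_comp' (Ideal.Quotient.mkₐ F _) X, ← AlgHom.map_adjoin, adjoin_range_X,
        Algebra.map_top, AlgHom.range_eq_top]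
      exact Ideal.Quotient.mkₐ_surjective _ _)
    (Ideal.Quotient.liftₐ _ (aeval fun i : Fin ℓ => w i) hker)
    (by intro i; exact (Ideal.Quotient.lift_mk _ _ _).trans (by simp))
  refine ⟨Ideal.Quotient.maximal_of_isField _ hfield, hfield, hrank, fun i => ?_⟩
  -- For `i = 0` the truncated index `i - 1` denotes the variable itself; `β 0 = 0` removes it and
  -- leaves a constant `h`.
  rcases Nat.eq_zero_or_pos (i : ℕ) with hi | hi
  · refine ⟨C (-α i), by simp, by simp, ?_⟩
    rw [quadratic, show β i = 0 by rw [hi, h.zero]]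
    simp
  · refine ⟨-(C (α i) + C (β i) * X ⟨i - 1, (Nat.sub_le _ _).trans_lt i.2⟩), ?_, ?_, ?_⟩
    · intro j hj
      rw [vars_neg] at hj
      have h1 := vars_add_subset _ _ hj
      rw [vars_C, Finset.empty_union] at h1
      have h2 := vars_mul _ _ h1
      rw [vars_C, Finset.empty_union, vars_X, Finset.mem_singleton] at h2
      rw [h2, Fin.lt_def]
      show (i : ℕ) - 1 < i
      omega
    · rw [totalDegree_neg]
      refine (totalDegree_add _ _).trans (max_le (by simp) ((totalDegree_mul _ _).trans ?_))
      rw [totalDegree_C, totalDegree_X]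
      omega
    · rw [quadratic]
      ring

end Tower

/-! ### From output codes to towers -/

namespace Tower

open Finset

theorem ofFn_eq_map_range {α : Type*} (n : ℕ) (g : ℕ → α) :
    (List.ofFn fun j : Fin n => g j) = (List.range n).map g :=
  List.ext_getElem (by simp) (by simp)

section present

variable {p : ℕ} [Fact p.Prime] {F : Type*} [Field F] [Finite F] [Algebra (ZMod p) F]

theorem presents_minpoly (hp : p ≠ 2) (θ : F) :
    Presents p (minpoly (ZMod p) θ).natDegree (fun j => ((minpoly (ZMod p) θ).coeff j).val) θ := by
  have hprime : p.Prime := Fact.out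
  have hfin : Module.Finite (ZMod p) F := Module.Finite.of_finite
  have hint : IsIntegral (ZMod p) θ := IsIntegral.of_finite _ _
  have hcast : ∀ n : ℕ, (n : F) = algebraMap (ZMod p) F n := fun n => (map_natCast _ n).symm
  refine ⟨lt_of_le_of_ne hprime.two_le hp.symm, minpoly.natDegree_pos hint,
    fun j _ => ZMod.val_lt _, by rw [hcast, ZMod.natCast_self, map_zero], ?_, ?_⟩
  · have h := minpoly.aeval (ZMod p) θ
    rw [(minpoly.monic hint).as_sum] at h
    simp only [map_add, map_pow, Polynomial.aeval_X, map_sum, map_mul, Polynomial.aeval_C] at h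
    rw [← h]
    congr 1
    refine sum_congr rfl fun j _ => ?_
    rw [hcast, ZMod.natCast_zmod_val]
  · intro f g hf hg hfg i hi
    have hli := linearIndependent_pow (K := ZMod p) θ
    rw [Fintype.linearIndependent_iff] at hli
    have := hli (fun i => (f i : ZMod p) - g i) (by
      rw [sum_range, sum_range] at hfg
      simp only [Algebra.smul_def, map_sub, map_natCast, sub_mul, sum_sub_distrib]
      rw [hfg, sub_self]) ⟨i, hi⟩
    have h1 : ((f i : ℕ) : ZMod p) = g i := sub_eq_zero.1 this
    have h2 := congrArg ZMod.val h1
    rwa [ZMod.val_cast_of_lt (hf i hi), ZMod.val_cast_of_lt (hg i hi)] at h2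

theorem card_eq_pow_natDegree {θ : F} (hθ : Algebra.adjoin (ZMod p) {θ} = ⊤) :
    Nat.card F = p ^ (minpoly (ZMod p) θ).natDegree := by
  have hfin : Module.Finite (ZMod p) F := Module.Finite.of_finite
  have hint : IsIntegral (ZMod p) θ := IsIntegral.of_finite _ _
  have h1 := (Algebra.adjoin.powerBasis hint).finrank
  rw [Algebra.adjoin.powerBasis_dim, hθ] at h1
  have h2 : Module.finrank (ZMod p) (⊤ : Subalgebra (ZMod p) F) = Module.finrank (ZMod p) F :=
    Subalgebra.topEquiv.toLinearEquiv.finrank_eq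
  rw [Module.natCard_eq_pow_finrank (K := ZMod p), Nat.card_zmod, ← h2, h1]

end present

section code

variable {p : ℕ} {F : Type*} [Field F] [Algebra (ZMod p) F]

theorem inputTape_eq (θ : F) (ℓ e : ℕ) :
    inputTape (p := p) θ ℓ e = [p, (minpoly (ZMod p) θ).natDegree, ℓ, e] ++
      (List.range (minpoly (ZMod p) θ).natDegree).map
        (fun j => ((minpoly (ZMod p) θ).coeff j).val) := by
  rw [inputTape, ofFn_eq_map_range _ fun j => ((minpoly (ZMod p) θ).coeff j).val]

/-- The term with the exponent `v` at the variable `i` and the coefficient with the digits `f`. -/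
def mkTerm (p ℓ u v i : ℕ) (f : ℕ → ℕ) : Term p ℓ u :=
  (fun j => if (j : ℕ) = i then v else 0, fun j => f j)

theorem code_mkTerm {ℓ u v i : ℕ} {f : ℕ → ℕ} (hf : ∀ j < u, f j < p) :
    (List.ofFn (mkTerm p ℓ u v i f).1 ++ List.ofFn fun j : Fin u => ((mkTerm p ℓ u v i f).2 j).val) =
      termCode ℓ u v i f := by
  rw [termCode, ← ofFn_eq_map_range, ← ofFn_eq_map_range]
  congr 2
  funext j
  exact ZMod.val_cast_of_lt (hf j j.2)

theorem monomial_mkTerm {ℓ u v : ℕ} (θ : F) (i : Fin ℓ) (f : ℕ → ℕ) :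
    MvPolynomial.monomial (Finsupp.equivFunOnFinite.symm (mkTerm p ℓ u v i f).1)
      (∑ j : Fin u, algebraMap (ZMod p) F ((mkTerm p ℓ u v i f).2 j) * θ ^ (j : ℕ)) =
    MvPolynomial.C (∑ j ∈ range u, (f j : F) * θ ^ j) * MvPolynomial.X i ^ v := by
  rw [MvPolynomial.C_mul_X_pow_eq_monomial, sum_range]
  congr 1
  · congr 1
    ext j
    simp only [mkTerm, Finsupp.equivFunOnFinite_symm_apply_apply, Finsupp.single_apply, Fin.ext_iff,
      eq_comm]
  · simp [mkTerm]

theorem IsTowerCode.isSuccess [Fact p.Prime] [Fintype F] (hp : p ≠ 2) {θ : F} {ℓ : ℕ}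
    (hcard : Fintype.card F = p ^ (minpoly (ZMod p) θ).natDegree) {f g : ℕ → ℕ → ℕ} {out : List ℕ}
    (h : IsTowerCode θ p (minpoly (ZMod p) θ).natDegree ℓ f g out) : IsSuccess p θ ℓ out := by
  have hpres := presents_minpoly (p := p) hp θ
  have hodd : p ^ (minpoly (ZMod p) θ).natDegree % 2 = 1 := by
    have := (Fact.out : p.Prime).eq_two_or_odd.resolve_left hp
    rw [Nat.pow_mod, this]
    simp
  set u := (minpoly (ZMod p) θ).natDegree with hu
  have hone : ∑ j ∈ range u, (oneDigits j : F) * θ ^ j = 1 := by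
    obtain ⟨v, hv⟩ := Nat.exists_eq_succ_of_ne_zero hpres.pos.ne'
    rw [hv, Nat.succ_eq_add_one, sum_range_succ']
    simp [oneDigits]
  have honelt : ∀ j < u, oneDigits j < p := fun j _ => by
    have := hpres.two_lt
    unfold oneDigits
    split_ifs <;> omega
  have hzero : ∑ j ∈ range u, (((fun _ => 0 : ℕ → ℕ) j : ℕ) : F) * θ ^ j = 0 := by simp
  have hc : QuadraticCoeffs (p ^ u) (fun i => ∑ j ∈ range u, (f i j : F) * θ ^ j)
      (fun i => ∑ j ∈ range u, (g i j : F) * θ ^ j) := by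
    refine ⟨fun i hi => ?_, fun i hi => ?_, ?_, ?_⟩
    · simp only [h.left_eq i hi, hzero]
    · simp only [h.right_eq i hi, hone]
    · simp only [h.right_zero, hzero]
    · obtain ⟨x, y, hg, ⟨h1, h2, h3, h4⟩ | ⟨h1, h2, h3, h4⟩⟩ := h.cases
      · refine Or.inl ⟨h1, ?_, ?_, ?_⟩
        · simp only [h2]; exact hg
        · simp only [h3, hzero]
        · simp only [h4, hone]
      · refine Or.inr ⟨h1, ?_, ?_⟩
        · simp only [h2, hone]
        · simp only [h3, h4]; exact hg
  refine ⟨_, ⟨fun i => [mkTerm p ℓ u 2 i oneDigits, mkTerm p ℓ u 0 i (f i),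
    mkTerm p ℓ u 1 (i - 1) (g i)], fun i => ?_, ?_⟩, isQuadraticTower_quadratic hcard hodd hc ℓ⟩
  · have h3 := monomial_mkTerm (p := p) (u := u) (v := 1) θ
      (⟨i - 1, (Nat.sub_le _ _).trans_lt i.2⟩ : Fin ℓ) (g i)
    simp only [polyOf, List.map_cons, List.map_nil, List.sum_cons, List.sum_nil]
    rw [h3, monomial_mkTerm θ i, monomial_mkTerm θ i, hone, quadratic]
    simp
  · rw [h.out_eq]
    congr 1
    have : (fun i : Fin ℓ => codeTerms [mkTerm p ℓ u 2 i oneDigits, mkTerm p ℓ u 0 i (f i),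
        mkTerm p ℓ u 1 (i - 1) (g i)]) = fun i : Fin ℓ => polyCode ℓ u f g i := by
      funext i
      simp only [codeTerms, List.flatMap_cons, List.flatMap_nil, List.append_nil, polyCode,
        code_mkTerm honelt, code_mkTerm (h.left_lt i), code_mkTerm (h.right_lt i)]
      rfl
    rw [this, ofFn_eq_map_range, List.flatMap_def]

end code

end Tower

/-! ### A family of affine maps with a spectral gap -/

namespace Expander

open Finset ZMod

variable {M : ℕ} [NeZero M]

/-- The Fourier transform of a function on the square of `ZMod M`. -/
noncomputable def hat (f : ZMod M × ZMod M → ℝ) (ξ : ZMod M × ZMod M) : ℂ :=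
  ∑ v : ZMod M × ZMod M, (f v : ℂ) * stdAddChar (ξ.1 * v.1 + ξ.2 * v.2)

theorem hat_sub (f g : ZMod M × ZMod M → ℝ) (ξ : ZMod M × ZMod M) :
    hat (fun v => f v - g v) ξ = hat f ξ - hat g ξ := by
  simp [hat, sub_mul, sum_sub_distrib]

theorem hat_zero (f : ZMod M × ZMod M → ℝ) : hat f 0 = ((∑ v, f v : ℝ) : ℂ) := by
  simp [hat]

theorem sum_char (a b : ZMod M) :
    ∑ ξ : ZMod M × ZMod M, (stdAddChar (ξ.1 * a + ξ.2 * b) : ℂ) =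
      if a = 0 ∧ b = 0 then (M : ℂ) ^ 2 else 0 := by
  have h := isPrimitive_stdAddChar M
  simp only [AddChar.map_add_eq_mul, Fintype.sum_prod_type, ← mul_sum, ← sum_mul]
  rw [AddChar.sum_mulShift a h, AddChar.sum_mulShift b h]
  by_cases ha : a = 0 <;> by_cases hb : b = 0 <;> simp [ha, hb, ZMod.card, sq]

theorem parseval (f : ZMod M × ZMod M → ℝ) :
    ∑ ξ, ‖hat f ξ‖ ^ 2 = (M : ℝ) ^ 2 * ∑ v, f v ^ 2 := by
  have h : ∑ ξ, hat f ξ * (starRingEnd ℂ) (hat f ξ) = (M : ℂ) ^ 2 * ∑ v, (f v : ℂ) ^ 2 := by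
    have h1 : ∀ ξ, hat f ξ * (starRingEnd ℂ) (hat f ξ) =
        ∑ v : ZMod M × ZMod M, ∑ w : ZMod M × ZMod M, (f v : ℂ) * (f w : ℂ) *
          stdAddChar (ξ.1 * (v.1 - w.1) + ξ.2 * (v.2 - w.2)) := by
      intro ξ
      rw [hat, map_sum, sum_mul_sum]
      refine sum_congr rfl fun v _ => sum_congr rfl fun w _ => ?_
      rw [map_mul, Complex.conj_ofReal, ← AddChar.map_neg_eq_conj,
        show ξ.1 * (v.1 - w.1) + ξ.2 * (v.2 - w.2) =
          (ξ.1 * v.1 + ξ.2 * v.2) + -(ξ.1 * w.1 + ξ.2 * w.2) by ring,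
        AddChar.map_add_eq_mul _ (ξ.1 * v.1 + ξ.2 * v.2)]
      ring
    simp only [h1]
    rw [sum_comm, mul_sum]
    refine sum_congr rfl fun v _ => ?_
    rw [sum_comm]
    simp only [← mul_sum, sum_char, sub_eq_zero]
    rw [sum_eq_single v]
    · simp
      ring
    · intro w _ hw
      rw [if_neg, mul_zero]
      rintro ⟨h1, h2⟩
      exact hw (Prod.ext h1.symm h2.symm)
    · simp
  have h2 : ((∑ ξ, ‖hat f ξ‖ ^ 2 : ℝ) : ℂ) = (((M : ℝ) ^ 2 * ∑ v, f v ^ 2 : ℝ) : ℂ) := by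
    push_cast
    rw [← h]
    exact sum_congr rfl fun ξ _ => (Complex.mul_conj' _).symm
  exact_mod_cast h2

/-- The four maps: two translations and two shears. -/
def gen : Fin 4 → ZMod M × ZMod M → ZMod M × ZMod M
  | 0, v => (v.1 + 1, v.2)
  | 1, v => (v.1, v.2 + 1)
  | 2, v => (v.1 + v.2, v.2)
  | 3, v => (v.1, v.2 + v.1)

theorem hat_gen_zero (f : ZMod M × ZMod M → ℝ) (ξ : ZMod M × ZMod M) :
    hat (fun v => f (gen 0 v)) ξ = stdAddChar (-ξ.1) * hat f ξ := by
  rw [hat, hat, mul_sum]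
  refine Fintype.sum_equiv ((Equiv.addRight (1 : ZMod M)).prodCongr (Equiv.refl _)) _ _ fun v => ?_
  simp only [gen, Equiv.prodCongr_apply, Prod.map, Equiv.coe_addRight, Equiv.refl_apply]
  rw [mul_left_comm, ← AddChar.map_add_eq_mul]
  congr 2
  ring

theorem hat_gen_one (f : ZMod M × ZMod M → ℝ) (ξ : ZMod M × ZMod M) :
    hat (fun v => f (gen 1 v)) ξ = stdAddChar (-ξ.2) * hat f ξ := by
  rw [hat, hat, mul_sum]
  refine Fintype.sum_equiv ((Equiv.refl _).prodCongr (Equiv.addRight (1 : ZMod M))) _ _ fun v => ?_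
  simp only [gen, Equiv.prodCongr_apply, Prod.map, Equiv.coe_addRight, Equiv.refl_apply]
  rw [mul_left_comm, ← AddChar.map_add_eq_mul]
  congr 2
  ring

/-- The shear `(a, b) ↦ (a + b, b)`. -/
def shearFst : ZMod M × ZMod M ≃ ZMod M × ZMod M where
  toFun v := (v.1 + v.2, v.2)
  invFun v := (v.1 - v.2, v.2)
  left_inv v := by simp
  right_inv v := by simp

/-- The shear `(a, b) ↦ (a, b + a)`. -/
def shearSnd : ZMod M × ZMod M ≃ ZMod M × ZMod M where
  toFun v := (v.1, v.2 + v.1)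
  invFun v := (v.1, v.2 - v.1)
  left_inv v := by simp
  right_inv v := by simp

/-- A linear substitution acts on frequencies by its inverse transpose, which for a shear is the
inverse of the other shear. -/
theorem hat_gen_two (f : ZMod M × ZMod M → ℝ) (ξ : ZMod M × ZMod M) :
    hat (fun v => f (gen 2 v)) ξ = hat f (shearSnd.symm ξ) := by
  rw [hat, hat]
  refine Fintype.sum_equiv shearFst _ _ fun v => ?_
  simp only [gen, shearFst, shearSnd, Equiv.coe_fn_mk, Equiv.coe_fn_symm_mk]
  congr 2
  ring

theorem hat_gen_three (f : ZMod M × ZMod M → ℝ) (ξ : ZMod M × ZMod M) :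
    hat (fun v => f (gen 3 v)) ξ = hat f (shearFst.symm ξ) := by
  rw [hat, hat]
  refine Fintype.sum_equiv shearSnd _ _ fun v => ?_
  simp only [gen, shearFst, shearSnd, Equiv.coe_fn_mk, Equiv.coe_fn_symm_mk]
  congr 2
  ring

/-- The square is `2 - 2 * cos t`, and the hypothesis puts `|t|` between a quarter and a half turn,
where the cosine is not positive. -/
theorem norm_char_sub_one (a : ZMod M) (ha : (M : ℤ) ≤ 4 * |a.valMinAbs|) :
    2 ≤ ‖(stdAddChar (-a) : ℂ) - 1‖ ^ 2 := by
  have hM : (0 : ℝ) < M := by exact_mod_cast Nat.pos_of_ne_zero (NeZero.ne M)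
  have h1 : (stdAddChar (-a) : ℂ) =
      Complex.exp (((2 * Real.pi * (-a.valMinAbs : ℤ) / M : ℝ) : ℂ) * Complex.I) := by
    have : -a = ((-a.valMinAbs : ℤ) : ZMod M) := by
      rw [Int.cast_neg, coe_valMinAbs]
    rw [this, stdAddChar_coe]
    congr 1
    push_cast
    ring
  set t : ℝ := 2 * Real.pi * (-a.valMinAbs : ℤ) / M with ht
  have habs : |t| = 2 * Real.pi * |(a.valMinAbs : ℝ)| / M := by
    rw [ht, abs_div, abs_mul, abs_of_pos hM, abs_of_pos (by positivity : 0 < 2 * Real.pi)]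
    simp
  have h2 := a.valMinAbs_mem_Ioc
  have hle : 2 * |(a.valMinAbs : ℝ)| ≤ M := by
    have : 2 * |a.valMinAbs| ≤ (M : ℤ) := by
      have := h2.1; have := h2.2
      rcases abs_cases a.valMinAbs with h | h <;> omega
    exact_mod_cast this
  have hge : (M : ℝ) ≤ 4 * |(a.valMinAbs : ℝ)| := by exact_mod_cast ha
  have hcos : Real.cos t ≤ 0 := by
    rw [← Real.cos_abs]
    apply Real.cos_nonpos_of_pi_div_two_le_of_le
    · rw [habs, div_le_div_iff₀ two_pos hM]
      nlinarith [Real.pi_pos]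
    · rw [habs, div_le_iff₀ hM]
      nlinarith [Real.pi_pos]
  rw [h1, ← Complex.normSq_eq_norm_sq, Complex.normSq_sub]
  rw [Complex.normSq_eq_norm_sq, Complex.norm_exp_ofReal_mul_I]
  simp only [map_one, mul_one, Complex.exp_ofReal_mul_I_re]
  linarith

/-- The source of expansion: a cone of frequencies is sent by two shears to disjoint parts of
itself, up to an error set. -/
theorem sum_add_sum_le {V : Type*} [Fintype V] [DecidableEq V] {μ : V → ℝ} (hμ : ∀ x, 0 ≤ μ x)
    (s t : Finset V) (ρ σ : V ≃ V) (h : ∀ x ∈ s, ρ x ∈ t) (h' : ∀ x ∈ s, σ x ∈ t)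
    (hd : ∀ x ∈ s, ∀ y ∈ s, ρ x ≠ σ y) :
    ∑ x ∈ s, μ (ρ x) + ∑ x ∈ s, μ (σ x) ≤ ∑ x ∈ t, μ x := by
  rw [← sum_image (s := s) (g := ρ) (f := μ) (fun a _ b _ h => ρ.injective h),
    ← sum_image (s := s) (g := σ) (f := μ) (fun a _ b _ h => σ.injective h), ← sum_union]
  · refine sum_le_sum_of_subset_of_nonneg ?_ fun x _ _ => hμ x
    intro x hx
    rcases mem_union.1 hx with hx | hx <;> obtain ⟨y, hy, rfl⟩ := mem_image.1 hx
    exacts [h y hy, h' y hy]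
  · rw [disjoint_left]
    rintro x hx hx'
    obtain ⟨y, hy, rfl⟩ := mem_image.1 hx
    obtain ⟨z, hz, he⟩ := mem_image.1 hx'
    exact hd y hy z hz he.symm

/-- With `d` the norm of the difference, `|a ^ 2 - b ^ 2| ≤ d * (a + b) ≤ 9 * d ^ 2 + (a ^ 2 + b ^
2) / 18`. Summation gives `9 / 81 + 2 / 18 = 2 / 9`. -/
theorem sum_shift_le {V : Type*} [Fintype V] {F : V → ℂ} (ρ : V ≃ V) {N : ℝ}
    (hN : ∑ x, ‖F x‖ ^ 2 = N) (h : ∑ x, ‖F (ρ x) - F x‖ ^ 2 ≤ 1 / 81 * N) (s : Finset V) :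
    ∑ x ∈ s, ‖F x‖ ^ 2 ≤ ∑ x ∈ s, ‖F (ρ x)‖ ^ 2 + 2 / 9 * N := by
  have h1 : ∀ x, ‖F x‖ ^ 2 - ‖F (ρ x)‖ ^ 2 ≤
      9 * ‖F (ρ x) - F x‖ ^ 2 + (1 / 18) * (‖F (ρ x)‖ ^ 2 + ‖F x‖ ^ 2) := by
    intro x
    have ha := norm_nonneg (F x)
    have hb := norm_nonneg (F (ρ x))
    have hd := norm_nonneg (F (ρ x) - F x)
    have htri : ‖F x‖ - ‖F (ρ x)‖ ≤ ‖F (ρ x) - F x‖ := by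
      rw [norm_sub_rev]; exact norm_sub_norm_le _ _
    nlinarith [sq_nonneg (‖F (ρ x) - F x‖ - 1 / 18 * (‖F x‖ + ‖F (ρ x)‖)),
      sq_nonneg (‖F x‖ - ‖F (ρ x)‖), mul_le_mul_of_nonneg_right htri (add_nonneg ha hb)]
  have h2 : ∑ x ∈ s, (‖F x‖ ^ 2 - ‖F (ρ x)‖ ^ 2) ≤
      ∑ x, (9 * ‖F (ρ x) - F x‖ ^ 2 + (1 / 18) * (‖F (ρ x)‖ ^ 2 + ‖F x‖ ^ 2)) :=
    (sum_le_sum fun x _ => h1 x).trans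
      (sum_le_sum_of_subset_of_nonneg (subset_univ _) fun x _ _ => by positivity)
  have h3 : ∑ x, ‖F (ρ x)‖ ^ 2 = N := by rw [← hN]; exact Equiv.sum_comp ρ fun x => ‖F x‖ ^ 2
  rw [sum_sub_distrib, sum_add_distrib, ← mul_sum, ← mul_sum, sum_add_distrib, h3, hN] at h2
  linarith

/-- Below a quarter of `M` nothing wraps around, so that signs can be treated as for integers. -/
theorem valMinAbs_add {a b : ZMod M} (ha : 4 * |a.valMinAbs| < M) (hb : 4 * |b.valMinAbs| < M) :
    (a + b).valMinAbs = a.valMinAbs + b.valMinAbs := by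
  rw [valMinAbs_spec]
  refine ⟨by simp, ?_, ?_⟩ <;>
    rcases abs_cases a.valMinAbs with h | h <;> rcases abs_cases b.valMinAbs with h' | h' <;> omega

theorem valMinAbs_sub {a b : ZMod M} (ha : 4 * |a.valMinAbs| < M) (hb : 4 * |b.valMinAbs| < M) :
    (a - b).valMinAbs = a.valMinAbs - b.valMinAbs := by
  rw [valMinAbs_spec]
  refine ⟨by simp, ?_, ?_⟩ <;>
    rcases abs_cases a.valMinAbs with h | h <;> rcases abs_cases b.valMinAbs with h' | h' <;> omega

/-- Suppose that all four maps nearly fix `f`, and regard `‖hat f ξ‖ ^ 2` as a mass of total `N`,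
with no mass at `0` since `f` has mean zero. The translations force almost all mass into the box of
small frequencies, and the shears almost preserve the mass of every set. But two shears send each of
the cones `neg` and `pos` to disjoint parts of itself, up to `out`, so that a cone has hardly more
than `4 / 9` of the mass. -/
theorem exists_gen (f : ZMod M × ZMod M → ℝ) (hf : ∑ v, f v = 0) :
    ∃ i, 1 / 81 * ∑ v, f v ^ 2 ≤ ∑ v, (f (gen i v) - f v) ^ 2 := by
  classical
  by_contra! hcon
  have hM : (0 : ℝ) < (M : ℝ) ^ 2 := by
    have : (0 : ℝ) < M := by exact_mod_cast Nat.pos_of_ne_zero (NeZero.ne M)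
    positivity
  obtain ⟨N, hN⟩ : ∃ N, ∑ ξ, ‖hat f ξ‖ ^ 2 = N := ⟨_, rfl⟩
  have hpos : 0 < N := by
    rw [← hN, parseval]
    have h1 : 0 ≤ ∑ v, (f (gen 0 v) - f v) ^ 2 := sum_nonneg fun _ _ => sq_nonneg _
    have := hcon 0
    exact mul_pos hM (by linarith)
  have hgen : ∀ i, ∑ ξ, ‖hat (fun v => f (gen i v)) ξ - hat f ξ‖ ^ 2 ≤ 1 / 81 * N := by
    intro i
    simp only [← hat_sub]
    rw [parseval, ← hN, parseval]
    have := mul_lt_mul_of_pos_left (hcon i) hM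
    linarith
  let μ : ZMod M × ZMod M → ℝ := fun ξ => ‖hat f ξ‖ ^ 2
  have hμ : ∀ ξ, 0 ≤ μ ξ := fun ξ => sq_nonneg _
  have hsym₁ : ∀ s : Finset (ZMod M × ZMod M),
      ∑ x ∈ s, μ x ≤ ∑ x ∈ s, μ (shearFst.symm x) + 2 / 9 * N :=
    sum_shift_le shearFst.symm hN (by simpa only [hat_gen_three] using hgen 3)
  have hsym₂ : ∀ s : Finset (ZMod M × ZMod M),
      ∑ x ∈ s, μ x ≤ ∑ x ∈ s, μ (shearSnd.symm x) + 2 / 9 * N :=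
    sum_shift_le shearSnd.symm hN (by simpa only [hat_gen_two] using hgen 2)
  have hinv : ∀ ρ : ZMod M × ZMod M ≃ ZMod M × ZMod M,
      ∑ x, ‖hat f (ρ.symm x) - hat f x‖ ^ 2 ≤ 1 / 81 * N →
      ∑ x, ‖hat f (ρ x) - hat f x‖ ^ 2 ≤ 1 / 81 * N := by
    intro ρ h
    rw [← Equiv.sum_comp ρ] at h
    simpa only [Equiv.symm_apply_apply, norm_sub_rev] using h
  have hshear₁ : ∀ s : Finset (ZMod M × ZMod M),
      ∑ x ∈ s, μ x ≤ ∑ x ∈ s, μ (shearFst x) + 2 / 9 * N :=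
    sum_shift_le shearFst hN (hinv _ (by simpa only [hat_gen_three] using hgen 3))
  have hshear₂ : ∀ s : Finset (ZMod M × ZMod M),
      ∑ x ∈ s, μ x ≤ ∑ x ∈ s, μ (shearSnd x) + 2 / 9 * N :=
    sum_shift_le shearSnd hN (hinv _ (by simpa only [hat_gen_two] using hgen 2))
  let Q : ZMod M × ZMod M → Prop := fun ξ => 4 * |ξ.1.valMinAbs| < M ∧ 4 * |ξ.2.valMinAbs| < M
  let out := univ.filter fun ξ : ZMod M × ZMod M => ¬ Q ξ
  -- The half-axes are divided between `neg` and `pos` so that together they cover the box except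
  -- `0`. In either cone the two sheared images are separated by which coordinate is larger in
  -- absolute value.
  let neg := univ.filter fun ξ : ZMod M × ZMod M => Q ξ ∧
    ((0 < ξ.1.valMinAbs ∧ ξ.2.valMinAbs ≤ 0) ∨ (ξ.1.valMinAbs < 0 ∧ 0 ≤ ξ.2.valMinAbs))
  let pos := univ.filter fun ξ : ZMod M × ZMod M => Q ξ ∧
    ((0 ≤ ξ.1.valMinAbs ∧ 0 < ξ.2.valMinAbs) ∨ (ξ.1.valMinAbs ≤ 0 ∧ ξ.2.valMinAbs < 0))
  have hout : ∑ ξ ∈ out, μ ξ ≤ 1 / 81 * N := by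
    have h0 := hgen 0
    have h1 := hgen 1
    have hsum : ∑ ξ ∈ out, 2 * μ ξ ≤ ∑ ξ, (‖hat (fun v => f (gen 0 v)) ξ - hat f ξ‖ ^ 2 +
        ‖hat (fun v => f (gen 1 v)) ξ - hat f ξ‖ ^ 2) := by
      refine (sum_le_sum fun ξ hξ => ?_).trans
        (sum_le_sum_of_subset_of_nonneg (subset_univ out) fun ξ _ _ => by positivity)
      have e0 : ‖hat (fun v => f (gen 0 v)) ξ - hat f ξ‖ ^ 2 =
          ‖(stdAddChar (-ξ.1) : ℂ) - 1‖ ^ 2 * μ ξ := by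
        rw [hat_gen_zero, ← sub_one_mul, norm_mul, mul_pow]
      have e1 : ‖hat (fun v => f (gen 1 v)) ξ - hat f ξ‖ ^ 2 =
          ‖(stdAddChar (-ξ.2) : ℂ) - 1‖ ^ 2 * μ ξ := by
        rw [hat_gen_one, ← sub_one_mul, norm_mul, mul_pow]
      rw [e0, e1]
      have hq : ¬ Q ξ := (mem_filter.1 hξ).2
      have p0 : 0 ≤ ‖(stdAddChar (-ξ.1) : ℂ) - 1‖ ^ 2 * μ ξ := mul_nonneg (sq_nonneg _) (hμ ξ)
      have p1 : 0 ≤ ‖(stdAddChar (-ξ.2) : ℂ) - 1‖ ^ 2 * μ ξ := mul_nonneg (sq_nonneg _) (hμ ξ)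
      rcases not_and_or.1 hq with h | h
      · have := mul_le_mul_of_nonneg_right (norm_char_sub_one ξ.1 (not_lt.1 h)) (hμ ξ)
        linarith
      · have := mul_le_mul_of_nonneg_right (norm_char_sub_one ξ.2 (not_lt.1 h)) (hμ ξ)
        linarith
    rw [← mul_sum, sum_add_distrib] at hsum
    linarith
  have hmemQ : ∀ {ξ}, (Q ξ → ξ ∈ neg) → ξ ∈ neg ∪ out := by
    intro ξ h
    by_cases hq : Q ξ
    · exact mem_union_left _ (h hq)
    · exact mem_union_right _ (mem_filter.2 ⟨mem_univ _, hq⟩)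
  have hmemQ' : ∀ {ξ}, (Q ξ → ξ ∈ pos) → ξ ∈ pos ∪ out := by
    intro ξ h
    by_cases hq : Q ξ
    · exact mem_union_left _ (h hq)
    · exact mem_union_right _ (mem_filter.2 ⟨mem_univ _, hq⟩)
  have hunion : ∀ s : Finset (ZMod M × ZMod M), ∑ ξ ∈ s ∪ out, μ ξ ≤
      ∑ ξ ∈ s, μ ξ + ∑ ξ ∈ out, μ ξ := by
    intro s
    have := sum_union_inter (s₁ := s) (s₂ := out) (f := μ)
    have h0 : 0 ≤ ∑ ξ ∈ s ∩ out, μ ξ := sum_nonneg fun _ _ => hμ _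
    linarith
  have hneg : ∑ ξ ∈ neg, μ ξ ≤ 4 / 9 * N + 1 / 81 * N := by
    have h1 := sum_add_sum_le hμ neg (neg ∪ out) shearFst.symm shearSnd.symm ?_ ?_ ?_
    · have := hsym₁ neg
      have := hsym₂ neg
      have := hunion neg
      linarith
    · intro ξ hξ
      obtain ⟨-, hq, hc⟩ := mem_filter.1 hξ
      refine hmemQ fun hq' => mem_filter.2 ⟨mem_univ _, hq', ?_⟩
      simp only [shearFst, Equiv.coe_fn_symm_mk, valMinAbs_sub hq.1 hq.2]
      omega
    · intro ξ hξ
      obtain ⟨-, hq, hc⟩ := mem_filter.1 hξ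
      refine hmemQ fun hq' => mem_filter.2 ⟨mem_univ _, hq', ?_⟩
      simp only [shearSnd, Equiv.coe_fn_symm_mk, valMinAbs_sub hq.2 hq.1]
      omega
    · intro ξ hξ η hη heq
      obtain ⟨-, hq, hc⟩ := mem_filter.1 hξ
      obtain ⟨-, hq', hc'⟩ := mem_filter.1 hη
      have e1 := congrArg (fun v => v.1.valMinAbs) heq
      have e2 := congrArg (fun v => v.2.valMinAbs) heq
      simp only [shearFst, shearSnd, Equiv.coe_fn_symm_mk, valMinAbs_sub hq.1 hq.2,
        valMinAbs_sub hq'.2 hq'.1] at e1 e2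
      omega
  have hposs : ∑ ξ ∈ pos, μ ξ ≤ 4 / 9 * N + 1 / 81 * N := by
    have h1 := sum_add_sum_le hμ pos (pos ∪ out) shearFst shearSnd ?_ ?_ ?_
    · have := hshear₁ pos
      have := hshear₂ pos
      have := hunion pos
      linarith
    · intro ξ hξ
      obtain ⟨-, hq, hc⟩ := mem_filter.1 hξ
      refine hmemQ' fun hq' => mem_filter.2 ⟨mem_univ _, hq', ?_⟩
      simp only [shearFst, Equiv.coe_fn_mk, valMinAbs_add hq.1 hq.2]
      omega
    · intro ξ hξ
      obtain ⟨-, hq, hc⟩ := mem_filter.1 hξ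
      refine hmemQ' fun hq' => mem_filter.2 ⟨mem_univ _, hq', ?_⟩
      simp only [shearSnd, Equiv.coe_fn_mk, valMinAbs_add hq.2 hq.1]
      omega
    · intro ξ hξ η hη heq
      obtain ⟨-, hq, hc⟩ := mem_filter.1 hξ
      obtain ⟨-, hq', hc'⟩ := mem_filter.1 hη
      have e1 := congrArg (fun v => v.1.valMinAbs) heq
      have e2 := congrArg (fun v => v.2.valMinAbs) heq
      simp only [shearFst, shearSnd, Equiv.coe_fn_mk, valMinAbs_add hq.1 hq.2,
        valMinAbs_add hq'.2 hq'.1] at e1 e2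
      omega
  have hall : N ≤ ∑ ξ ∈ neg, μ ξ + ∑ ξ ∈ pos, μ ξ + ∑ ξ ∈ out, μ ξ := by
    have hsub : (univ : Finset (ZMod M × ZMod M)) ⊆ insert 0 ((neg ∪ pos) ∪ out) := by
      intro ξ _
      by_cases hq : Q ξ
      · by_cases h0 : ξ = 0
        · simp [h0]
        · refine mem_insert_of_mem (mem_union_left _ (mem_union.2 ?_))
          have hne : ξ.1.valMinAbs ≠ 0 ∨ ξ.2.valMinAbs ≠ 0 := by
            by_contra! hh
            exact h0 (Prod.ext ((valMinAbs_eq_zero _).1 hh.1) ((valMinAbs_eq_zero _).1 hh.2))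
          simp only [neg, pos, mem_filter, mem_univ, true_and, hq]
          omega
      · exact mem_insert_of_mem (mem_union_right _ (mem_filter.2 ⟨mem_univ _, hq⟩))
    have h0 : μ 0 = 0 := by
      simp only [μ, hat_zero, hf]
      simp
    have h1 : N ≤ ∑ ξ ∈ insert 0 ((neg ∪ pos) ∪ out), μ ξ := by
      rw [← hN]
      exact sum_le_sum_of_subset_of_nonneg hsub fun ξ _ _ => hμ ξ
    rw [sum_insert_zero h0] at h1
    have h2 := hunion (neg ∪ pos)
    have h3 := sum_union_inter (s₁ := neg) (s₂ := pos) (f := μ)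
    have h4 : 0 ≤ ∑ ξ ∈ neg ∩ pos, μ ξ := sum_nonneg fun _ _ => hμ _
    linarith
  -- The parts add up to at most `8 / 9 + 3 / 81`, which is less than `1`.
  linarith

end Expander

/-! ### Random walks avoid a small set with exponentially small probability only -/

namespace Expander

open Finset ZMod

variable {M : ℕ}

/-- The sixteen maps of the walk. -/
def move (b : Bool × Bool × Bool × Bool) (v : ZMod M × ZMod M) : ZMod M × ZMod M :=
  (v.1 + b.1.toNat * v.2 + b.2.1.toNat,
    v.2 + b.2.2.1.toNat * (v.1 + b.1.toNat * v.2 + b.2.1.toNat) + b.2.2.2.toNat)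

theorem move_zero (v : ZMod M × ZMod M) : move (false, false, false, false) v = v := by
  simp [move]

theorem exists_move (i : Fin 4) :
    ∃ b, b ≠ (false, false, false, false) ∧ ∀ v : ZMod M × ZMod M, move b v = gen i v := by
  fin_cases i
  · exact ⟨(false, true, false, false), by decide, fun v => by simp [move, gen]⟩
  · exact ⟨(false, false, false, true), by decide, fun v => by simp [move, gen]⟩
  · exact ⟨(true, false, false, false), by decide, fun v => by simp [move, gen]⟩
  · exact ⟨(false, false, true, false), by decide, fun v => by simp [move, gen]⟩

variable [NeZero M]

theorem move_bijective (b : Bool × Bool × Bool × Bool) :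
    Function.Bijective (move b : ZMod M × ZMod M → ZMod M × ZMod M) := by
  rw [← Finite.injective_iff_bijective]
  rintro ⟨x, y⟩ ⟨x', y'⟩ h
  simp only [move, Prod.mk.injEq] at h
  obtain ⟨h1, h2⟩ := h
  rw [h1] at h2
  have hy : y = y' := by linear_combination h2
  subst hy
  exact Prod.ext (by linear_combination h1) rfl

theorem sum_move (b : Bool × Bool × Bool × Bool) (f : ZMod M × ZMod M → ℝ) :
    ∑ v, f (move b v) = ∑ v, f v :=
  (move_bijective b).sum_comp f

/-- Lagrange's identity: the defect in Cauchy–Schwarz is half the sum of all `(y k - y l) ^ 2`, of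
which the two terms for `i` and `j` are kept. -/
theorem sq_sum_le {ι : Type*} [Fintype ι] (y : ι → ℝ) {i j : ι} (hij : i ≠ j) :
    (∑ k, y k) ^ 2 ≤ Fintype.card ι * ∑ k, y k ^ 2 - (y i - y j) ^ 2 := by
  classical
  have h1 : ∑ k, ∑ l, (y k - y l) ^ 2 = 2 * (Fintype.card ι * ∑ k, y k ^ 2 - (∑ k, y k) ^ 2) := by
    simp only [sub_sq, sum_add_distrib, sum_sub_distrib, ← mul_sum, ← sum_mul, sum_const, card_univ,
      nsmul_eq_mul]
    ring
  have h2 : (y i - y j) ^ 2 ≤ ∑ l, (y i - y l) ^ 2 :=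
    single_le_sum (f := fun l => (y i - y l) ^ 2) (fun _ _ => sq_nonneg _) (mem_univ j)
  have h3 : (y j - y i) ^ 2 ≤ ∑ l, (y j - y l) ^ 2 :=
    single_le_sum (f := fun l => (y j - y l) ^ 2) (fun _ _ => sq_nonneg _) (mem_univ i)
  have h4 : ∑ k ∈ {i, j}, ∑ l, (y k - y l) ^ 2 ≤ ∑ k, ∑ l, (y k - y l) ^ 2 :=
    sum_le_sum_of_subset_of_nonneg (subset_univ _) fun _ _ _ => sum_nonneg fun _ _ => sq_nonneg _
  rw [sum_pair hij] at h4
  nlinarith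

/-- The identity is one of the sixteen maps, so the difference between a generator and the identity
is one of the defects in `sq_sum_le`. -/
theorem sum_sq_move_le_of_mean_zero (f : ZMod M × ZMod M → ℝ) (hf : ∑ v, f v = 0) :
    ∑ v, (∑ b, f (move b v)) ^ 2 ≤ (256 - 1 / 81) * ∑ v, f v ^ 2 := by
  obtain ⟨i, hi⟩ := exists_gen f hf
  obtain ⟨b, hb, hbi⟩ := exists_move (M := M) i
  have h1 : ∀ v, (∑ b, f (move b v)) ^ 2 ≤
      16 * ∑ b, f (move b v) ^ 2 - (f (gen i v) - f v) ^ 2 := by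
    intro v
    have := sq_sum_le (fun b => f (move b v)) hb
    rw [hbi, move_zero] at this
    simpa using this
  have h2 : ∑ v, ∑ b, f (move b v) ^ 2 = 16 * ∑ v, f v ^ 2 := by
    rw [sum_comm]
    have : ∀ b, ∑ v : ZMod M × ZMod M, f (move b v) ^ 2 = ∑ v, f v ^ 2 := fun b =>
      sum_move b fun v => f v ^ 2
    simp only [this, sum_const, card_univ, nsmul_eq_mul]
    simp
  have h3 := sum_le_sum fun v (_ : v ∈ univ) => h1 v
  rw [sum_sub_distrib, ← mul_sum, h2] at h3
  linarith

/-- The gap applies to `f` minus its mean only. As `f` lives on at most 9/10 of the points,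
Cauchy–Schwarz limits the share of the mean to 9/10 of the norm, and a tenth of the gap `1 / 81`
survives. -/
theorem sum_sq_move_le (f : ZMod M × ZMod M → ℝ) (B : Finset (ZMod M × ZMod M))
    (hB : (B.card : ℝ) ≤ 9 / 10 * (M : ℝ) ^ 2) (hf : ∀ v ∉ B, f v = 0) :
    ∑ v, (∑ b, f (move b v)) ^ 2 ≤ (256 - 1 / 810) * ∑ v, f v ^ 2 := by
  have hM : (0 : ℝ) < (M : ℝ) ^ 2 := by
    have : (0 : ℝ) < M := by exact_mod_cast Nat.pos_of_ne_zero (NeZero.ne M)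
    positivity
  obtain ⟨m, hm⟩ : ∃ m, (M : ℝ) ^ 2 * m = ∑ v, f v := ⟨(∑ v, f v) / (M : ℝ) ^ 2, mul_div_cancel₀ _ hM.ne'⟩
  have hcard : ∑ _v : ZMod M × ZMod M, (1 : ℝ) = (M : ℝ) ^ 2 := by
    simp [ZMod.card, sq]
  have hconst : ∀ a : ℝ, ∑ _v : ZMod M × ZMod M, a = (M : ℝ) ^ 2 * a := fun a => by
    rw [← hcard, sum_mul]; simp
  have h0 : ∑ v, (f v - m) = 0 := by
    rw [sum_sub_distrib, hconst, hm, sub_self]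
  have h1 := sum_sq_move_le_of_mean_zero _ h0
  have h2 : ∀ v : ZMod M × ZMod M, ∑ b, (f (move b v) - m) = ∑ b, f (move b v) - 16 * m := by
    intro v
    rw [sum_sub_distrib]
    simp
  have h3 : ∑ v : ZMod M × ZMod M, ∑ b, f (move b v) = 16 * ∑ v, f v := by
    rw [sum_comm]
    simp only [sum_move, sum_const, card_univ, nsmul_eq_mul]
    simp
  have h4 : ∑ v, (f v - m) ^ 2 = ∑ v, f v ^ 2 - (M : ℝ) ^ 2 * m ^ 2 := by
    simp only [sub_sq, sum_add_distrib, sum_sub_distrib, hconst, ← sum_mul, ← mul_sum, ← hm]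
    ring
  have h5 : ∑ v : ZMod M × ZMod M, (∑ b, f (move b v) - 16 * m) ^ 2 =
      ∑ v : ZMod M × ZMod M, (∑ b, f (move b v)) ^ 2 - 256 * ((M : ℝ) ^ 2 * m ^ 2) := by
    simp only [sub_sq, sum_add_distrib, sum_sub_distrib, hconst, ← sum_mul, ← mul_sum, h3, ← hm]
    ring
  simp only [h2] at h1
  rw [h4, h5] at h1
  have h6 : (∑ v, f v) ^ 2 ≤ 9 / 10 * (M : ℝ) ^ 2 * ∑ v, f v ^ 2 := by
    have h7 : ∑ v, f v = ∑ v ∈ B, f v :=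
      (sum_subset (subset_univ B) fun v _ hv => hf v hv).symm
    have h8 : (∑ v ∈ B, f v) ^ 2 ≤ B.card * ∑ v ∈ B, f v ^ 2 := sq_sum_le_card_mul_sum_sq
    have h9 : ∑ v ∈ B, f v ^ 2 ≤ ∑ v, f v ^ 2 :=
      sum_le_sum_of_subset_of_nonneg (subset_univ _) fun _ _ _ => sq_nonneg _
    have h10 : 0 ≤ ∑ v, f v ^ 2 := sum_nonneg fun _ _ => sq_nonneg _
    rw [h7]
    calc _ ≤ _ := h8
      _ ≤ B.card * ∑ v, f v ^ 2 := by gcongr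
      _ ≤ _ := by gcongr
  have h11 : (M : ℝ) ^ 2 * m ^ 2 ≤ 9 / 10 * ∑ v, f v ^ 2 := by
    rw [← hm] at h6
    have : (M : ℝ) ^ 2 * ((M : ℝ) ^ 2 * m ^ 2) ≤ (M : ℝ) ^ 2 * (9 / 10 * ∑ v, f v ^ 2) := by
      linarith
    exact le_of_mul_le_mul_left this hM
  linarith

open Classical in
/-- The number of strings of random bits for which the first `n` vertices of the walk from `v`
all lie in `B`. -/
noncomputable def stay (B : Finset (ZMod M × ZMod M)) : ℕ → ZMod M × ZMod M → ℕ
  | 0, _ => 1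
  | n + 1, v => if v ∈ B then ∑ b, stay B n (move b v) else 0

theorem sum_sq_stay_le (B : Finset (ZMod M × ZMod M))
    (hB : (B.card : ℝ) ≤ 9 / 10 * (M : ℝ) ^ 2) (n : ℕ) :
    ∑ v, (stay B (n + 1) v : ℝ) ^ 2 ≤ (256 - 1 / 810) ^ n * (256 * (M : ℝ) ^ 2) := by
  have hle : ∀ n v, (stay B (n + 1) v : ℝ) ^ 2 ≤ (∑ b, (stay B n (move b v) : ℝ)) ^ 2 := by
    intro n v
    rw [stay]
    split_ifs
    · push_cast; exact le_rfl
    · simp [sq_nonneg]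
  induction n with
  | zero =>
    refine (sum_le_sum fun v _ => hle 0 v).trans ?_
    simp only [stay, Nat.cast_one, sum_const, card_univ, Fintype.card_prod, ZMod.card,
      Fintype.card_bool, nsmul_eq_mul]
    push_cast
    exact (by ring : _ = _).le
  | succ n ih =>
    refine (sum_le_sum fun v _ => hle (n + 1) v).trans
      ((sum_sq_move_le (fun v => (stay B (n + 1) v : ℝ)) B hB fun v hv => ?_).trans ?_)
    · simp [stay, hv]
    · rw [pow_succ', mul_assoc]
      exact mul_le_mul_of_nonneg_left ih (by norm_num)

/-- Here `207360 = 256 * 810`, and `2 ^ 19` is more than twice this number. -/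
theorem pow_le_quarter : (1 - 1 / 207360 : ℝ) ^ (2 ^ 19) ≤ 1 / 4 := by
  have h1 : (1 - 1 / 207360 : ℝ) ≤ Real.exp (-(1 / 207360)) := by
    have := Real.add_one_le_exp (-(1 / 207360) : ℝ)
    linarith
  calc (1 - 1 / 207360 : ℝ) ^ (2 ^ 19) ≤ Real.exp (-(1 / 207360)) ^ (2 ^ 19) := by
        gcongr
    _ = Real.exp (((2 ^ 19 : ℕ) : ℝ) * -(1 / 207360)) := (Real.exp_nat_mul _ _).symm
    _ ≤ Real.exp (-2) := by
        apply Real.exp_le_exp.2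
        norm_num
    _ ≤ 1 / 4 := by
        rw [Real.exp_neg, one_div]
        apply inv_anti₀ (by norm_num)
        have h2 : (2 : ℝ) ≤ Real.exp 1 := by
          have := Real.add_one_le_exp (1 : ℝ)
          linarith
        have : Real.exp 2 = Real.exp 1 * Real.exp 1 := by
          rw [← Real.exp_add]; norm_num
        rw [this]
        nlinarith

/-- Cauchy–Schwarz passes from squares to sums, so the factor `1 / 4` gained in `2 ^ 19` steps
becomes `1 / 2`. -/
theorem sum_stay_le (B : Finset (ZMod M × ZMod M))
    (hB : (B.card : ℝ) ≤ 9 / 10 * (M : ℝ) ^ 2) (e : ℕ) :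
    ∑ v, (stay B (e * 2 ^ 19 + 1) v : ℝ) ≤
      (1 / 2) ^ e * (16 ^ (e * 2 ^ 19 + 1) * (M : ℝ) ^ 2) := by
  have h1 := sum_sq_stay_le B hB (e * 2 ^ 19)
  generalize hn : e * 2 ^ 19 = n at *
  have h2 : (∑ v, (stay B (n + 1) v : ℝ)) ^ 2 ≤
      (M : ℝ) ^ 2 * ∑ v, (stay B (n + 1) v : ℝ) ^ 2 := by
    have := sq_sum_le_card_mul_sum_sq (s := (univ : Finset (ZMod M × ZMod M)))
      (f := fun v => (stay B (n + 1) v : ℝ))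
    rw [card_univ, Fintype.card_prod, ZMod.card] at this
    push_cast at this
    rwa [← sq] at this
  have h3 : ((256 : ℝ) - 1 / 810) ^ n ≤ 256 ^ n * ((1 / 2) ^ e) ^ 2 := by
    have : ((256 : ℝ) - 1 / 810) = 256 * (1 - 1 / 207360) := by norm_num
    rw [this, mul_pow]
    gcongr
    rw [← hn, mul_comm e, pow_mul, ← pow_mul (1 / 2 : ℝ), mul_comm e 2, pow_mul (1 / 2 : ℝ)]
    refine pow_le_pow_left₀ (by apply pow_nonneg; norm_num) ?_ _
    refine pow_le_quarter.trans (by norm_num)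
  refine abs_le_of_sq_le_sq' ?_ (by positivity) |>.2
  calc _ ≤ _ := h2
    _ ≤ (M : ℝ) ^ 2 * ((256 ^ n * ((1 / 2) ^ e) ^ 2) * (256 * (M : ℝ) ^ 2)) := by
        gcongr
        exact h1.trans (by gcongr)
    _ = ((1 / 2) ^ e * (16 ^ (n + 1) * (M : ℝ) ^ 2)) ^ 2 := by
        have : (256 : ℝ) ^ n = (16 ^ n) ^ 2 := by
          rw [← pow_mul, mul_comm, pow_mul]; norm_num
        rw [this]
        ring

end Expander

/-! ### Counting the pairs whose sum of squares is not a square -/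

namespace Tower

section Count

open Finset

variable {F : Type*} [Field F] [Fintype F] [DecidableEq F]

/-- Each `a` admits at most two `b`, and `a = 0` only one. -/
theorem card_sumSq_eq_zero_le :
    #{v : F × F | v.1 * v.1 + v.2 * v.2 = 0} + 1 ≤ 2 * Fintype.card F := by
  have h1 : #{v : F × F | v.1 * v.1 + v.2 * v.2 = 0} =
      ∑ a : F, #{b : F | a * a + b * b = 0} := by
    rw [card_filter, ← univ_product_univ, sum_product]
    simp only [card_filter]
  have h2 : ∀ a : F, #{b : F | a * a + b * b = 0} ≤ 2 := by
    intro a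
    by_contra! h
    obtain ⟨x, y, z, hx, hy, hz, hxy, hxz, hyz⟩ := two_lt_card_iff.1 h
    simp only [mem_filter_univ] at hx hy hz
    have h3 : (x - y) * (x + y) = 0 := by linear_combination hx - hy
    have h4 : (x - z) * (x + z) = 0 := by linear_combination hx - hz
    have h5 := (mul_eq_zero.1 h3).resolve_left (sub_ne_zero.2 hxy)
    have h6 := (mul_eq_zero.1 h4).resolve_left (sub_ne_zero.2 hxz)
    exact hyz (by linear_combination h5 - h6)
  have h3 : #{b : F | (0 : F) * 0 + b * b = 0} = 1 := by
    rw [card_eq_one]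
    exact ⟨0, by ext; simp⟩
  rw [h1, ← add_sum_erase _ _ (mem_univ (0 : F)), h3]
  have h4 := sum_le_card_nsmul (univ.erase (0 : F)) (fun a => #{b : F | a * a + b * b = 0}) 2
    fun a _ => h2 a
  rw [card_erase_of_mem (mem_univ _), card_univ, smul_eq_mul] at h4
  have := Fintype.card_pos (α := F)
  omega

/-- A nonsquare `g` is a sum of two squares `a ^ 2 + b ^ 2`. Multiplication by the formal number `a
+ b * i` multiplies sums of squares by `g` and is injective, so nonzero square values are not more
frequent than nonsquare ones. -/
theorem card_sumSq_pow_ne_le (hF : ringChar F ≠ 2) :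
    2 * #{v : F × F | (v.1 * v.1 + v.2 * v.2) ^ (Fintype.card F / 2) ≠ -1} + 1 ≤
      Fintype.card F ^ 2 + 2 * Fintype.card F := by
  set n := Fintype.card F / 2
  have h1 : (1 : F) ≠ -1 := (Ring.neg_one_ne_one_of_char_ne_two hF).symm
  obtain ⟨g, hg⟩ := FiniteField.exists_nonsquare hF
  have hg0 : g ≠ 0 := by
    rintro rfl
    exact hg (IsSquare.zero)
  have hgn : g ^ n = -1 :=
    (FiniteField.pow_dichotomy hF hg0).resolve_left fun h =>
      hg ((FiniteField.isSquare_iff hF hg0).2 h)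
  obtain ⟨a, b, hab⟩ : ∃ a b : F, a * a + b * b = g := by
    obtain ⟨a, b, h⟩ := FiniteField.exists_root_sum_quadratic
      (f := (Polynomial.X ^ 2 : Polynomial F)) (g := Polynomial.X ^ 2 - Polynomial.C g)
      (by simp) (Polynomial.degree_X_pow_sub_C (by norm_num) g) (FiniteField.odd_card_of_char_ne_two hF)
    exact ⟨a, b, by simp at h; linear_combination h⟩
  have h2 : #{v : F × F | (v.1 * v.1 + v.2 * v.2) ^ n = 1} ≤
      #{v : F × F | (v.1 * v.1 + v.2 * v.2) ^ n = -1} := by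
    refine card_le_card_of_injOn (fun v => (v.1 * a - v.2 * b, v.1 * b + v.2 * a)) ?_ ?_
    · intro v hv
      simp only [coe_filter, mem_univ, true_and, Set.mem_ofPred_eq] at hv ⊢
      have : (v.1 * a - v.2 * b) * (v.1 * a - v.2 * b) + (v.1 * b + v.2 * a) * (v.1 * b + v.2 * a)
          = (v.1 * v.1 + v.2 * v.2) * g := by rw [← hab]; ring
      rw [this, mul_pow, hv, hgn, one_mul]
    · rintro ⟨x, y⟩ - ⟨x', y'⟩ - h
      simp only [Prod.mk.injEq] at h
      obtain ⟨h3, h4⟩ := h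
      have h5 : (x - x') * g = 0 := by rw [← hab]; linear_combination a * h3 + b * h4
      have h6 : (y - y') * g = 0 := by rw [← hab]; linear_combination a * h4 - b * h3
      rw [Prod.mk.injEq]
      exact ⟨sub_eq_zero.1 ((mul_eq_zero.1 h5).resolve_right hg0),
        sub_eq_zero.1 ((mul_eq_zero.1 h6).resolve_right hg0)⟩
  have h3 : #{v : F × F | (v.1 * v.1 + v.2 * v.2) ^ n ≠ -1} ≤
      #{v : F × F | v.1 * v.1 + v.2 * v.2 = 0} +
        #{v : F × F | (v.1 * v.1 + v.2 * v.2) ^ n = 1} := by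
    refine le_trans (card_le_card fun v hv => ?_) (card_union_le _ _)
    simp only [mem_union, mem_filter_univ] at hv ⊢
    by_cases h0 : v.1 * v.1 + v.2 * v.2 = 0
    · exact Or.inl h0
    · exact Or.inr ((FiniteField.pow_dichotomy hF h0).resolve_right hv)
  have h4 : #{v : F × F | (v.1 * v.1 + v.2 * v.2) ^ n = -1} +
      #{v : F × F | (v.1 * v.1 + v.2 * v.2) ^ n ≠ -1} = Fintype.card F ^ 2 := by
    rw [card_filter_add_card_filter_not, card_univ, Fintype.card_prod, sq]
  have h5 := card_sumSq_eq_zero_le (F := F)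
  omega

end Count

section Digits

open Finset

variable {F : Type*} [Field F] {p u : ℕ} {c : ℕ → ℕ} {θ : F}

theorem mod_pow_congr {x y : ℕ} (h : ∀ i < u, x / p ^ i % p = y / p ^ i % p) :
    x % p ^ u = y % p ^ u := by
  induction u with
  | zero => simp [Nat.mod_one]
  | succ u ih => rw [Nat.mod_pow_succ, Nat.mod_pow_succ, ih fun i hi => h i (by omega), h u (by omega)]

theorem Presents.mod_eq_of_elt_eq (h : Presents p u c θ) {x y : ℕ}
    (hxy : elt θ p u x = elt θ p u y) : x % p ^ u = y % p ^ u := by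
  have hp : 0 < p := by have := h.two_lt; omega
  exact mod_pow_congr (h.inj _ _ (fun i _ => Nat.mod_lt _ hp) (fun i _ => Nat.mod_lt _ hp) hxy)

variable [DecidableEq F] {M : ℕ} [NeZero M]

/-- The element determines `x` modulo `p ^ u`, so on a fibre the quotient by `p ^ u` is injective.
-/
theorem Presents.card_elt_eq_le (h : Presents p u c θ) (a : F) :
    #{x : ZMod M | elt θ p u x.val = a} ≤ M / p ^ u + 1 := by
  rw [← card_range (M / p ^ u + 1)]
  refine card_le_card_of_injOn (fun x => x.val / p ^ u) (fun x _ => ?_) fun x hx y hy hxy => ?_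
  · simp only [coe_range, Set.mem_Iio]
    exact Nat.lt_succ_of_le (Nat.div_le_div_right (ZMod.val_lt x).le)
  · simp only [coe_filter, mem_univ, true_and, Set.mem_ofPred_eq] at hx hy
    apply ZMod.val_injective
    dsimp only at hxy
    rw [← Nat.mod_add_div x.val (p ^ u), ← Nat.mod_add_div y.val (p ^ u), hxy,
      h.mod_eq_of_elt_eq (hx.trans hy.symm)]

-- Since `16 * q ≤ M`, fibres of the digit map exceed the average by a factor of at most `17 / 16`,
-- and `7 / 9 * (17 / 16) ^ 2 < 9 / 10`.
open Classical in
theorem Presents.card_not_good_le (h : Presents p u c θ) [Fintype F]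
    (hcard : Fintype.card F = p ^ u) (hF : ringChar F ≠ 2) (hM : 16 * p ^ u ≤ M) :
    (#{v : ZMod M × ZMod M | ¬ Good θ p u v.1.val v.2.val} : ℝ) ≤ 9 / 10 * (M : ℝ) ^ 2 := by
  have h1 : #{v : ZMod M × ZMod M | ¬ Good θ p u v.1.val v.2.val} ≤
      #{v : F × F | (v.1 * v.1 + v.2 * v.2) ^ (p ^ u / 2) ≠ -1} *
        ((M / p ^ u + 1) * (M / p ^ u + 1)) := by
    rw [mul_comm]
    refine card_le_mul_card_image_of_maps_to
      (f := fun v : ZMod M × ZMod M => (elt θ p u v.1.val, elt θ p u v.2.val))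
      (fun v hv => ?_) _ fun v _ => ?_
    · exact mem_filter.2 ⟨mem_univ _, (mem_filter.1 hv).2⟩
    · refine le_trans (card_le_card (t := filter (fun x : ZMod M => elt θ p u x.val = v.1) univ ×ˢ
        filter (fun x : ZMod M => elt θ p u x.val = v.2) univ) fun w hw => ?_) ?_
      · simp only [mem_filter, Prod.ext_iff] at hw
        simp [hw.2]
      · rw [card_product]
        exact Nat.mul_le_mul (h.card_elt_eq_le _) (h.card_elt_eq_le _)
  have h2 := card_sumSq_pow_ne_le hF
  rw [hcard] at h2
  set n := #{v : F × F | (v.1 * v.1 + v.2 * v.2) ^ (p ^ u / 2) ≠ -1}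
  have hq : 3 ≤ p ^ u := le_trans h.two_lt (Nat.le_self_pow h.pos.ne' p)
  generalize p ^ u = q at *
  have hq' : (3 : ℝ) ≤ q := by exact_mod_cast hq
  have hM' : (16 : ℝ) * q ≤ M := by exact_mod_cast hM
  have h3 : (2 : ℝ) * n + 1 ≤ q ^ 2 + 2 * q := by exact_mod_cast h2
  have h4 : 9 * (n : ℝ) ≤ 7 * q ^ 2 := by nlinarith
  have h5 : ((M / q + 1 : ℕ) : ℝ) * q ≤ 17 / 16 * M := by
    have : ((M / q * q : ℕ) : ℝ) ≤ M := by exact_mod_cast Nat.div_mul_le_self M q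
    push_cast at this ⊢
    linarith
  have h6 : (((M / q + 1 : ℕ) : ℝ) * q) ^ 2 ≤ (17 / 16 * M) ^ 2 :=
    pow_le_pow_left₀ (by positivity) h5 2
  calc _ ≤ ((n * ((M / q + 1) * (M / q + 1)) : ℕ) : ℝ) := by exact_mod_cast h1
    _ = n * ((M / q + 1 : ℕ) : ℝ) ^ 2 := by push_cast; ring
    _ ≤ (7 / 9 * q ^ 2) * ((M / q + 1 : ℕ) : ℝ) ^ 2 := by gcongr; linarith
    _ = 7 / 9 * (((M / q + 1 : ℕ) : ℝ) * q) ^ 2 := by ring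
    _ ≤ 7 / 9 * (17 / 16 * M) ^ 2 := by gcongr
    _ ≤ _ := by nlinarith [sq_nonneg (M : ℝ)]

end Digits

end Tower

/-! ### Counting strings of random bits -/

namespace Tower

open Finset Expander

open Classical in
/-- The number of strings of `n` bits with the property `P`. -/
noncomputable def countStrings : ℕ → (List Bool → Prop) → ℕ
  | 0, P => if P [] then 1 else 0
  | n + 1, P => ∑ b, countStrings n fun w => P (b :: w)

theorem countStrings_eq_card (n : ℕ) (P : List Bool → Prop) :
    countStrings n P = Nat.card {ω : Fin n → Bool // P (List.ofFn ω)} := by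
  classical
  rw [Nat.card_eq_fintype_card, Fintype.card_subtype, card_filter]
  induction n generalizing P with
  | zero => simp [countStrings]
  | succ n ih =>
    rw [countStrings, ← (Fin.consEquiv fun _ : Fin (n + 1) => Bool).sum_comp,
      Fintype.sum_prod_type]
    refine sum_congr rfl fun b _ => ?_
    rw [ih]
    simp [Fin.consEquiv, List.ofFn_succ]

theorem countStrings_false (n : ℕ) : countStrings n (fun _ => False) = 0 := by
  rw [countStrings_eq_card]
  simp

theorem sum_range_two_pow_succ (g : ℕ → ℕ) (n x : ℕ) :
    ∑ i ∈ range (2 ^ (n + 1)), g (x * 2 ^ (n + 1) + i) =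
      ∑ b : Bool, ∑ i ∈ range (2 ^ n), g ((x * 2 + b.toNat) * 2 ^ n + i) := by
  rw [pow_succ, mul_two, sum_range_add, Fintype.sum_bool, add_comm]
  congr 1 <;> refine sum_congr rfl fun i _ => congrArg g ?_
  · simp only [Bool.toNat_true]; ring
  · simp only [Bool.toNat_false]; ring

/-- Drawing is a bijection from strings of `2 * n` bits to pairs of `n`-digit numbers, so the
starting pair is uniform. -/
theorem countStrings_draw (P : ℕ × ℕ × List Bool → Prop) (R n x y : ℕ) :
    countStrings (R + 2 * n) (fun w => P (draw n x y w)) =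
      ∑ i ∈ range (2 ^ n), ∑ j ∈ range (2 ^ n),
        countStrings R fun w => P (x * 2 ^ n + i, y * 2 ^ n + j, w) := by
  induction n generalizing x y with
  | zero => simp [draw]
  | succ n ih =>
    have h : countStrings (R + 2 * (n + 1)) (fun w => P (draw (n + 1) x y w)) =
        ∑ b₁ : Bool, ∑ b₂ : Bool, countStrings (R + 2 * n) fun w =>
          P (draw n (x * 2 + b₁.toNat) (y * 2 + b₂.toNat) w) := rfl
    rw [h, sum_range_two_pow_succ (fun a => ∑ j ∈ range (2 ^ (n + 1)),
      countStrings R fun w => P (a, y * 2 ^ (n + 1) + j, w))]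
    refine sum_congr rfl fun b₁ _ => ?_
    simp only [ih]
    rw [sum_comm]
    refine sum_congr rfl fun i _ => ?_
    rw [sum_range_two_pow_succ (fun a => countStrings R fun w =>
      P ((x * 2 + b₁.toNat) * 2 ^ n + i, a, w))]

section walk

variable {M : ℕ} [NeZero M]

theorem stepFst_lt (x y : ℕ) (b₁ b₂ : Bool) : stepFst M x y b₁ b₂ < M :=
  Nat.mod_lt _ (Nat.pos_of_ne_zero (NeZero.ne M))

-- A step of the program on residues is the map `move` on `ZMod M`, so both sides satisfy the same
-- recursion.
open Classical in
theorem countStrings_walk (good : ℕ → ℕ → Prop) (n : ℕ) {x y : ℕ} (hx : x < M) (hy : y < M) :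
    countStrings (4 * n) (fun w => ¬ Walk good M n x y w) =
      stay {v : ZMod M × ZMod M | ¬ good v.1.val v.2.val} n (x, y) := by
  induction n generalizing x y with
  | zero => simp [countStrings, stay, Walk]
  | succ n ih =>
    have h : countStrings (4 * (n + 1)) (fun w => ¬ Walk good M (n + 1) x y w) =
        ∑ b₁ : Bool, ∑ b₂ : Bool, ∑ b₃ : Bool, ∑ b₄ : Bool, countStrings (4 * n) fun w =>
          ¬ (good x y ∨ Walk good M n (stepFst M x y b₁ b₂)
            (stepFst M y (stepFst M x y b₁ b₂) b₃ b₄) w) := rfl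
    rw [h, stay]
    by_cases hg : good x y
    · simp [hg, countStrings_false, ZMod.val_cast_of_lt hx, ZMod.val_cast_of_lt hy]
    · rw [if_pos (by simp [hg, ZMod.val_cast_of_lt hx, ZMod.val_cast_of_lt hy])]
      simp only [Fintype.sum_prod_type, hg, false_or]
      refine sum_congr rfl fun b₁ _ => sum_congr rfl fun b₂ _ => sum_congr rfl fun b₃ _ =>
        sum_congr rfl fun b₄ _ => ?_
      rw [ih (stepFst_lt _ _ _ _) (stepFst_lt _ _ _ _)]
      congr 1
      simp [move, stepFst]

theorem sum_range_eq_sum_zmod (g : ZMod M → ℕ) :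
    ∑ i ∈ range M, g i = ∑ x, g x :=
  sum_nbij' (fun i => (i : ZMod M)) ZMod.val (fun _ _ => mem_univ _)
    (fun x _ => mem_range.2 (ZMod.val_lt x)) (fun _ hi => ZMod.val_cast_of_lt (mem_range.1 hi))
    (fun x _ => ZMod.natCast_zmod_val x) fun _ _ => rfl

end walk

theorem Presents.countStrings_walk_le {F : Type*} [Field F] [Fintype F] {p u : ℕ} {c : ℕ → ℕ}
    {θ : F} (h : Presents p u c θ) (hcard : Fintype.card F = p ^ u) (hF : ringChar F ≠ 2)
    {b : ℕ} (hb : 16 * p ^ u ≤ 2 ^ b) (e : ℕ) :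
    (countStrings (4 * (e * 2 ^ 19 + 1) + 2 * b) (fun w =>
      ¬ Walk (Good θ p u) (2 ^ b) (e * 2 ^ 19 + 1)
        (draw b 0 0 w).1 (draw b 0 0 w).2.1 (draw b 0 0 w).2.2) : ℝ) ≤
      (1 / 2) ^ e * 2 ^ (4 * (e * 2 ^ 19 + 1) + 2 * b) := by
  classical
  have hM : NeZero (2 ^ b) := ⟨by positivity⟩
  have h1 := sum_stay_le _ (h.card_not_good_le hcard hF hb) e
  generalize e * 2 ^ 19 + 1 = n at *
  rw [countStrings_draw (fun v => ¬ Walk (Good θ p u) (2 ^ b) n v.1 v.2.1 v.2.2)]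
  have h2 : ∑ i ∈ range (2 ^ b), ∑ j ∈ range (2 ^ b), countStrings (4 * n) (fun w =>
      ¬ Walk (Good θ p u) (2 ^ b) n (0 * 2 ^ b + i) (0 * 2 ^ b + j) w) =
      ∑ v, stay {v : ZMod (2 ^ b) × ZMod (2 ^ b) | ¬ Good θ p u v.1.val v.2.val} n v := by
    rw [Fintype.sum_prod_type, ← sum_range_eq_sum_zmod]
    refine sum_congr rfl fun i hi => ?_
    rw [← sum_range_eq_sum_zmod]
    refine sum_congr rfl fun j hj => ?_
    rw [zero_mul, zero_add, zero_add]
    exact countStrings_walk _ _ (mem_range.1 hi) (mem_range.1 hj)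
  rw [h2]
  push_cast
  refine h1.trans (le_of_eq ?_)
  rw [pow_add, pow_mul, mul_comm 2 b, pow_mul]
  push_cast
  norm_num

end Tower

/-! ### The main theorem -/

namespace Tower

open Finset

theorem countStrings_add_not (n : ℕ) (P : List Bool → Prop) :
    countStrings n P + countStrings n (fun w => ¬ P w) = 2 ^ n := by
  induction n generalizing P with
  | zero => by_cases h : P [] <;> simp [countStrings, h]
  | succ n ih => simp only [countStrings, ← sum_add_distrib, ih]; simp [pow_succ, mul_comm]

theorem stepBound_le {u ℓ e b k n : ℕ} (hn : 1 ≤ n) (hu : u ≤ n) (hℓ : ℓ ≤ n) (he : e ≤ n)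
    (hb : b ≤ n + 4) (hk : k ≤ n) : stepBound u ℓ e b k ≤ 10 ^ 8 * n ^ 3 := by
  have h1 : stepBound u ℓ e b k ≤ stepBound n n n (n + 4) n := by
    unfold stepBound
    gcongr
  refine h1.trans ?_
  have h2 : 1 ≤ n ^ 3 := Nat.one_le_pow _ _ hn
  have h3 : n ≤ n ^ 3 := Nat.le_self_pow (by norm_num) n
  have h4 : n ^ 2 ≤ n ^ 3 := Nat.pow_le_pow_right hn (by norm_num)
  unfold stepBound
  ring_nf at h2 h3 h4 ⊢
  omega

theorem Presents.setup {F : Type*} [Field F] {p u ℓ e n : ℕ} {c : ℕ → ℕ} {θ : F}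
    (h : Presents p u c θ) (hu : u ≤ n) (hℓ : ℓ ≤ n) (he : e ≤ n) (hp : p ≤ 2 ^ n) :
    Setup p u ℓ e ((3 * n + 2) * (2 * n + 2) + 25) c θ := by
  have hn : n < 2 ^ n := Nat.lt_two_pow_self
  refine { h with base_pow_le := ?_, trials_le := ?_, length_le := ?_ }
  · have h1 : base p u ≤ 2 ^ (3 * n + 2) := by
      calc base p u = 4 * u * p ^ 2 := rfl
        _ ≤ 4 * 2 ^ n * (2 ^ n) ^ 2 := by gcongr; omega
        _ = 2 ^ (3 * n + 2) := by ring
    calc base p u ^ (2 * u + 2) ≤ (2 ^ (3 * n + 2)) ^ (2 * u + 2) := Nat.pow_le_pow_left h1 _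
      _ ≤ (2 ^ (3 * n + 2)) ^ (2 * n + 2) := Nat.pow_le_pow_right (by positivity) (by omega)
      _ = 2 ^ ((3 * n + 2) * (2 * n + 2)) := (pow_mul _ _ _).symm
      _ ≤ _ := Nat.pow_le_pow_right (by norm_num) (by omega)
  · calc (e + 1) * 2 ^ 20 ≤ 2 ^ n * 2 ^ 20 := by gcongr; omega
      _ = 2 ^ (n + 20) := (pow_add _ _ _).symm
      _ ≤ _ := Nat.pow_le_pow_right (by norm_num) (by nlinarith)
  · calc ℓ + 4 ≤ 2 ^ n * 2 ^ 2 := by omega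
      _ = 2 ^ (n + 2) := (pow_add _ _ _).symm
      _ ≤ _ := Nat.pow_le_pow_right (by norm_num) (by nlinarith)

/-- Bounds for the parameters of the algorithm in terms of the allowance for random bits. -/
theorem parameter_bounds {p u : ℕ} (hp : 2 < p) (hu : 0 < u) (ℓ : ℕ) {δ : ℝ} (hδ : 0 < δ)
    (hδ' : δ ≤ 1) : ∃ n : ℕ, 1 ≤ n ∧ u ≤ n ∧ ℓ ≤ n ∧ ⌈Real.logb 2 (1 / δ)⌉₊ ≤ n ∧
      p ^ u ≤ 2 ^ n ∧ (n : ℝ) ≤ 2 * (2 ^ ℓ * Real.logb 2 (p ^ u : ℕ) + Real.logb 2 (1 / δ)) := by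
  set D := Real.logb 2 (1 / δ)
  set l := Real.logb 2 (p ^ u : ℕ) with hl
  have hD : 0 ≤ D := Real.logb_nonneg (by norm_num) ((one_le_div hδ).2 hδ')
  have hq : (2 : ℝ) ^ (u : ℝ) ≤ (p ^ u : ℕ) := by
    rw [Real.rpow_natCast]
    exact_mod_cast Nat.pow_le_pow_left hp.le u
  have hq0 : (0 : ℝ) < (p ^ u : ℕ) := lt_of_lt_of_le (by positivity) hq
  have hul : (u : ℝ) ≤ l := (Real.le_logb_iff_rpow_le (by norm_num) hq0).2 hq
  have hu1 : (1 : ℝ) ≤ u := by exact_mod_cast hu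
  have h2 : (1 : ℝ) ≤ 2 ^ ℓ := one_le_pow₀ (by norm_num)
  have hℓ : (ℓ : ℝ) ≤ 2 ^ ℓ := by exact_mod_cast (Nat.lt_two_pow_self (n := ℓ)).le
  have h3 : l ≤ 2 ^ ℓ * l := le_mul_of_one_le_left (by linarith) h2
  have h4 : 2 ^ ℓ ≤ 2 ^ ℓ * l := le_mul_of_one_le_right (by linarith) (by linarith)
  set N := 2 ^ ℓ * l + D
  have hN : N ≤ ⌈N⌉₊ := Nat.le_ceil N
  refine ⟨⌈N⌉₊, ?_, ?_, ?_, Nat.ceil_mono (by linarith), ?_, ?_⟩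
  · exact_mod_cast (show (1 : ℝ) ≤ ⌈N⌉₊ by linarith)
  · exact_mod_cast (show (u : ℝ) ≤ ⌈N⌉₊ by linarith)
  · exact_mod_cast (show (ℓ : ℝ) ≤ ⌈N⌉₊ by linarith)
  · have : ((p ^ u : ℕ) : ℝ) ≤ 2 ^ ((⌈N⌉₊ : ℕ) : ℝ) :=
      (Real.logb_le_iff_le_rpow (by norm_num) hq0).1 (by linarith)
    rw [Real.rpow_natCast] at this
    exact_mod_cast this
  -- Since `N ≥ 1`, rounding up at most doubles it.
  · have := Nat.ceil_lt_add_one (show 0 ≤ N by linarith)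
    linarith

theorem half_pow_ceil_logb_le {δ : ℝ} (hδ : 0 < δ) :
    (1 / 2 : ℝ) ^ ⌈Real.logb 2 (1 / δ)⌉₊ ≤ δ := by
  have h := (Real.logb_le_iff_le_rpow (b := 2) (by norm_num) (one_div_pos.2 hδ)).1
    (Nat.le_ceil (Real.logb 2 (1 / δ)))
  rw [Real.rpow_natCast] at h
  rw [one_div_pow]
  exact (one_div_le (by positivity) hδ).2 h

end Tower

theorem mainTheorem5 :
    ∃ (A : RAM.Prog) (C : ℝ) (c : ℕ),
      ∀ (p : ℕ) [Fact p.Prime] (F : Type*) [Field F] [Finite F] [Algebra (ZMod p) F] (θ : F)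
        (ℓ : ℕ) (δ : ℝ),
        p ≠ 2 → Algebra.adjoin (ZMod p) {θ} = ⊤ → 0 < δ → δ ≤ 1 →
        ∃ r : ℕ,
          -- number of random bits
          (r : ℝ) ≤ C * (2 ^ ℓ * Real.logb 2 (Nat.card F) + Real.logb 2 (1 / δ)) ∧
          -- on each string of random bits: running time, and a correct output or failure
          (∀ ω : Fin r → Bool, ∃ (out : List ℕ) (t : ℕ),
            A.Outputs (Tower.inputTape (p := p) θ ℓ ⌈Real.logb 2 (1 / δ)⌉₊) (List.ofFn ω) out t ∧
            (t : ℝ) ≤ C * (2 ^ ℓ * Real.logb 2 (Nat.card F) + Real.logb 2 (1 / δ)) ^ c ∧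
            (Tower.IsSuccess p θ ℓ out ∨ out = Tower.failure)) ∧
          -- probability of success
          1 - δ ≤ (Nat.card {ω : Fin r → Bool // ∃ (out : List ℕ) (t : ℕ),
            A.Outputs (Tower.inputTape (p := p) θ ℓ ⌈Real.logb 2 (1 / δ)⌉₊) (List.ofFn ω) out t ∧
            Tower.IsSuccess p θ ℓ out} : ℝ) / 2 ^ r := by
  -- The cost is at most `136 * 10 ^ 8 * n ^ 5` with `n ≤ 2 * N`, and `136 * 32 * 10 ^ 8 < 10 ^ 12`.
  refine ⟨Tower.towerP, 10 ^ 12, 5, fun p _ F _ _ _ θ ℓ δ hp hθ hδ hδ' => ?_⟩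
  have hF : Fintype F := Fintype.ofFinite F
  have hP := Tower.presents_minpoly hp θ
  have hcard := Tower.card_eq_pow_natDegree hθ
  have hcard' : Fintype.card F = p ^ (minpoly (ZMod p) θ).natDegree := by
    rw [← hcard, Nat.card_eq_fintype_card]
  have hchar : ringChar F ≠ 2 := by
    have := charP_of_injective_algebraMap (algebraMap (ZMod p) F).injective p
    rwa [ringChar.eq F p]
  have hodd : p ^ (minpoly (ZMod p) θ).natDegree % 2 = 1 :=
    hcard' ▸ FiniteField.odd_card_of_char_ne_two hchar
  have hsucc : ∀ {out}, (∃ f g, Tower.IsTowerCode θ p (minpoly (ZMod p) θ).natDegree ℓ f g out) →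
      Tower.IsSuccess p θ ℓ out := fun ⟨_, _, h⟩ => h.isSuccess hp hcard'
  obtain ⟨n, hn, hu, hℓ, he, hq, hnN⟩ := Tower.parameter_bounds hP.two_lt hP.pos ℓ hδ hδ'
  rw [Tower.inputTape_eq, hcard]
  have hδe := Tower.half_pow_ceil_logb_le hδ
  generalize 2 ^ ℓ * Real.logb 2 ((p ^ (minpoly (ZMod p) θ).natDegree : ℕ) : ℝ) +
    Real.logb 2 (1 / δ) = N at *
  generalize ⌈Real.logb 2 (1 / δ)⌉₊ = e at *
  generalize (minpoly (ZMod p) θ).natDegree = u at *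
  have hS := hP.setup hu hℓ he ((Nat.le_self_pow hP.pos.ne' p).trans hq)
  obtain ⟨b, hb, hb', hbn⟩ : ∃ b, 16 * p ^ u ≤ 2 ^ b ∧ (∀ j < b, 2 ^ j < 16 * p ^ u) ∧
      b ≤ n + 4 :=
    ⟨Nat.clog 2 (16 * p ^ u), Nat.le_pow_clog (by norm_num) _,
      fun j hj => (Nat.lt_clog_iff_pow_lt (by norm_num)).1 hj,
      Nat.clog_le_of_le_pow (by rw [pow_add]; omega)⟩
  have hk : (p ^ u / 2).size ≤ n := Nat.size_le.2 (by have := hP.two_lt; omega)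
  have hrun := fun w hw => Tower.towerP_outputs hS hodd hb hb' (w := w) hw
  have hN : (1 : ℝ) ≤ 2 * N := le_trans (by exact_mod_cast hn) hnN
  -- Four bits for each round of the walk, and `b` bits for either coordinate of its start.
  refine ⟨4 * (e * 2 ^ 19 + 1) + 2 * b, ?_, fun ω => ?_, ?_⟩
  · have h1 : 4 * (e * 2 ^ 19 + 1) + 2 * b ≤ 10 ^ 7 * n := by omega
    have h2 : ((4 * (e * 2 ^ 19 + 1) + 2 * b : ℕ) : ℝ) ≤ 10 ^ 7 * n := by exact_mod_cast h1
    linarith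
  · obtain ⟨out, t, h1, h2, h3, -⟩ := hrun (List.ofFn ω) (by rw [List.length_ofFn, add_comm])
    refine ⟨out, t, h1, ?_, h3.imp_left hsucc⟩
    have h4 : t ≤ 10 ^ 8 * n ^ 3 * (3 * (45 * n ^ 2) + n ^ 2) := by
      refine h2.trans (Nat.mul_le_mul (Tower.stepBound_le hn hu hℓ he hbn hk) ?_)
      have h5 : n ≤ n ^ 2 := Nat.le_self_pow (by norm_num) n
      nlinarith
    have h5 : (t : ℝ) ≤ 10 ^ 8 * n ^ 3 * (3 * (45 * n ^ 2) + n ^ 2) := by exact_mod_cast h4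
    have h6 : (n : ℝ) ^ 5 ≤ (2 * N) ^ 5 := pow_le_pow_left₀ (by positivity) hnN 5
    have h7 : 0 ≤ N ^ 5 := by have : 0 ≤ N := by linarith
                              positivity
    nlinarith
  · have h1 := hP.countStrings_walk_le hcard' hchar hb e
    have h2 := Tower.countStrings_add_not (4 * (e * 2 ^ 19 + 1) + 2 * b) (fun w =>
      Tower.Walk (Tower.Good θ p u) (2 ^ b) (e * 2 ^ 19 + 1) (Tower.draw b 0 0 w).1
        (Tower.draw b 0 0 w).2.1 (Tower.draw b 0 0 w).2.2)
    rw [Tower.countStrings_eq_card] at h2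
    generalize hr : 4 * (e * 2 ^ 19 + 1) + 2 * b = r at *
    rw [le_div_iff₀ (by positivity)]
    have h3 := (Nat.cast_inj (R := ℝ)).2 h2
    push_cast at h3
    have h4 : (1 / 2 : ℝ) ^ e * 2 ^ r ≤ δ * 2 ^ r := by gcongr
    -- Every string whose walk meets a good pair leads to success, so the complement of the bad
    -- strings gives the bound.
    refine le_trans (by linarith) (Nat.cast_le.2 (Nat.card_le_card_of_injective
      (Subtype.map id fun ω hω => ?_) (Subtype.map_injective _ Function.injective_id)))
    obtain ⟨out, t, h5, -, -, h6⟩ := hrun (List.ofFn ω) (by rw [List.length_ofFn]; omega)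
    exact ⟨out, t, h5, hsucc (h6 hω)⟩
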